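/- **Setting.** One divisible good is sold to $n\ge 1$ bidders whose values are drawn independently from the same distribution on a value space $V$. The function $c:[0,\infty)\to[0,\infty)$ is convex and strictly increasing with $c(0)=0$, and $c^{-1}$ is its inverse. A mechanism consists of measurable functions $x:V^n\to[0,1]^n$ (allocations) and $p:V^n\to[0,\infty)^n$ (payments). Its interim allocations are $\hat x_i(t)=\mathbb E_{v_{-i}}[x_i(t,v_{-i})]$ and its interim perceived payments are $\hat c_i(t)=\mathbb E_{v_{-i}}[c(p_i(t,v_{-i}))]$, which are required to be finite. It is *admissible* if it is * Bayesian incentive compatible: $v\hat x_i(v)-\hat c_i(v)\ge v\hat x_i(w)-\hat c_i(w)$ for all $i$ and all $v,w\in V$; * interim individually rational: $v\hat x_i(v)-\hat c_i(v)\ge 0$ for all $i$ and all $v\in V$; * ex-post feasible: $\sum_i x_i(v)\le 1$ for all $v\in V^n$. Its revenue is $\mathbb E_v[\sum_i p_i(v)]$. An *optimal auction* is an admissible mechanism of maximal revenue. **Continuous values.** Let $V=[0,1]$, and let the values have a density $f$ that is continuous on $[0,1]$ and strictly positive on $(0,1)$, with distribution function $F$. Consider the program $$\sup_{z}\ \mathrm{Obj}(z)=\int_0^1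 f(t)\,c^{-1}\Big(\int_0^t\tau z(\tau)\,d\tau\Big)dt$$ over integrable $z:[0,1]\to\mathbb R$ subject to $$\int_0^1 z(\tau)\,\big(1-F(\max\{t,\tau\})\big)\,d\tau\le\frac{1-F(t)^n}{n}\quad\text{for all } t\in[0,1],\qquad z(\tau)\ge 0\quad\text{for all }\tau\in[0,1].$$ Then: 1. The program has a finite supremum, an optimal auction exists, and its revenue is $n$ times this supremum. 2. For every feasible $z$ there is an admissible mechanism with $\hat x_i(t)=\int_0^t z(\tau)\,d\tau$ and $p_i(v)=c^{-1}\big(\int_0^{v_i}\tau z(\tau)\,d\tau\big)$ for all $i$, $t$ and $v$, and its revenue is $n\,\mathrm{Obj}(z)$. 3. Conversely, if $M$ is an admissible mechanism and $z\ge 0$ is integrable with $\frac1n\sum_i\hat x_i(t)=\int_0^t z(\tau)\,d\tau$ for all $t\in[0,1]$, then $z$ is feasible and the revenue of $M$ is at most $n\,\mathrm{Obj}(z)$. 4. A function $z$ is an optimal solution of the program if and only if $z$ is integrable, $z\ge 0$ on $[0,1]$, and some optimal auction satisfies $\hat x_i(t)=\int_0^t z(\tau)\,d\tau$ for all $i$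 and all $t\in[0,1]$. **Discrete values.** Let $V=\{1,\dots,m\}$, and let the values have a probability mass function $f>0$ on $V$. Put $F(t)=\sum_{k=1}^t f(k)$, $F(0)=0$, and $$y(t)=\sum_{k=0}^{n-1}\binom{n-1}{k}\frac1{k+1}\Big(\sum_{\tau=1}^{t-1}f(\tau)\Big)^{n-1-k}f(t)^k$$ (with $0^0=1$). Consider the program $$\max_z\ \mathrm{Obj}(z)=\sum_{t=1}^m f(t)\,c^{-1}\Big(\sum_{\tau=1}^t\tau z(\tau)\Big)$$ subject to $$\sum_{\tau=1}^m z(\tau)\,\big(1-F(\max\{t,\tau\}-1)\big)\le\sum_{q=t}^m f(q)\,y(q),\qquad z(t)\ge 0\qquad\text{for all } t\in V.$$ Then: 1. The maximum of the program is attained, an optimal auction exists, and its revenue is $n$ times this maximum. 2. For every feasible $z$ there is an admissible mechanism with $\hat x_i(t)=\sum_{\tau=1}^t z(\tau)$ and $p_i(v)=c^{-1}\big(\sum_{\tau=1}^{v_i}\tau z(\tau)\big)$ for all $i$, $t$ and $v$, and its revenue is $n\,\mathrm{Obj}(z)$. 3. Conversely, if $M$ is an admissible mechanism and $\frac1n\sum_i\hat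 x_i(t)=\sum_{\tau=1}^t z(\tau)$ for all $t\in V$, then $z$ is feasible and the revenue of $M$ is at most $n\,\mathrm{Obj}(z)$. 4. A function $z$ is an optimal solution of the program if and only if some optimal auction satisfies $\hat x_i(t)=\sum_{\tau=1}^t z(\tau)$ for all $i$ and all $t\in V$. -/

import Mathlib

open MeasureTheory Set

noncomputable section

namespace ConvexAuction

/-! ### Auctions with `n` bidders, value space `V ⊆ ℝ`, values i.i.d. with law `μ`
(a probability measure carried by `V`), and perceived payment function `c` -/

/-- A direct mechanism: an allocation rule and a payment rule, as functions of the reported value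
profile. Only their restrictions to profiles in `V ^ n` matter. -/
structure Mechanism (n : ℕ) where
  /-- `alloc v i` is the share of the good that bidder `i` receives at the profile `v`. -/
  alloc : (Fin n → ℝ) → Fin n → ℝ
  /-- `pay v i` is the (actual) payment of bidder `i` at the profile `v`. -/
  pay : (Fin n → ℝ) → Fin n → ℝ

/-- The joint law of the value profile: independent values with law `μ`. -/
def profileLaw (n : ℕ) (μ : Measure ℝ) : Measure (Fin n → ℝ) :=
  Measure.pi fun _ => μ

/-- Interim allocation of bidder `i` with report `t`: the expectation of `alloc (t, v₋ᵢ) i`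
over the values `v₋ᵢ` of the other bidders (coordinate `i` of `v` is overwritten by `t`). -/
def interimAlloc {n : ℕ} (μ : Measure ℝ) (M : Mechanism n) (i : Fin n) (t : ℝ) : ℝ :=
  ∫ v, M.alloc (Function.update v i t) i ∂(profileLaw n μ)

/-- Interim perceived payment of bidder `i` with report `t`. -/
def interimCost {n : ℕ} (μ : Measure ℝ) (c : ℝ → ℝ) (M : Mechanism n) (i : Fin n) (t : ℝ) : ℝ :=
  ∫ v, c (M.pay (Function.update v i t) i) ∂(profileLaw n μ)

/-- Well-formed mechanisms: measurable rules, shares in `[0, 1]`, nonnegative payments, and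
interim perceived payments that exist as finite expectations. -/
structure WellFormed {n : ℕ} (V : Set ℝ) (μ : Measure ℝ) (c : ℝ → ℝ) (M : Mechanism n) :
    Prop where
  measurable_alloc : ∀ i, Measurable fun v => M.alloc v i
  measurable_pay : ∀ i, Measurable fun v => M.pay v i
  alloc_mem : ∀ v, (∀ j, v j ∈ V) → ∀ i, M.alloc v i ∈ Icc (0 : ℝ) 1
  pay_nonneg : ∀ v, (∀ j, v j ∈ V) → ∀ i, 0 ≤ M.pay v i
  integrable_cost : ∀ i, ∀ t ∈ V,
    Integrable (fun v => c (M.pay (Function.update v i t) i)) (profileLaw n μ)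

/-- Bayesian incentive compatibility. -/
def BIC {n : ℕ} (V : Set ℝ) (μ : Measure ℝ) (c : ℝ → ℝ) (M : Mechanism n) : Prop :=
  ∀ i, ∀ v ∈ V, ∀ w ∈ V,
    v * interimAlloc μ M i w - interimCost μ c M i w ≤
      v * interimAlloc μ M i v - interimCost μ c M i v

/-- Interim individual rationality. -/
def IIR {n : ℕ} (V : Set ℝ) (μ : Measure ℝ) (c : ℝ → ℝ) (M : Mechanism n) : Prop :=
  ∀ i, ∀ v ∈ V, 0 ≤ v * interimAlloc μ M i v - interimCost μ c M i v

/-- Ex-post feasibility: the good is never overallocated. -/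
def XP {n : ℕ} (V : Set ℝ) (M : Mechanism n) : Prop :=
  ∀ v, (∀ j, v j ∈ V) → ∑ i, M.alloc v i ≤ 1

/-- The auctions over which the auctioneer optimizes. -/
structure IsAdmissible {n : ℕ} (V : Set ℝ) (μ : Measure ℝ) (c : ℝ → ℝ) (M : Mechanism n) :
    Prop where
  wellFormed : WellFormed V μ c M
  bic : BIC V μ c M
  iir : IIR V μ c M
  xp : XP V M

/-- Total expected revenue (actual payments). -/
def revenue {n : ℕ} (μ : Measure ℝ) (M : Mechanism n) : ℝ :=
  ∫ v, ∑ i, M.pay v i ∂(profileLaw n μ)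

/-- An optimal auction: it maximizes expected revenue among all BIC, IIR and XP mechanisms. -/
def IsOptimalAuction {n : ℕ} (V : Set ℝ) (μ : Measure ℝ) (c : ℝ → ℝ) (M : Mechanism n) : Prop :=
  IsAdmissible V μ c M ∧ ∀ M' : Mechanism n, IsAdmissible V μ c M' → revenue μ M' ≤ revenue μ M

/-- The inverse of the payment function `c` on `[0, ∞)`. -/
def costInv (c : ℝ → ℝ) : ℝ → ℝ :=
  Function.invFunOn c (Ici 0)

/-! ### The continuous program -/

/-- The distribution on `[0, 1]` with density `f`. -/
def densityLaw (f : ℝ → ℝ) : Measure ℝ :=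
  (volume.restrict (Icc 0 1)).withDensity fun t => ENNReal.ofReal (f t)

/-- The cumulative distribution function of `densityLaw f` on `[0, 1]`. -/
def densityCdf (f : ℝ → ℝ) (t : ℝ) : ℝ :=
  ∫ s in (0 : ℝ)..t, f s

/-- Feasible solutions `z : [0, 1] → ℝ` of the continuous program. -/
structure ContFeasible (n : ℕ) (f z : ℝ → ℝ) : Prop where
  integrable : IntervalIntegrable z volume 0 1
  nonneg : ∀ τ ∈ Icc (0 : ℝ) 1, 0 ≤ z τ
  border : ∀ t ∈ Icc (0 : ℝ) 1,
    ∫ τ in (0 : ℝ)..1, z τ * (1 - densityCdf f (max t τ)) ≤ (1 - densityCdf f t ^ n) / n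

/-- The objective of the continuous program. -/
def contObjective (c f z : ℝ → ℝ) : ℝ :=
  ∫ t in (0 : ℝ)..1, f t * costInv c (∫ τ in (0 : ℝ)..t, τ * z τ)

/-- Optimal solutions of the continuous program. -/
def ContSolution (n : ℕ) (c f z : ℝ → ℝ) : Prop :=
  ContFeasible n f z ∧ ∀ z', ContFeasible n f z' → contObjective c f z' ≤ contObjective c f z

/-! ### The discrete program -/

/-- The value space `{1, …, m}`. -/
def discValues (m : ℕ) : Set ℝ :=
  (fun t : ℕ => (t : ℝ)) '' Icc 1 m

/-- The distribution on `{1, …, m}` with probability mass function `f`. -/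
def massLaw (m : ℕ) (f : ℕ → ℝ) : Measure ℝ :=
  ∑ t ∈ Finset.Icc 1 m, ENNReal.ofReal (f t) • Measure.dirac (t : ℝ)

/-- The cumulative distribution function of `massLaw m f` on `{0, …, m}`. -/
def massCdf (f : ℕ → ℝ) (t : ℕ) : ℝ :=
  ∑ k ∈ Finset.Icc 1 t, f k

/-- The interim allocation of a bidder with value `t` when the good goes to the highest value,
with uniform tie-breaking. -/
def topAlloc (n : ℕ) (f : ℕ → ℝ) (t : ℕ) : ℝ :=
  ∑ k ∈ Finset.range n,
    ((n - 1).choose k : ℝ) * (1 / ((k : ℝ) + 1)) *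
      (∑ τ ∈ Finset.Icc 1 (t - 1), f τ) ^ (n - 1 - k) * f t ^ k

/-- Feasible solutions `z : {1, …, m} → ℝ` of the discrete program. -/
structure DiscFeasible (n m : ℕ) (f z : ℕ → ℝ) : Prop where
  nonneg : ∀ τ ∈ Finset.Icc 1 m, 0 ≤ z τ
  border : ∀ t ∈ Finset.Icc 1 m,
    ∑ τ ∈ Finset.Icc 1 m, z τ * (1 - massCdf f (max t τ - 1)) ≤
      ∑ q ∈ Finset.Icc t m, f q * topAlloc n f q

/-- The objective of the discrete program. -/
def discObjective (m : ℕ) (c : ℝ → ℝ) (f z : ℕ → ℝ) : ℝ :=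
  ∑ t ∈ Finset.Icc 1 m, f t * costInv c (∑ τ ∈ Finset.Icc 1 t, (τ : ℝ) * z τ)

/-- Optimal solutions of the discrete program. -/
def DiscSolution (n m : ℕ) (c : ℝ → ℝ) (f z : ℕ → ℝ) : Prop :=
  DiscFeasible n m f z ∧
    ∀ z', DiscFeasible n m f z' → discObjective m c f z' ≤ discObjective m c f z

end ConvexAuction

end

open ConvexAuction

noncomputable section

namespace ConvexAuction

/-! ### Convex payment functions and their inverses -/

/-- Convex, strictly increasing functions on `[0, ∞)` that vanish at `0`. -/
structure IsCost (c : ℝ → ℝ) : Prop where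
  convex : ConvexOn ℝ (Ici 0) c
  mono : StrictMonoOn c (Ici 0)
  zero : c 0 = 0

namespace IsCost

variable {c : ℝ → ℝ}

theorem nonneg (hc : IsCost c) {x : ℝ} (hx : 0 ≤ x) : 0 ≤ c x := by
  have := hc.mono.monotoneOn (mem_Ici.2 le_rfl) (mem_Ici.2 hx) hx
  rwa [hc.zero] at this

theorem one_pos (hc : IsCost c) : 0 < c 1 := by
  have := hc.mono (mem_Ici.2 le_rfl) (mem_Ici.2 zero_le_one) zero_lt_one
  rwa [hc.zero] at this

theorem map_mul_le (hc : IsCost c) {a x : ℝ} (ha : 0 ≤ a) (ha1 : a ≤ 1) (hx : 0 ≤ x) :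
    c (a * x) ≤ a * c x := by
  have := hc.convex.2 (mem_Ici.2 hx) (mem_Ici.2 le_rfl) ha (sub_nonneg.2 ha1) (by ring)
  simpa [hc.zero] using this

theorem le_mul_one (hc : IsCost c) {x : ℝ} (hx : 0 ≤ x) (hx1 : x ≤ 1) : c x ≤ x * c 1 := by
  simpa using hc.map_mul_le hx hx1 zero_le_one

theorem mul_one_le (hc : IsCost c) {x : ℝ} (hx : 1 ≤ x) : x * c 1 ≤ c x := by
  have hx0 : 0 < x := by linarith
  have := hc.map_mul_le (inv_nonneg.2 hx0.le) (inv_le_one_of_one_le₀ hx) hx0.le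
  rw [inv_mul_cancel₀ hx0.ne'] at this
  calc x * c 1 ≤ x * (x⁻¹ * c x) := by gcongr
    _ = c x := by field_simp

/-- Payments are thus integrable as soon as perceived payments are. -/
theorem le_one_add_div (hc : IsCost c) {x : ℝ} (hx : 0 ≤ x) : x ≤ 1 + c x / c 1 := by
  rcases le_total x 1 with h | h
  · have := div_nonneg (hc.nonneg hx) hc.one_pos.le
    linarith
  · have := (le_div_iff₀ hc.one_pos).2 (hc.mul_one_le h)
    linarith

/-- Convexity gives continuity only in the interior; at the endpoint `0` the squeeze `0 ≤ c x ≤ x *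
c 1` does. -/
theorem continuousOn (hc : IsCost c) : ContinuousOn c (Ici 0) := by
  intro x hx
  rcases eq_or_lt_of_le (mem_Ici.1 hx) with rfl | h
  · have h1 : Filter.Tendsto (fun x => x * c 1) (nhdsWithin 0 (Ici 0)) (nhds 0) := by
      have : ContinuousWithinAt (fun x => x * c 1) (Ici 0) 0 := by fun_prop
      simpa [ContinuousWithinAt] using this
    have h2 : Filter.Tendsto c (nhdsWithin 0 (Ici 0)) (nhds 0) := by
      refine tendsto_of_tendsto_of_tendsto_of_le_of_le' tendsto_const_nhds h1 ?_ ?_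
      · filter_upwards [self_mem_nhdsWithin] with y hy using hc.nonneg hy
      · filter_upwards [self_mem_nhdsWithin, nhdsWithin_le_nhds (Iic_mem_nhds zero_lt_one)]
          with y hy hy1 using hc.le_mul_one hy hy1
    simpa [ContinuousWithinAt, hc.zero] using h2
  · have := hc.convex.continuousOn_interior
    rw [interior_Ici] at this
    exact (this.continuousAt (Ioi_mem_nhds h)).continuousWithinAt

theorem exists_eq (hc : IsCost c) {y : ℝ} (hy : 0 ≤ y) : ∃ x, 0 ≤ x ∧ c x = y := by
  set b := max 1 (y / c 1)
  have hb : y ≤ c b := by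
    calc y ≤ b * c 1 := (div_le_iff₀ hc.one_pos).1 (le_max_right _ _)
      _ ≤ c b := hc.mul_one_le (le_max_left _ _)
  have hb0 : 0 ≤ b := zero_le_one.trans (le_max_left _ _)
  have := intermediate_value_Icc hb0 (hc.continuousOn.mono Icc_subset_Ici_self)
  rw [hc.zero] at this
  obtain ⟨x, hx, rfl⟩ := this ⟨hy, hb⟩
  exact ⟨x, hx.1, rfl⟩

theorem costInv_nonneg (hc : IsCost c) {y : ℝ} (hy : 0 ≤ y) : 0 ≤ costInv c y :=
  Function.invFunOn_mem (hc.exists_eq hy)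

theorem apply_costInv (hc : IsCost c) {y : ℝ} (hy : 0 ≤ y) : c (costInv c y) = y :=
  Function.invFunOn_eq (hc.exists_eq hy)

theorem le_costInv (hc : IsCost c) {x y : ℝ} (hx : 0 ≤ x) (h : c x ≤ y) : x ≤ costInv c y := by
  have hy := (hc.nonneg hx).trans h
  rw [← hc.apply_costInv hy] at h
  exact (hc.mono.le_iff_le hx (hc.costInv_nonneg hy)).1 h

theorem costInv_mono (hc : IsCost c) {x y : ℝ} (hx : 0 ≤ x) (h : x ≤ y) :
    costInv c x ≤ costInv c y :=
  hc.le_costInv (hc.costInv_nonneg hx) (by rwa [hc.apply_costInv hx])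

theorem concaveOn_costInv (hc : IsCost c) : ConcaveOn ℝ (Ici 0) (costInv c) := by
  refine ⟨convex_Ici 0, fun x hx y hy a b ha hb hab => ?_⟩
  have hx' := hc.costInv_nonneg hx
  have hy' := hc.costInv_nonneg hy
  refine hc.le_costInv (add_nonneg (mul_nonneg ha hx') (mul_nonneg hb hy')) ?_
  have := hc.convex.2 hx' hy' ha hb hab
  rwa [hc.apply_costInv hx, hc.apply_costInv hy] at this

/-- The cost function, extended to an order isomorphism of `ℝ` by the identity. -/
def orderIso (hc : IsCost c) : ℝ ≃o ℝ :=
  StrictMono.orderIsoOfSurjective (fun x => if 0 ≤ x then c x else x)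
    (by
      intro x y h
      dsimp only
      split_ifs with hx hy hy
      · exact hc.mono hx hy h
      · linarith
      · linarith [hc.nonneg hy]
      · exact h)
    (by
      intro y
      by_cases hy : 0 ≤ y
      · obtain ⟨x, hx, rfl⟩ := hc.exists_eq hy
        exact ⟨x, if_pos hx⟩
      · exact ⟨y, if_neg hy⟩)

theorem orderIso_apply (hc : IsCost c) {x : ℝ} (hx : 0 ≤ x) : hc.orderIso x = c x := if_pos hx

/-- `costInv c` is unspecified at negative arguments; continuity and measurability are borrowed from
this globally continuous inverse. -/
theorem orderIso_symm_apply (hc : IsCost c) {y : ℝ} (hy : 0 ≤ y) :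
    hc.orderIso.symm y = costInv c y := by
  rw [OrderIso.symm_apply_eq, hc.orderIso_apply (hc.costInv_nonneg hy), hc.apply_costInv hy]

theorem continuous_orderIso_symm (hc : IsCost c) : Continuous hc.orderIso.symm :=
  hc.orderIso.symm.continuous

end IsCost

/-! ### Decreasing sequences of convex sets in Hilbert spaces -/

section Hilbert

open Filter Topology

variable {H : Type*} [NormedAddCommGroup H] [InnerProductSpace ℝ H] [CompleteSpace H]

/-- A decreasing sequence of nonempty convex sets that are bounded in a Hilbert space admits a
convergent choice of elements. -/
theorem exists_tendsto_of_antitone_convex (D : ℕ → Set H) (hD : Antitone D)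
    (hconv : ∀ k, Convex ℝ (D k)) (hne : ∀ k, (D k).Nonempty) {R : ℝ}
    (hR : ∀ x ∈ D 0, ‖x‖ ≤ R) :
    ∃ (u : ℕ → H) (x : H), (∀ k, u k ∈ D k) ∧ Tendsto u atTop (𝓝 x) := by
  set ρ : ℕ → ℝ := fun k => sInf (norm '' D k) with hρ
  have hbdd : ∀ k, BddBelow (norm '' D k) := fun k => ⟨0, by rintro _ ⟨x, -, rfl⟩; positivity⟩
  have hle : ∀ k, ∀ x ∈ D k, ρ k ≤ ‖x‖ := fun k x hx => csInf_le (hbdd k) ⟨x, hx, rfl⟩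
  have hρ0 : ∀ k, 0 ≤ ρ k := fun k => Real.sInf_nonneg (by rintro _ ⟨x, -, rfl⟩; positivity)
  have hmono : Monotone ρ := fun i j hij =>
    csInf_le_csInf (hbdd i) ((hne j).image _) (image_mono (hD hij))
  have hρR : ∀ k, ρ k ≤ R := fun k => by
    obtain ⟨x, hx⟩ := hne k
    exact (hle k x hx).trans (hR x (hD (Nat.zero_le k) hx))
  obtain ⟨L, hL⟩ : ∃ L, Tendsto ρ atTop (𝓝 L) :=
    ⟨_, tendsto_atTop_ciSup hmono ⟨R, by rintro _ ⟨k, rfl⟩; exact hρR k⟩⟩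
  have hρL : ∀ k, ρ k ≤ L := fun k => hmono.ge_of_tendsto hL k
  -- Elements of almost minimal norm; they will form a Cauchy sequence because the minimal norms `ρ
  -- k` converge.
  have hex : ∀ k : ℕ, ∃ x ∈ D k, ‖x‖ < ρ k + 1 / ((k : ℝ) + 1) := fun k => by
    obtain ⟨_, ⟨x, hx, rfl⟩, h⟩ := exists_lt_of_csInf_lt ((hne k).image norm)
      (lt_add_of_pos_right (ρ k) (by positivity : (0 : ℝ) < 1 / ((k : ℝ) + 1)))
    exact ⟨x, hx, h⟩
  choose u hu hun using hex
  have hL0 : 0 ≤ L := (hρ0 0).trans (hρL 0)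
  set b : ℕ → ℝ := fun k => 4 * ((L + 1 / ((k : ℝ) + 1)) ^ 2 - ρ k ^ 2) with hb
  have hb0 : Tendsto b atTop (𝓝 0) := by
    have h1 : Tendsto (fun k : ℕ => L + 1 / ((k : ℝ) + 1)) atTop (𝓝 (L + 0)) :=
      tendsto_const_nhds.add tendsto_one_div_add_atTop_nhds_zero_nat
    have := ((h1.pow 2).sub (hL.pow 2)).const_mul 4
    rwa [add_zero, sub_self, mul_zero] at this
  -- The midpoint of `u i` and `u j` lies in `D i`, so its norm is at least `ρ i`; the parallelogram
  -- law turns this into a bound on the distance.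
  have hdist : ∀ i j, i ≤ j → ‖u i - u j‖ ^ 2 ≤ b i := by
    intro i j hij
    have hmid : ρ i ≤ ‖(1 / 2 : ℝ) • u i + (1 / 2 : ℝ) • u j‖ :=
      hle i _ (hconv i (hu i) (hD hij (hu j)) (by norm_num) (by norm_num) (by norm_num))
    have hmid' : 2 * ρ i ≤ ‖u i + u j‖ := by
      rw [← smul_add, norm_smul] at hmid
      norm_num at hmid
      linarith
    have hpar := parallelogram_law_with_norm ℝ (u i) (u j)
    have hk : ∀ k, i ≤ k → ‖u k‖ ≤ L + 1 / ((i : ℝ) + 1) := fun k hk => by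
      have h1 := (hun k).le
      have h2 := hρL k
      have h3 : (1 : ℝ) / ((k : ℝ) + 1) ≤ 1 / ((i : ℝ) + 1) := by gcongr
      linarith
    have h1 := pow_le_pow_left₀ (norm_nonneg _) (hk i le_rfl) 2
    have h2 := pow_le_pow_left₀ (norm_nonneg _) (hk j hij) 2
    have h3 := pow_le_pow_left₀ (mul_nonneg zero_le_two (hρ0 i)) hmid' 2
    simp only [hb]
    nlinarith
  have hcauchy : CauchySeq u := by
    refine cauchySeq_of_le_tendsto_0 (fun k => 2 * √(b k)) (fun i j N hi hj => ?_) ?_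
    · have h1 : ‖u N - u i‖ ≤ √(b N) := Real.le_sqrt_of_sq_le (hdist N i hi)
      have h2 : ‖u N - u j‖ ≤ √(b N) := Real.le_sqrt_of_sq_le (hdist N j hj)
      rw [← dist_eq_norm] at h1 h2
      calc dist (u i) (u j) ≤ dist (u N) (u i) + dist (u N) (u j) := dist_triangle_left _ _ _
        _ ≤ 2 * √(b N) := by linarith
    · simpa using (hb0.sqrt).const_mul 2
  obtain ⟨x, hx⟩ := cauchySeq_tendsto_of_complete hcauchy
  exact ⟨u, x, hu, hx⟩

/-- A point `y` is the image of a closed bounded convex set under the adjoint of `S` as soon as no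
`φ` separates it from that image. -/
theorem exists_mem_forall_inner_eq {E : Type*} [NormedAddCommGroup E] [InnerProductSpace ℝ E]
    [CompleteSpace E] (S : E →L[ℝ] H) (K : Set H) (hconv : Convex ℝ K) (hclosed : IsClosed K)
    (hne : K.Nonempty) {R : ℝ} (hR : ∀ k ∈ K, ‖k‖ ≤ R) (y : E)
    (h : ∀ φ : E, ∃ k ∈ K, inner ℝ φ y ≤ inner ℝ (S φ) k) :
    ∃ k ∈ K, ∀ φ : E, inner ℝ (S φ) k = inner ℝ φ y := by
  set T := ContinuousLinearMap.adjoint S with hT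
  have hadj : ∀ φ k, inner ℝ (S φ) k = inner ℝ φ (T k) := fun φ k =>
    (ContinuousLinearMap.adjoint_inner_right S φ k).symm
  -- If the projection `w` of `y` onto the closed image differed from `y`, then `φ = y - w` would
  -- separate.
  have hy : y ∈ closure (T '' K) := by
    have hconvT : Convex ℝ (closure (T '' K)) := (hconv.linear_image T.toLinearMap).closure
    obtain ⟨w, hw, hmin⟩ := exists_norm_eq_iInf_of_complete_convex
      (hne.image T).closure isClosed_closure.isComplete hconvT y
    rw [norm_eq_iInf_iff_real_inner_le_zero hconvT hw] at hmin
    obtain ⟨k, hk, hle⟩ := h (y - w)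
    have h1 := hmin (T k) (subset_closure ⟨k, hk, rfl⟩)
    rw [hadj] at hle
    have h2 : inner ℝ (y - w) (y - w) ≤ 0 := by
      rw [inner_sub_right] at h1 ⊢
      linarith
    have h3 : y - w = 0 := by
      rwa [real_inner_self_eq_norm_sq, sq_nonpos_iff, norm_eq_zero] at h2
    rwa [sub_eq_zero.1 h3]
  -- Approximate preimages of `y` form decreasing convex sets; a convergent choice from them does
  -- the work of weak compactness of `K`.
  set D : ℕ → Set H := fun j => K ∩ {k | ‖T k - y‖ ≤ 1 / ((j : ℝ) + 1)} with hDdef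
  have hball : ∀ r, Convex ℝ {k | ‖T k - y‖ ≤ r} := fun r => by
    have := (convex_closedBall y r).linear_preimage T.toLinearMap
    convert this using 1
    ext k
    simp [dist_eq_norm]
  obtain ⟨u, x, hu, hux⟩ := exists_tendsto_of_antitone_convex D
    (fun i j hij k hk => ⟨hk.1, le_trans (show ‖T k - y‖ ≤ _ from hk.2) (Nat.one_div_le_one_div hij)⟩)
    (fun j => hconv.inter (hball _))
    (fun j => by
      obtain ⟨_, ⟨k, hk, rfl⟩, hd⟩ := Metric.mem_closure_iff.1 hy (1 / ((j : ℝ) + 1))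
        (by positivity)
      refine ⟨k, hk, ?_⟩
      rw [dist_comm, dist_eq_norm] at hd
      exact hd.le)
    (fun k hk => hR k hk.1)
  have hxK : x ∈ K := hclosed.mem_of_tendsto hux (Eventually.of_forall fun j => (hu j).1)
  have hTx : T x = y := by
    have h1 : Tendsto (fun j => ‖T (u j) - y‖) atTop (𝓝 ‖T x - y‖) :=
      (((T.continuous.tendsto x).comp hux).sub_const y).norm
    have h2 := le_of_tendsto_of_tendsto' h1 tendsto_one_div_add_atTop_nhds_zero_nat
      fun j => (hu j).2
    exact sub_eq_zero.1 (norm_le_zero_iff.1 h2)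
  exact ⟨x, hxK, fun φ => by rw [hadj, hTx]⟩

end Hilbert

/-! ### Overwriting one coordinate of the profile -/

section Update

variable {n : ℕ} (μ : Measure ℝ) [IsProbabilityMeasure μ]

instance : IsProbabilityMeasure (profileLaw n μ) := by
  unfold profileLaw; infer_instance

theorem measurable_update_pair (i : Fin n) :
    Measurable fun p : ℝ × (Fin n → ℝ) => Function.update p.2 i p.1 := by
  refine measurable_pi_lambda _ fun j => ?_
  by_cases h : j = i
  · subst h
    simpa using measurable_fst
  · simp only [Function.update_of_ne h]
    exact (measurable_pi_apply j).comp measurable_snd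

/-- Resampling one independent coordinate does not change the joint law. Hence interim expectations,
defined by overwriting a coordinate, are the sections in Fubini's theorem. -/
theorem measurePreserving_update (i : Fin n) :
    MeasurePreserving (fun p : ℝ × (Fin n → ℝ) => Function.update p.2 i p.1)
      (μ.prod (profileLaw n μ)) (profileLaw n μ) := by
  refine ⟨measurable_update_pair i, ?_⟩
  symm
  refine Measure.pi_eq fun s hs => ?_
  rw [Measure.map_apply (measurable_update_pair i) (MeasurableSet.univ_pi hs)]
  have hpre : (fun p : ℝ × (Fin n → ℝ) => Function.update p.2 i p.1) ⁻¹' univ.pi s =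
      s i ×ˢ univ.pi (Function.update s i univ) := by
    ext ⟨t, v⟩
    simp only [mem_preimage, mem_univ_pi, mem_prod]
    constructor
    · intro h
      refine ⟨by simpa using h i, fun j => ?_⟩
      by_cases hj : j = i
      · subst hj; simp
      · simpa [Function.update_of_ne hj] using h j
    · rintro ⟨h1, h2⟩ j
      by_cases hj : j = i
      · subst hj; simpa using h1
      · simpa [Function.update_of_ne hj] using h2 j
  rw [hpre, Measure.prod_prod, profileLaw, Measure.pi_pi,
    ← Finset.mul_prod_erase _ _ (Finset.mem_univ i),
    ← Finset.mul_prod_erase (a := i) _ (fun j => μ (s j)) (Finset.mem_univ i)]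
  simp only [Function.update_self, measure_univ, one_mul]
  congr 1
  exact Finset.prod_congr rfl fun j hj => by rw [Function.update_of_ne (Finset.ne_of_mem_erase hj)]

variable {μ}

theorem integrable_update_pair {g : (Fin n → ℝ) → ℝ} (hg : Integrable g (profileLaw n μ))
    (i : Fin n) :
    Integrable (fun p : ℝ × (Fin n → ℝ) => g (Function.update p.2 i p.1))
      (μ.prod (profileLaw n μ)) :=
  (measurePreserving_update μ i).integrable_comp_of_integrable hg

/-- Fubini: the expectation of `g` is computed by first fixing the value of bidder `i`. -/
theorem integral_eq_integral_update {g : (Fin n → ℝ) → ℝ} (hg : Integrable g (profileLaw n μ))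
    (i : Fin n) :
    ∫ v, g v ∂(profileLaw n μ) =
      ∫ t, ∫ v, g (Function.update v i t) ∂(profileLaw n μ) ∂μ := by
  rw [← integral_prod _ (integrable_update_pair hg i)]
  conv_lhs => rw [← (measurePreserving_update μ i).map_eq]
  refine integral_map (measurable_update_pair i).aemeasurable ?_
  rw [(measurePreserving_update μ i).map_eq]
  exact hg.aestronglyMeasurable

theorem measurePreserving_eval_profile (i : Fin n) :
    MeasurePreserving (fun v : Fin n → ℝ => v i) (profileLaw n μ) μ :=
  measurePreserving_eval (fun _ => μ) i

theorem ae_profile_of_ae {P : ℝ → Prop} (h : ∀ᵐ t ∂μ, P t) :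
    ∀ᵐ v ∂(profileLaw n μ), ∀ j, P (v j) :=
  ae_all_iff.2 fun j => (measurePreserving_eval_profile j).quasiMeasurePreserving.ae h

end Update

/-! ### Border's inequality for all sets -/

/-- The power function is convex on `[0, ∞)` and lies above its tangent at `y`; with `y = 1` this is
Bernoulli's inequality. -/
theorem pow_tangent_le {x y : ℝ} (hx : 0 ≤ x) (hy : 0 ≤ y) (n : ℕ) :
    y ^ n + n * y ^ (n - 1) * (x - y) ≤ x ^ n := by
  induction n with
  | zero => simp
  | succ k ih =>
    have h1 := mul_le_mul_of_nonneg_left ih hx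
    rcases k with _ | k
    · simp
    · simp only [Nat.add_sub_cancel] at h1 ⊢
      have h2 : 0 ≤ ((k : ℝ) + 1) * y ^ k * (x - y) ^ 2 := by positivity
      push_cast at h1 ⊢
      calc y ^ (k + 1 + 1) + ((k : ℝ) + 1 + 1) * y ^ (k + 1) * (x - y)
          = x * (y ^ (k + 1) + ((k : ℝ) + 1) * y ^ k * (x - y))
            - ((k : ℝ) + 1) * y ^ k * (x - y) ^ 2 := by ring
        _ ≤ x * x ^ (k + 1) := by linarith
        _ = x ^ (k + 1 + 1) := by ring

theorem prod_le_mean_pow {n : ℕ} (hn : 1 ≤ n) (b : Fin n → ℝ) (hb : ∀ i, 0 ≤ b i) :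
    ∏ i, b i ≤ ((∑ i, b i) / n) ^ n := by
  have hn0 : (n : ℝ) ≠ 0 := by positivity
  have h := Real.geom_mean_le_arith_mean Finset.univ (fun _ => (1 : ℝ)) b
    (fun _ _ => zero_le_one) (by simp; omega) (fun i _ => hb i)
  simp only [Real.rpow_one, one_mul, Finset.sum_const, Finset.card_univ, Fintype.card_fin,
    nsmul_eq_mul, mul_one] at h
  have hp : 0 ≤ ∏ i, b i := Finset.prod_nonneg fun i _ => hb i
  calc ∏ i, b i = ((∏ i, b i) ^ ((n : ℝ)⁻¹)) ^ n := by
        rw [← Real.rpow_natCast, ← Real.rpow_mul hp, inv_mul_cancel₀ hn0, Real.rpow_one]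
    _ ≤ _ := pow_le_pow_left₀ (Real.rpow_nonneg hp _) h n

section SetInequality

variable {μ : Measure ℝ} [IsProbabilityMeasure μ]

/-- A quantile at level `1 - a` of a law without mass to the right of `r` and to the left
of `l`. -/
theorem exists_quantile {l r a : ℝ} (hl : μ (Iio l) = 0) (hr : μ (Ioi r) = 0) (ha : 0 ≤ a)
    (ha1 : a ≤ 1) : ∃ t, μ.real (Ioi t) ≤ a ∧ a ≤ μ.real (Ici t) := by
  set s := {t | l ≤ t ∧ μ.real (Ioi t) ≤ a} with hs
  have hanti : ∀ x y : ℝ, x ≤ y → μ.real (Ioi y) ≤ μ.real (Ioi x) := fun x y h =>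
    measureReal_mono (Ioi_subset_Ioi h)
  have hmem : max l r ∈ s := by
    refine ⟨le_max_left _ _, ?_⟩
    have : μ.real (Ioi r) = 0 := by simp [Measure.real, hr]
    linarith [hanti r (max l r) (le_max_right _ _)]
  have hbdd : BddBelow s := ⟨l, fun t ht => ht.1⟩
  -- The infimum inherits the first bound by continuity from below. Points of `[l, t)` violate that
  -- bound, which yields the second by continuity from above; if `t = l`, then `Ici t` has full
  -- mass.
  set t := sInf s with ht
  have hlt : l ≤ t := le_csInf ⟨_, hmem⟩ fun t ht => ht.1
  refine ⟨t, ?_, ?_⟩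
  · have h1 : Filter.Tendsto (fun k : ℕ => μ.real (Ioi (t + 1 / ((k : ℝ) + 1)))) Filter.atTop
        (nhds (μ.real (⋃ k : ℕ, Ioi (t + 1 / ((k : ℝ) + 1))))) := by
      refine (ENNReal.tendsto_toReal (measure_ne_top _ _)).comp
        (tendsto_measure_iUnion_atTop fun i j hij => Ioi_subset_Ioi ?_)
      have := Nat.one_div_le_one_div (α := ℝ) hij
      linarith
    have h2 : (⋃ k : ℕ, Ioi (t + 1 / ((k : ℝ) + 1))) = Ioi t := by
      ext x
      simp only [mem_iUnion, mem_Ioi]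
      constructor
      · rintro ⟨k, hk⟩
        have : (0 : ℝ) < 1 / ((k : ℝ) + 1) := by positivity
        linarith
      · intro hx
        obtain ⟨k, hk⟩ := exists_nat_one_div_lt (sub_pos.2 hx)
        exact ⟨k, by linarith⟩
    rw [h2] at h1
    refine le_of_tendsto' h1 fun k => ?_
    obtain ⟨y, hy, hyt⟩ := exists_lt_of_csInf_lt ⟨_, hmem⟩
      (lt_add_of_pos_right t (by positivity : (0 : ℝ) < 1 / ((k : ℝ) + 1)))
    exact (hanti y _ hyt.le).trans hy.2
  · rcases eq_or_lt_of_le hlt with h | h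
    · have : μ.real (Ici t) = 1 := by
        rw [← h, ← compl_Iio, probReal_compl_eq_one_sub measurableSet_Iio]
        simp [Measure.real, hl]
      linarith
    · have h1 : Filter.Tendsto (fun k : ℕ => μ.real (Ioi (t - 1 / ((k : ℝ) + 1)))) Filter.atTop
          (nhds (μ.real (⋂ k : ℕ, Ioi (t - 1 / ((k : ℝ) + 1))))) := by
        refine (ENNReal.tendsto_toReal (measure_ne_top _ _)).comp
          (tendsto_measure_iInter_atTop (fun k => measurableSet_Ioi.nullMeasurableSet)
            (fun i j hij => Ioi_subset_Ioi ?_) ⟨0, measure_ne_top _ _⟩)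
        have := Nat.one_div_le_one_div (α := ℝ) hij
        linarith
      have h2 : (⋂ k : ℕ, Ioi (t - 1 / ((k : ℝ) + 1))) = Ici t := by
        ext x
        simp only [mem_iInter, mem_Ioi, mem_Ici]
        constructor
        · intro hx
          by_contra! hlt
          obtain ⟨k, hk⟩ := exists_nat_one_div_lt (sub_pos.2 hlt)
          linarith [hx k]
        · intro hx k
          have : (0 : ℝ) < 1 / ((k : ℝ) + 1) := by positivity
          linarith
      rw [h2] at h1
      have hev : ∀ᶠ k : ℕ in Filter.atTop, l < t - 1 / ((k : ℝ) + 1) := by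
        have : Filter.Tendsto (fun k : ℕ => t - 1 / ((k : ℝ) + 1)) Filter.atTop (nhds (t - 0)) :=
          tendsto_const_nhds.sub tendsto_one_div_add_atTop_nhds_zero_nat
        rw [sub_zero] at this
        exact this.eventually (lt_mem_nhds h)
      refine ge_of_tendsto h1 (hev.mono fun k hk => ?_)
      by_contra! hcon
      have h3 : t ≤ t - 1 / ((k : ℝ) + 1) := csInf_le hbdd ⟨hk.le, hcon.le⟩
      have : (0 : ℝ) < 1 / ((k : ℝ) + 1) := by positivity
      linarith

/-- The data of an interim allocation rule `X` that satisfies Border's inequalities for all upper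
sets. The law `μ` is carried by `[l, r]`. -/
structure BorderRule (n : ℕ) (μ : Measure ℝ) (X : ℝ → ℝ) : Prop where
  bounded : ∃ l r, μ (Iio l) = 0 ∧ μ (Ioi r) = 0
  mono : Monotone X
  mem : ∀ t, X t ∈ Icc (0 : ℝ) 1
  border_Ici : ∀ t, n * ∫ s in Ici t, X s ∂μ ≤ 1 - (1 - μ.real (Ici t)) ^ n
  border_Ioi : ∀ t, n * ∫ s in Ioi t, X s ∂μ ≤ 1 - (1 - μ.real (Ioi t)) ^ n

theorem BorderRule.integrable {n : ℕ} {X : ℝ → ℝ} (hX : BorderRule n μ X) : Integrable X μ := by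
  refine Integrable.of_bound hX.mono.measurable.aestronglyMeasurable 1
    (Filter.Eventually.of_forall fun t => ?_)
  rw [Real.norm_of_nonneg (hX.mem t).1]
  exact (hX.mem t).2

/-- Bathtub principle: `X - θ` is nonnegative on `H` and nonpositive off `H`, so no set gives it a
larger integral than `H`. -/
theorem setIntegral_le_threshold {X : ℝ → ℝ} (hX : Integrable X μ) {A H : Set ℝ}
    (hA : MeasurableSet A) (hH : MeasurableSet H) {θ : ℝ} (h1 : ∀ x ∈ H, θ ≤ X x)
    (h2 : ∀ x ∉ H, X x ≤ θ) :
    ∫ s in A, X s ∂μ ≤ θ * (μ.real A - μ.real H) + ∫ s in H, X s ∂μ := by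
  have hg : Integrable (fun s => X s - θ) μ := hX.sub (integrable_const θ)
  have h : ∫ s in A, (X s - θ) ∂μ ≤ ∫ s in H, (X s - θ) ∂μ := by
    rw [← integral_indicator hA, ← integral_indicator hH]
    refine integral_mono (hg.indicator hA) (hg.indicator hH) fun x => ?_
    by_cases hxA : x ∈ A <;> by_cases hxH : x ∈ H <;> simp [hxA, hxH, h1, h2]
  rw [integral_sub hX.integrableOn (integrable_const θ).integrableOn,
    integral_sub hX.integrableOn (integrable_const θ).integrableOn] at h
  simp only [setIntegral_const, smul_eq_mul] at h
  linarith

/-- By the inequality of arithmetic and geometric means, the product may be replaced by `(1 - a) ^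
n` with `a` the average mass. The sum on the left is then compared with one upper set at the
quantile of level `1 - a`. -/
theorem BorderRule.sum_setIntegral_le {n : ℕ} (hn : 1 ≤ n) {X : ℝ → ℝ} (hX : BorderRule n μ X)
    (A : Fin n → Set ℝ) (hA : ∀ i, MeasurableSet (A i)) :
    ∑ i, ∫ s in A i, X s ∂μ ≤ 1 - ∏ i, (1 - μ.real (A i)) := by
  have hn0 : (0 : ℝ) < n := by positivity
  set a := (∑ i, μ.real (A i)) / n with ha
  have ha_sum : ∑ i, μ.real (A i) = n * a := by rw [ha]; field_simp
  have ha0 : 0 ≤ a := by positivity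
  have ha1 : a ≤ 1 := by
    rw [ha, div_le_one hn0]
    calc ∑ i, μ.real (A i) ≤ ∑ _i : Fin n, (1 : ℝ) :=
          Finset.sum_le_sum fun i _ => measureReal_le_one
      _ = n := by simp
  have hprod : ∏ i, (1 - μ.real (A i)) ≤ (1 - a) ^ n := by
    refine (prod_le_mean_pow hn _ fun i => sub_nonneg.2 measureReal_le_one).trans_eq ?_
    rw [Finset.sum_sub_distrib, ha_sum]
    simp only [Finset.sum_const, Finset.card_univ, Fintype.card_fin, nsmul_eq_mul, mul_one]
    congr 1
    field_simp
  suffices h : ∑ i, ∫ s in A i, X s ∂μ ≤ 1 - (1 - a) ^ n by linarith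
  -- With `h` the mass of `H`, the bathtub principle, Border's inequality at `H` and the tangent of
  -- the `n`-th power at `1 - a` bound the sum by `1 - (1 - a) ^ n + n * (a - h) * (θ - (1 - a) ^ (n
  -- - 1))`; the sign condition discards the last term.
  have key : ∀ H : Set ℝ, MeasurableSet H → ∀ θ : ℝ, (∀ x ∈ H, θ ≤ X x) → (∀ x ∉ H, X x ≤ θ) →
      n * ∫ s in H, X s ∂μ ≤ 1 - (1 - μ.real H) ^ n →
      (a - μ.real H) * (θ - (1 - a) ^ (n - 1)) ≤ 0 →
      ∑ i, ∫ s in A i, X s ∂μ ≤ 1 - (1 - a) ^ n := by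
    intro H hH θ h1 h2 hb hsign
    have hsum := Finset.sum_le_sum fun i (_ : i ∈ Finset.univ) =>
      setIntegral_le_threshold hX.integrable (hA i) hH h1 h2
    simp only [Finset.sum_add_distrib, ← Finset.mul_sum, Finset.sum_sub_distrib, Finset.sum_const,
      Finset.card_univ, Fintype.card_fin, nsmul_eq_mul, ha_sum] at hsum
    have ht := pow_tangent_le (sub_nonneg.2 (measureReal_le_one (μ := μ) (s := H)))
      (sub_nonneg.2 ha1) n
    have := mul_le_mul_of_nonneg_left hsign hn0.le
    nlinarith
  obtain ⟨l, r, hl, hr⟩ := hX.bounded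
  obtain ⟨t, ht1, ht2⟩ := exists_quantile hl hr ha0 ha1
  -- If `t` is an atom, `a` may lie strictly between the masses of `Ioi t` and `Ici t`. The choice
  -- between them makes the two factors of opposite sign.
  rcases le_total (X t) ((1 - a) ^ (n - 1)) with h | h
  · exact key (Ioi t) measurableSet_Ioi (X t) (fun x hx => hX.mono (le_of_lt hx))
      (fun x hx => hX.mono (not_lt.1 hx)) (hX.border_Ioi t)
      (mul_nonpos_of_nonneg_of_nonpos (sub_nonneg.2 ht1) (sub_nonpos.2 h))
  · exact key (Ici t) measurableSet_Ici (X t) (fun x hx => hX.mono hx)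
      (fun x hx => hX.mono (not_le.1 hx).le) (hX.border_Ici t)
      (mul_nonpos_of_nonpos_of_nonneg (sub_nonpos.2 ht2) (sub_nonneg.2 h))

end SetInequality

/-! ### Greedy allocations -/

/-- The whole good goes to the first maximizer of the scores `a`, provided its score is
positive. -/
def greedyShare {n : ℕ} (a : Fin n → ℝ) (i : Fin n) : ℝ :=
  open Classical in
  if 0 < a i ∧ (∀ j < i, a j < a i) ∧ ∀ j, a j ≤ a i then 1 else 0

section Greedy

variable {n : ℕ}

theorem greedyShare_nonneg (a : Fin n → ℝ) (i : Fin n) : 0 ≤ greedyShare a i := by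
  unfold greedyShare; split_ifs <;> norm_num

theorem greedyShare_le_one (a : Fin n → ℝ) (i : Fin n) : greedyShare a i ≤ 1 := by
  unfold greedyShare; split_ifs <;> norm_num

theorem sum_greedyShare_le (a : Fin n → ℝ) : ∑ i, greedyShare a i ≤ 1 := by
  by_cases h : ∃ i, greedyShare a i ≠ 0
  · obtain ⟨i, hi⟩ := h
    rw [Finset.sum_eq_single i]
    · exact greedyShare_le_one a i
    · intro j _ hji
      by_contra hj
      unfold greedyShare at hi hj
      simp only [ne_eq, ite_eq_right_iff, one_ne_zero, imp_false, not_not] at hi hj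
      rcases lt_or_gt_of_ne hji with h | h
      · exact absurd (hi.2.1 j h) (not_lt.2 (hj.2.2 i))
      · exact absurd (hj.2.1 i h) (not_lt.2 (hi.2.2 j))
    · simp
  · push Not at h
    simp [h]

theorem mul_greedyShare_nonneg (a : Fin n → ℝ) (i : Fin n) : 0 ≤ a i * greedyShare a i := by
  unfold greedyShare
  split_ifs with h
  · simpa using h.1.le
  · simp

theorem le_sum_mul_greedyShare (a : Fin n → ℝ) (j : Fin n) :
    a j ≤ ∑ i, a i * greedyShare a i := by
  rcases le_or_gt (a j) 0 with hj | hj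
  · exact hj.trans (Finset.sum_nonneg fun i _ => mul_greedyShare_nonneg a i)
  · obtain ⟨m, -, hm⟩ := Finset.exists_max_image Finset.univ a ⟨j, Finset.mem_univ j⟩
    obtain ⟨i, hi, hmin⟩ := Finset.exists_min_image
      (Finset.univ.filter fun i => a i = a m) id ⟨m, by simp⟩
    simp only [Finset.mem_filter, Finset.mem_univ, true_and, id] at hi hmin
    have hle : ∀ k, a k ≤ a i := fun k => (hm k (Finset.mem_univ k)).trans_eq hi.symm
    have hwin : greedyShare a i = 1 := by
      unfold greedyShare
      refine if_pos ⟨hj.trans_le (hle j), fun k hk => lt_of_le_of_ne (hle k) fun h => ?_, hle⟩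
      exact absurd (hmin k (h.trans hi)) (not_le.2 hk)
    calc a j ≤ a i * greedyShare a i := by rw [hwin, mul_one]; exact hle j
      _ ≤ _ := Finset.single_le_sum (f := fun i => a i * greedyShare a i)
        (fun i _ => mul_greedyShare_nonneg a i) (Finset.mem_univ i)

theorem measurable_greedyShare (i : Fin n) : Measurable fun a : Fin n → ℝ => greedyShare a i := by
  unfold greedyShare
  refine Measurable.ite ?_ measurable_const measurable_const
  have h : {a : Fin n → ℝ | 0 < a i ∧ (∀ j < i, a j < a i) ∧ ∀ j, a j ≤ a i} =
      {a | 0 < a i} ∩ ((⋂ j, ⋂ _ : j < i, {a | a j < a i}) ∩ ⋂ j, {a | a j ≤ a i}) := by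
    ext a; simp
  rw [h]
  refine (measurableSet_lt measurable_const (measurable_pi_apply i)).inter
    ((MeasurableSet.iInter fun j => MeasurableSet.iInter fun _ =>
      measurableSet_lt (measurable_pi_apply j) (measurable_pi_apply i)).inter
    (MeasurableSet.iInter fun j => measurableSet_le (measurable_pi_apply j) (measurable_pi_apply i)))

/-- Layer cake: replace `φ i` by its positive part and integrate over levels `s > 0` the set
inequality for the superlevel sets of the `φ i`. The right-hand side is the expectation of the
largest positive score. -/
theorem BorderRule.sum_integral_mul_le {μ : Measure ℝ} [IsProbabilityMeasure μ] (hn : 1 ≤ n)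
    {X : ℝ → ℝ} (hX : BorderRule n μ X) (φ : Fin n → ℝ → ℝ) (hφ : ∀ i, Measurable (φ i))
    (hint : ∀ i, Integrable (φ i) μ) :
    ∑ i, ∫ t, φ i t * X t ∂μ ≤
      ∑ i, ∫ v, φ i (v i) * greedyShare (fun j => φ j (v j)) i ∂(profileLaw n μ) := by
  have hscore : Measurable fun (v : Fin n → ℝ) (j : Fin n) => φ j (v j) :=
    measurable_pi_lambda _ fun j => (hφ j).comp (measurable_pi_apply j)
  have hgm : ∀ i, Measurable fun v : Fin n → ℝ => greedyShare (fun j => φ j (v j)) i := fun i =>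
    (measurable_greedyShare i).comp hscore
  have hmi : ∀ i, Integrable (fun v : Fin n → ℝ => φ i (v i) * greedyShare (fun j => φ j (v j)) i)
      (profileLaw n μ) := fun i => by
    have h1 : Integrable (fun v : Fin n → ℝ => φ i (v i)) (profileLaw n μ) :=
      (measurePreserving_eval_profile i).integrable_comp_of_integrable (hint i)
    refine h1.mul_bdd (c := 1) (hgm i).aestronglyMeasurable (Filter.Eventually.of_forall fun v => ?_)
    rw [Real.norm_of_nonneg (greedyShare_nonneg _ _)]
    exact greedyShare_le_one _ _
  set M : (Fin n → ℝ) → ℝ := fun v => ∑ i, φ i (v i) * greedyShare (fun j => φ j (v j)) i with hM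
  have hMm : Measurable M := Finset.measurable_sum _ fun i _ =>
    ((hφ i).comp (measurable_pi_apply i)).mul (hgm i)
  have hM0 : ∀ v, 0 ≤ M v := fun v => Finset.sum_nonneg fun i _ =>
    mul_greedyShare_nonneg (fun j => φ j (v j)) i
  have hMi : Integrable M (profileLaw n μ) := integrable_finsetSum _ fun i _ => hmi i
  rw [← integral_finsetSum _ fun i _ => hmi i]
  set μX : Measure ℝ := μ.withDensity fun t => ENNReal.ofReal (X t) with hμX
  have hXm : Measurable fun t => ENNReal.ofReal (X t) := hX.mono.measurable.ennreal_ofReal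
  have hμX_apply : ∀ A, MeasurableSet A → μX A = ENNReal.ofReal (∫ s in A, X s ∂μ) := fun A hA => by
    rw [hμX, withDensity_apply _ hA, ofReal_integral_eq_lintegral_ofReal hX.integrable.integrableOn
      (Filter.Eventually.of_forall fun t => (hX.mem t).1)]
  -- One minus the product is the probability that some score exceeds `s`, and in that event the
  -- greedy value `M` exceeds `s` too.
  have hset : ∀ s : ℝ, ∑ i, μX {t | s < φ i t} ≤ (profileLaw n μ) {v | s < M v} := fun s => by
    have hA : ∀ i, MeasurableSet {t | s < φ i t} := fun i => measurableSet_lt measurable_const (hφ i)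
    have h1 : ∑ i, μX {t | s < φ i t} ≤
        ENNReal.ofReal (1 - ∏ i, (1 - μ.real {t | s < φ i t})) := by
      simp only [hμX_apply _ (hA _)]
      rw [← ENNReal.ofReal_sum_of_nonneg fun i _ => integral_nonneg fun t => (hX.mem t).1]
      exact ENNReal.ofReal_le_ofReal (hX.sum_setIntegral_le hn _ hA)
    refine h1.trans ?_
    have h2 : (profileLaw n μ).real (univ.pi fun i => {t | s < φ i t}ᶜ) =
        ∏ i, (1 - μ.real {t | s < φ i t}) := by
      rw [Measure.real, profileLaw, Measure.pi_pi, ENNReal.toReal_prod]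
      exact Finset.prod_congr rfl fun i _ => probReal_compl_eq_one_sub (hA i)
    rw [← h2, ← probReal_compl_eq_one_sub (MeasurableSet.univ_pi fun i => (hA i).compl),
      ofReal_measureReal]
    refine measure_mono fun v hv => ?_
    simp only [mem_compl_iff, mem_univ_pi, mem_ofPred_eq, not_forall, not_not] at hv
    obtain ⟨i, hi⟩ := hv
    exact hi.trans_le (le_sum_mul_greedyShare (fun j => φ j (v j)) i)
  have hlint : ∑ i, ∫⁻ t, ENNReal.ofReal (max (φ i t) 0) ∂μX ≤
      ∫⁻ v, ENNReal.ofReal (M v) ∂(profileLaw n μ) := by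
    rw [lintegral_eq_lintegral_meas_lt _ (Filter.Eventually.of_forall hM0) hMm.aemeasurable]
    have h1 : ∀ i, ∫⁻ t, ENNReal.ofReal (max (φ i t) 0) ∂μX =
        ∫⁻ s in Ioi (0 : ℝ), μX {t | s < φ i t} := fun i => by
      rw [lintegral_eq_lintegral_meas_lt (f := fun t => max (φ i t) 0) _
        (Filter.Eventually.of_forall fun t => le_max_right _ _)
        ((hφ i).max measurable_const).aemeasurable]
      refine setLIntegral_congr_fun measurableSet_Ioi fun s hs => ?_
      congr 1
      ext t
      simp [not_lt.2 (le_of_lt (mem_Ioi.1 hs))]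
    simp only [h1]
    rw [← lintegral_finsetSum]
    · exact lintegral_mono fun s => hset s
    · intro i _
      exact (Antitone.measurable fun a b hab => measure_mono fun t ht => lt_of_le_of_lt hab ht)
  have hpos : ∀ i, Integrable (fun t => max (φ i t) 0 * X t) μ := fun i => by
    refine ((hint i).pos_part).mul_bdd (c := 1) hX.mono.measurable.aestronglyMeasurable
      (Filter.Eventually.of_forall fun t => ?_)
    rw [Real.norm_of_nonneg (hX.mem t).1]
    exact (hX.mem t).2
  have hle : ∀ i, ∫ t, φ i t * X t ∂μ ≤ ∫ t, max (φ i t) 0 * X t ∂μ := fun i => by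
    refine integral_mono ((hint i).mul_bdd (c := 1) hX.mono.measurable.aestronglyMeasurable
      (Filter.Eventually.of_forall fun t => ?_)) (hpos i) fun t => ?_
    · rw [Real.norm_of_nonneg (hX.mem t).1]
      exact (hX.mem t).2
    · exact mul_le_mul_of_nonneg_right (le_max_left _ _) (hX.mem t).1
  refine (Finset.sum_le_sum fun i _ => hle i).trans ?_
  have hpos0 : ∀ i t, 0 ≤ max (φ i t) 0 * X t := fun i t =>
    mul_nonneg (le_max_right _ _) (hX.mem t).1
  rw [← ENNReal.ofReal_le_ofReal_iff (integral_nonneg hM0),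
    ENNReal.ofReal_sum_of_nonneg fun i _ => integral_nonneg (hpos0 i),
    ofReal_integral_eq_lintegral_ofReal hMi (Filter.Eventually.of_forall hM0)]
  refine le_trans (le_of_eq (Finset.sum_congr rfl fun i _ => ?_)) hlint
  rw [ofReal_integral_eq_lintegral_ofReal (hpos i) (Filter.Eventually.of_forall (hpos0 i)), hμX,
    lintegral_withDensity_eq_lintegral_mul _ hXm ((hφ i).max measurable_const).ennreal_ofReal]
  refine lintegral_congr fun t => ?_
  rw [Pi.mul_apply, mul_comm, ENNReal.ofReal_mul (hX.mem t).1]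

end Greedy

/-! ### Existence of allocations with a given interim allocation rule -/

section Indexed

variable {n : ℕ}

section General

variable {α : Type*} [MeasurableSpace α] (ρ : Measure α) [IsFiniteMeasure ρ]

/-- Functions of an index in `Fin n` and a point are integrated over this product measure. -/
abbrev indexed (n : ℕ) : Measure (Fin n × α) := (Measure.count : Measure (Fin n)).prod ρ

variable {ρ}

theorem ae_indexed {P : Fin n × α → Prop} (h : ∀ᵐ p ∂indexed ρ n, P p) :
    ∀ i, ∀ᵐ a ∂ρ, P (i, a) :=
  Measure.ae_count_iff.1 (Measure.ae_ae_of_ae_prod h)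

theorem integrable_indexed {F : Fin n × α → ℝ} (h : Integrable F (indexed ρ n)) (i : Fin n) :
    Integrable (fun a => F (i, a)) ρ :=
  Measure.ae_count_iff.1 h.prod_right_ae i

theorem integral_indexed {F : Fin n × α → ℝ} (h : Integrable F (indexed ρ n)) :
    ∫ p, F p ∂indexed ρ n = ∑ i, ∫ a, F (i, a) ∂ρ := by
  rw [integral_prod _ h, integral_count]

theorem inner_toLp_indexed {F G : Fin n × α → ℝ} (hF : MemLp F 2 (indexed ρ n))
    (hG : MemLp G 2 (indexed ρ n)) :
    inner ℝ (hF.toLp F) (hG.toLp G) = ∑ i, ∫ a, F (i, a) * G (i, a) ∂ρ := by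
  rw [← integral_indexed (F := fun p => F p * G p) (hF.integrable_mul hG), L2.inner_def]
  refine integral_congr_ae ?_
  filter_upwards [hF.coeFn_toLp, hG.coeFn_toLp] with p h1 h2
  rw [h1, h2]
  simp [mul_comm]

end General

variable {μ : Measure ℝ} [IsProbabilityMeasure μ]

/-- Bidder `i` only observes the own value `v i`. -/
def ownValue (p : Fin n × (Fin n → ℝ)) : Fin n × ℝ := (p.1, p.2 p.1)

theorem measurable_ownValue : Measurable (ownValue (n := n)) :=
  measurable_from_prod_countable_right fun i =>
    measurable_const.prodMk (measurable_pi_apply i)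

/-- Each coordinate has law `μ`. Composition with `ownValue` is therefore an isometry of L² spaces,
and its adjoint sends an allocation rule to its interim rule. -/
theorem measurePreserving_ownValue :
    MeasurePreserving (ownValue (n := n)) (indexed (profileLaw n μ) n) (indexed μ n) := by
  refine ⟨measurable_ownValue, Measure.ext fun s hs => ?_⟩
  rw [Measure.map_apply measurable_ownValue hs, Measure.prod_apply (measurable_ownValue hs),
    Measure.prod_apply hs]
  refine lintegral_congr fun i => ?_
  exact (measurePreserving_eval_profile i).measure_preimage
    (measurable_prodMk_left hs).nullMeasurableSet

/-- Square-integrable allocation rules that are feasible almost everywhere. -/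
def feasibleAlloc (n : ℕ) (μ : Measure ℝ) [IsProbabilityMeasure μ] :
    Set (Lp ℝ 2 (indexed (profileLaw n μ) n)) :=
  {k | (∀ (s : Set (Fin n × (Fin n → ℝ))) (hs : MeasurableSet s),
      0 ≤ inner ℝ (indicatorConstLp 2 hs (measure_ne_top _ s) (1 : ℝ)) k) ∧
    ∀ (B : Set (Fin n → ℝ)) (hB : MeasurableSet B),
      inner ℝ (indicatorConstLp 2 (MeasurableSet.univ.prod hB)
        (measure_ne_top _ (univ ×ˢ B)) (1 : ℝ)) k ≤ (profileLaw n μ).real B}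

theorem convex_feasibleAlloc : Convex ℝ (feasibleAlloc n μ) := by
  intro k hk l hl a b ha hb hab
  refine ⟨fun s hs => ?_, fun B hB => ?_⟩
  · rw [inner_add_right, inner_smul_right, inner_smul_right]
    exact add_nonneg (mul_nonneg ha (hk.1 s hs)) (mul_nonneg hb (hl.1 s hs))
  · rw [inner_add_right, inner_smul_right, inner_smul_right]
    calc _ ≤ a * (profileLaw n μ).real B + b * (profileLaw n μ).real B :=
          add_le_add (mul_le_mul_of_nonneg_left (hk.2 B hB) ha)
            (mul_le_mul_of_nonneg_left (hl.2 B hB) hb)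
      _ = _ := by rw [← add_mul, hab, one_mul]

/-- Testing feasibility against indicators presents the set as an intersection of closed
half-spaces, with no almost-everywhere limits to handle. -/
theorem isClosed_feasibleAlloc : IsClosed (feasibleAlloc n μ) := by
  simp only [feasibleAlloc, ofPred_and, ofPred_forall]
  refine IsClosed.inter ?_ ?_
  · exact isClosed_iInter fun s => isClosed_iInter fun hs =>
      isClosed_le continuous_const (continuous_const.inner continuous_id)
  · exact isClosed_iInter fun s => isClosed_iInter fun hs =>
      isClosed_le (continuous_const.inner continuous_id) continuous_const

theorem integrable_feasibleAlloc (k : Lp ℝ 2 (indexed (profileLaw n μ) n)) :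
    Integrable k (indexed (profileLaw n μ) n) :=
  (Lp.memLp k).integrable (by norm_num)

theorem integral_indexed_univ_prod {F : Fin n × (Fin n → ℝ) → ℝ}
    (h : Integrable F (indexed (profileLaw n μ) n)) {B : Set (Fin n → ℝ)} (hB : MeasurableSet B) :
    ∫ p in univ ×ˢ B, F p ∂indexed (profileLaw n μ) n =
      ∫ v in B, ∑ i, F (i, v) ∂(profileLaw n μ) := by
  rw [integral_finsetSum _ fun i _ => (integrable_indexed h i).integrableOn,
    ← integral_indicator (MeasurableSet.univ.prod hB),
    integral_indexed (h.indicator (MeasurableSet.univ.prod hB))]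
  refine Finset.sum_congr rfl fun i _ => ?_
  rw [← integral_indicator hB]
  refine integral_congr_ae (Filter.Eventually.of_forall fun v => ?_)
  by_cases hv : v ∈ B <;> simp [hv]

theorem ae_nonneg_of_mem_feasibleAlloc {k : Lp ℝ 2 (indexed (profileLaw n μ) n)}
    (hk : k ∈ feasibleAlloc n μ) : ∀ᵐ p ∂indexed (profileLaw n μ) n, 0 ≤ k p := by
  refine ae_nonneg_of_forall_setIntegral_nonneg (integrable_feasibleAlloc k) fun s hs _ => ?_
  have := hk.1 s hs
  rwa [L2.inner_indicatorConstLp_one] at this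

theorem ae_sum_le_of_mem_feasibleAlloc {k : Lp ℝ 2 (indexed (profileLaw n μ) n)}
    (hk : k ∈ feasibleAlloc n μ) : ∀ᵐ v ∂(profileLaw n μ), ∑ i, k (i, v) ≤ 1 := by
  refine ae_le_of_forall_setIntegral_le (g := fun _ => (1 : ℝ)) (integrable_finsetSum _ fun i _ =>
    integrable_indexed (integrable_feasibleAlloc k) i) (integrable_const 1) fun B hB _ => ?_
  have := hk.2 B hB
  rw [L2.inner_indicatorConstLp_one,
    integral_indexed_univ_prod (integrable_feasibleAlloc k) hB] at this
  simpa using this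

theorem ae_forall_of_mem_feasibleAlloc {k : Lp ℝ 2 (indexed (profileLaw n μ) n)}
    (hk : k ∈ feasibleAlloc n μ) :
    ∀ᵐ v ∂(profileLaw n μ), (∀ i, 0 ≤ k (i, v)) ∧ ∑ i, k (i, v) ≤ 1 :=
  (ae_all_iff.2 (ae_indexed (ae_nonneg_of_mem_feasibleAlloc hk))).and
    (ae_sum_le_of_mem_feasibleAlloc hk)

theorem norm_le_of_mem_feasibleAlloc :
    ∃ R : ℝ, ∀ k ∈ feasibleAlloc n μ, ‖k‖ ≤ R := by
  refine ⟨_, fun k hk => Lp.norm_le_of_ae_bound zero_le_one ?_⟩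
  have hm : MeasurableSet {p : Fin n × (Fin n → ℝ) | ‖k p‖ ≤ 1} :=
    measurableSet_le (Lp.stronglyMeasurable k).measurable.norm measurable_const
  refine (Measure.ae_prod_iff_ae_ae hm).2 (Measure.ae_count_iff.2 fun i => ?_)
  filter_upwards [ae_forall_of_mem_feasibleAlloc hk] with v hv
  rw [Real.norm_of_nonneg (hv.1 i)]
  exact (Finset.single_le_sum (f := fun i => k (i, v)) (fun i _ => hv.1 i)
    (Finset.mem_univ i)).trans hv.2

theorem toLp_mem_feasibleAlloc {G : Fin n × (Fin n → ℝ) → ℝ}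
    (hG : MemLp G 2 (indexed (profileLaw n μ) n)) (h0 : ∀ p, 0 ≤ G p)
    (h1 : ∀ v, ∑ i, G (i, v) ≤ 1) : hG.toLp G ∈ feasibleAlloc n μ := by
  have hint : Integrable G (indexed (profileLaw n μ) n) := hG.integrable (by norm_num)
  refine ⟨fun s hs => ?_, fun B hB => ?_⟩
  · rw [L2.inner_indicatorConstLp_one,
      integral_congr_ae (ae_restrict_of_ae hG.coeFn_toLp)]
    exact integral_nonneg h0
  · rw [L2.inner_indicatorConstLp_one,
      integral_congr_ae (ae_restrict_of_ae hG.coeFn_toLp), integral_indexed_univ_prod hint hB]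
    calc ∫ v in B, ∑ i, G (i, v) ∂(profileLaw n μ) ≤ ∫ v in B, (1 : ℝ) ∂(profileLaw n μ) :=
          integral_mono (integrable_finsetSum _ fun i _ => (integrable_indexed hint i).integrableOn)
            (integrable_const 1) h1
      _ = _ := by simp

theorem memLp_of_bound_one {α : Type*} [MeasurableSpace α] {ρ : Measure α} [IsFiniteMeasure ρ]
    {G : α → ℝ} (hG : Measurable G) (h : ∀ a, G a ∈ Icc (0 : ℝ) 1) : MemLp G 2 ρ :=
  MemLp.of_bound hG.aestronglyMeasurable 1 (Filter.Eventually.of_forall fun a => by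
    rw [Real.norm_of_nonneg (h a).1]; exact (h a).2)

/-- Border's theorem: an interim rule that satisfies Border's inequalities is the interim
allocation, at almost every value, of an ex-post feasible allocation rule. -/
theorem BorderRule.exists_alloc_ae (hn : 1 ≤ n) {X : ℝ → ℝ} (hX : BorderRule n μ X) :
    ∃ x : (Fin n → ℝ) → Fin n → ℝ, (∀ i, Measurable fun v => x v i) ∧ (∀ v i, 0 ≤ x v i) ∧
      (∀ v, ∑ i, x v i ≤ 1) ∧
      ∀ i, ∀ᵐ t ∂μ, ∫ v, x (Function.update v i t) i ∂(profileLaw n μ) = X t := by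
  have hmp := measurePreserving_ownValue (n := n) (μ := μ)
  set S : Lp ℝ 2 (indexed μ n) →L[ℝ] Lp ℝ 2 (indexed (profileLaw n μ) n) :=
    (Lp.compMeasurePreservingₗᵢ ℝ ownValue hmp).toContinuousLinearMap with hS
  have hS_toLp : ∀ {F : Fin n × ℝ → ℝ} (hF : MemLp F 2 (indexed μ n)),
      S (hF.toLp F) = (hF.comp_measurePreserving hmp).toLp (F ∘ ownValue) := fun hF =>
    Lp.toLp_compMeasurePreserving hF hmp
  have hXm : Measurable fun p : Fin n × ℝ => X p.2 := hX.mono.measurable.comp measurable_snd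
  have hY : MemLp (fun p : Fin n × ℝ => X p.2) 2 (indexed μ n) :=
    memLp_of_bound_one hXm fun p => hX.mem p.2
  obtain ⟨R, hR⟩ := norm_le_of_mem_feasibleAlloc (n := n) (μ := μ)
  have h0 : MemLp (fun _ : Fin n × (Fin n → ℝ) => (0 : ℝ)) 2 (indexed (profileLaw n μ) n) :=
    memLp_of_bound_one measurable_const fun _ => ⟨le_rfl, zero_le_one⟩
  obtain ⟨k, hk, hkeq⟩ := exists_mem_forall_inner_eq S (feasibleAlloc n μ) convex_feasibleAlloc
    isClosed_feasibleAlloc ⟨_, toLp_mem_feasibleAlloc h0 (fun _ => le_rfl) (by simp)⟩ hR (hY.toLp _)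
    (by
      -- No weight `φ` separates `X` from the feasible rules: the greedy allocation with scores `φ
      -- (j, v j)` does at least as well.
      intro φ
      have hφL := Lp.memLp φ
      have hφm := (Lp.stronglyMeasurable φ).measurable
      have hφi : ∀ i, Measurable fun t => φ (i, t) := fun i => hφm.comp measurable_prodMk_left
      have hGm : Measurable fun p : Fin n × (Fin n → ℝ) =>
          greedyShare (fun j => φ (j, p.2 j)) p.1 :=
        measurable_from_prod_countable_right fun i => (measurable_greedyShare i).comp
          (measurable_pi_lambda _ fun j => (hφi j).comp (measurable_pi_apply j))
      have hG : MemLp _ 2 (indexed (profileLaw n μ) n) := memLp_of_bound_one hGm fun p =>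
        ⟨greedyShare_nonneg _ _, greedyShare_le_one _ _⟩
      refine ⟨hG.toLp _, toLp_mem_feasibleAlloc hG (fun p => greedyShare_nonneg _ _)
        (fun v => sum_greedyShare_le _), ?_⟩
      have h1 : inner ℝ φ (hY.toLp _) = ∑ i, ∫ t, φ (i, t) * X t ∂μ := by
        conv_lhs => rw [← Lp.toLp_coeFn φ hφL]
        exact inner_toLp_indexed hφL hY
      have h2 : S φ = (hφL.comp_measurePreserving hmp).toLp (φ ∘ ownValue) := by
        rw [← hS_toLp hφL, Lp.toLp_coeFn]
      rw [h1, h2, inner_toLp_indexed (hφL.comp_measurePreserving hmp) hG]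
      exact hX.sum_integral_mul_le hn (fun i t => φ (i, t)) hφi
        fun i => integrable_indexed (hφL.integrable (by norm_num)) i)
  have hkm := (Lp.stronglyMeasurable k).measurable
  have hkmi : ∀ i, Measurable fun v => k (i, v) := fun i => hkm.comp measurable_prodMk_left
  -- `k` is feasible only almost everywhere; on the exceptional null set the good is withheld.
  set good : Set (Fin n → ℝ) := {v | (∀ i, 0 ≤ k (i, v)) ∧ ∑ i, k (i, v) ≤ 1} with hgood
  have hgoodm : MeasurableSet good := by
    have : good = (⋂ i, {v | 0 ≤ k (i, v)}) ∩ {v | ∑ i, k (i, v) ≤ 1} := by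
      ext v; simp [hgood]
    rw [this]
    exact (MeasurableSet.iInter fun i => measurableSet_le measurable_const (hkmi i)).inter
      (measurableSet_le (Finset.measurable_sum _ fun i _ => hkmi i) measurable_const)
  set x : (Fin n → ℝ) → Fin n → ℝ := fun v i => good.indicator (fun v => k (i, v)) v with hx
  have hxm : ∀ i, Measurable fun v => x v i := fun i => (hkmi i).indicator hgoodm
  have hx0 : ∀ v i, 0 ≤ x v i := fun v i => indicator_nonneg (fun v hv => hv.1 i) v
  have hx1 : ∀ v, ∑ i, x v i ≤ 1 := fun v => by
    by_cases hv : v ∈ good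
    · simpa [hx, hv] using hv.2
    · simp [hx, hv]
  have hxle : ∀ v i, x v i ≤ 1 := fun v i =>
    (Finset.single_le_sum (f := fun i => x v i) (fun i _ => hx0 v i) (Finset.mem_univ i)).trans
      (hx1 v)
  have hxk : ∀ i, ∀ᵐ v ∂(profileLaw n μ), x v i = k (i, v) := fun i => by
    filter_upwards [ae_forall_of_mem_feasibleAlloc hk] with v hv
    exact indicator_of_mem (s := good) hv _
  have hxi : ∀ i, Integrable (fun v => x v i) (profileLaw n μ) := fun i =>
    (memLp_of_bound_one (hxm i) fun v => ⟨hx0 v i, hxle v i⟩).integrable (by norm_num)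
  refine ⟨x, hxm, hx0, hx1, fun i => ?_⟩
  refine Integrable.ae_eq_of_forall_setIntegral_eq _ _
    (integrable_update_pair (hxi i) i).integral_prod_left hX.integrable fun A hA _ => ?_
  -- Testing the adjoint identity with the indicator of `{i} ×ˢ A` isolates bidder `i` with values
  -- in `A`.
  have hF : MemLp (({i} ×ˢ A).indicator fun _ : Fin n × ℝ => (1 : ℝ)) 2 (indexed μ n) :=
    memLp_of_bound_one (measurable_const.indicator ((measurableSet_singleton i).prod hA)) fun p => by
      by_cases hp : p ∈ ({i} ×ˢ A : Set (Fin n × ℝ)) <;> simp [hp]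
  have h1 := hkeq (hF.toLp _)
  rw [hS_toLp hF, inner_toLp_indexed hF hY, ← Lp.toLp_coeFn k (Lp.memLp k),
    inner_toLp_indexed (hF.comp_measurePreserving hmp) (Lp.memLp k),
    Finset.sum_eq_single i (fun j _ hj => by simp [ownValue, hj]) (by simp),
    Finset.sum_eq_single i (fun j _ hj => by simp [hj]) (by simp)] at h1
  have h2 : ∫ a, ({i} ×ˢ A).indicator (fun _ : Fin n × ℝ => (1 : ℝ)) (i, a) * X a ∂μ =
      ∫ a in A, X a ∂μ := by
    rw [← integral_indicator hA]
    refine integral_congr_ae (Filter.Eventually.of_forall fun a => ?_)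
    by_cases ha : a ∈ A <;> simp [ha]
  have h3 : Integrable (fun v => A.indicator (fun _ => (1 : ℝ)) (v i) * x v i) (profileLaw n μ) := by
    refine (memLp_of_bound_one (((measurable_const.indicator hA).comp (measurable_pi_apply i)).mul
      (hxm i)) fun v => ?_).integrable (by norm_num : (1 : ENNReal) ≤ 2)
    by_cases hv : v i ∈ A <;> simp [hv, hx0 v i, hxle v i]
  have h4 : ∫ v, (({i} ×ˢ A).indicator (fun _ : Fin n × ℝ => (1 : ℝ)) ∘ ownValue) (i, v) * k (i, v)
      ∂(profileLaw n μ) = ∫ v, A.indicator (fun _ => (1 : ℝ)) (v i) * x v i ∂(profileLaw n μ) := by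
    refine integral_congr_ae ?_
    filter_upwards [hxk i] with v hv
    by_cases ha : v i ∈ A <;> simp [ha, ownValue, hv]
  rw [h2, h4, integral_eq_integral_update h3 i] at h1
  rw [← h1, ← integral_indicator hA]
  refine integral_congr_ae (Filter.Eventually.of_forall fun t => ?_)
  by_cases ht : t ∈ A <;> simp [ht]

/-- Border's theorem with the interim allocation prescribed at every value. -/
theorem BorderRule.exists_alloc (hn : 1 ≤ n) {X : ℝ → ℝ} (hX : BorderRule n μ X) :
    ∃ x : (Fin n → ℝ) → Fin n → ℝ, (∀ i, Measurable fun v => x v i) ∧ (∀ v i, 0 ≤ x v i) ∧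
      (∀ v, ∑ i, x v i ≤ 1) ∧
      ∀ i t, ∫ v, x (Function.update v i t) i ∂(profileLaw n μ) = X t := by
  classical
  obtain ⟨x, hxm, hx0, hx1, hxX⟩ := hX.exists_alloc_ae hn
  have hae := ae_all_iff.2 hxX
  obtain ⟨N, hNsub, hNm, hN0⟩ := exists_measurable_superset_of_null hae
  have hN : ∀ t ∉ N, ∀ i, ∫ v, x (Function.update v i t) i ∂(profileLaw n μ) = X t := by
    intro t ht
    by_contra hcon
    exact ht (hNsub hcon)
  have haeN : ∀ᵐ v ∂(profileLaw n μ), ∀ j, v j ∉ N :=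
    ae_profile_of_ae (measure_eq_zero_iff_ae_notMem.1 hN0)
  -- Almost surely no sampled value lies in the null set `N`. The first bidder reporting a value in
  -- `N` can therefore get exactly `X` of that value, and the others nothing, without affecting the
  -- interim allocation at reports outside `N`.
  set y : (Fin n → ℝ) → Fin n → ℝ := fun v i =>
    if ∀ j, v j ∉ N then x v i else if v i ∈ N ∧ ∀ j < i, v j ∉ N then X (v i) else 0 with hy
  have hcoord : ∀ j : Fin n, MeasurableSet {v : Fin n → ℝ | v j ∉ N} := fun j => by
    have h : MeasurableSet ((fun v : Fin n → ℝ => v j) ⁻¹' Nᶜ) := measurable_pi_apply j hNm.compl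
    exact h
  refine ⟨y, fun i => ?_, fun v i => ?_, fun v => ?_, fun i t => ?_⟩
  · refine Measurable.ite ?_ (hxm i) (Measurable.ite ?_
      (hX.mono.measurable.comp (measurable_pi_apply i)) measurable_const)
    · rw [ofPred_forall]
      exact MeasurableSet.iInter hcoord
    · rw [ofPred_and]
      refine MeasurableSet.inter ((measurable_pi_apply i) hNm) ?_
      simp only [ofPred_forall]
      exact MeasurableSet.iInter fun j => MeasurableSet.iInter fun _ => hcoord j
  · simp only [hy]
    split_ifs
    exacts [hx0 v i, (hX.mem _).1, le_rfl]
  · by_cases h : ∀ j, v j ∉ N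
    · simpa only [hy, if_pos h] using hx1 v
    · simp only [hy, if_neg h]
      by_cases h' : ∃ i, v i ∈ N ∧ ∀ j < i, v j ∉ N
      · obtain ⟨i, hi⟩ := h'
        rw [Finset.sum_eq_single i]
        · rw [if_pos hi]
          exact (hX.mem _).2
        · intro j _ hji
          refine if_neg fun hj => ?_
          rcases lt_or_gt_of_ne hji with h | h
          · exact hi.2 j h hj.1
          · exact hj.2 i h hi.1
        · simp
      · push Not at h'
        rw [Finset.sum_eq_zero fun i _ => if_neg fun hi => ?_]
        · exact zero_le_one
        · obtain ⟨j, hj, hjN⟩ := h' i hi.1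
          exact hi.2 j hj hjN
  · by_cases ht : t ∈ N
    · rw [integral_congr_ae (g := fun _ => X t)]
      · simp
      · filter_upwards [haeN] with v hv
        have h1 : ¬ ∀ j, Function.update v i t j ∉ N := fun h => h i (by simpa using ht)
        have h2 : Function.update v i t i ∈ N ∧ ∀ j < i, Function.update v i t j ∉ N :=
          ⟨by simpa using ht, fun j hj => by simpa [Function.update_of_ne hj.ne] using hv j⟩
        simp only [hy]
        rw [if_neg h1, if_pos h2, Function.update_self]
    · rw [← hN t ht i]
      refine integral_congr_ae ?_
      filter_upwards [haeN] with v hv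
      have h1 : ∀ j, Function.update v i t j ∉ N := fun j => by
        by_cases hj : j = i
        · subst hj; simpa using ht
        · simpa [Function.update_of_ne hj] using hv j
      simp only [hy, if_pos h1]

end Indexed

/-! ### Properties of admissible mechanisms -/

/-- Adding the two incentive constraints between `v` and `w` shows that `v - w` times the difference
of the allocations is nonnegative. -/
theorem BIC.interimAlloc_mono {n : ℕ} {V : Set ℝ} {μ : Measure ℝ} {c : ℝ → ℝ}
    {M : Mechanism n} (hM : BIC V μ c M) (i : Fin n) :
    MonotoneOn (interimAlloc μ M i) V := by
  intro w hw v hv hwv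
  rcases eq_or_lt_of_le hwv with rfl | h
  · exact le_rfl
  · have h1 := hM i v hv w hw
    have h2 := hM i w hw v hv
    nlinarith

section Admissible

variable {n : ℕ} {V : Set ℝ} {μ : Measure ℝ} [IsProbabilityMeasure μ] {c : ℝ → ℝ} {M : Mechanism n}

theorem update_mem_profiles {v : Fin n → ℝ} (hv : ∀ j, v j ∈ V) (i : Fin n) {t : ℝ} (ht : t ∈ V)
    (j : Fin n) : Function.update v i t j ∈ V := by
  by_cases h : j = i
  · subst h; simpa using ht
  · simpa [Function.update_of_ne h] using hv j

theorem measurable_update_left (i : Fin n) (t : ℝ) :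
    Measurable fun v : Fin n → ℝ => Function.update v i t :=
  (measurable_update_pair i).comp measurable_prodMk_left

theorem WellFormed.integrable_alloc (hM : WellFormed V μ c M) (hV : ∀ᵐ t ∂μ, t ∈ V) (i : Fin n) :
    Integrable (fun v => M.alloc v i) (profileLaw n μ) := by
  refine Integrable.of_bound (hM.measurable_alloc i).aestronglyMeasurable 1 ?_
  filter_upwards [ae_profile_of_ae hV] with v hv
  rw [Real.norm_of_nonneg (hM.alloc_mem v hv i).1]
  exact (hM.alloc_mem v hv i).2

theorem WellFormed.interimAlloc_mem (hM : WellFormed V μ c M) (hV : ∀ᵐ t ∂μ, t ∈ V) (i : Fin n)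
    {t : ℝ} (ht : t ∈ V) : interimAlloc μ M i t ∈ Icc (0 : ℝ) 1 := by
  have hmem : ∀ᵐ v ∂(profileLaw n μ), M.alloc (Function.update v i t) i ∈ Icc (0 : ℝ) 1 := by
    filter_upwards [ae_profile_of_ae hV] with v hv
    exact hM.alloc_mem _ (update_mem_profiles hv i ht) i
  refine ⟨integral_nonneg_of_ae (hmem.mono fun v hv => hv.1), ?_⟩
  have hint : Integrable (fun v => M.alloc (Function.update v i t) i) (profileLaw n μ) := by
    refine Integrable.of_bound
      ((hM.measurable_alloc i).comp (measurable_update_left i t)).aestronglyMeasurable 1 ?_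
    filter_upwards [hmem] with v hv
    rw [Real.norm_of_nonneg hv.1]
    exact hv.2
  calc interimAlloc μ M i t ≤ ∫ _v, (1 : ℝ) ∂(profileLaw n μ) :=
        integral_mono_ae hint (integrable_const 1) (hmem.mono fun v hv => hv.2)
    _ = 1 := by simp

theorem WellFormed.integrable_interimAlloc (hM : WellFormed V μ c M) (hV : ∀ᵐ t ∂μ, t ∈ V)
    (i : Fin n) : Integrable (interimAlloc μ M i) μ :=
  (integrable_update_pair (hM.integrable_alloc hV i) i).integral_prod_left

/-- Border's inequality is necessary for ex-post feasibility. -/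
theorem IsAdmissible.sum_setIntegral_le (hM : IsAdmissible V μ c M) (hV : ∀ᵐ t ∂μ, t ∈ V)
    {A : Set ℝ} (hA : MeasurableSet A) :
    ∑ i, ∫ t in A, interimAlloc μ M i t ∂μ ≤ 1 - (1 - μ.real A) ^ n := by
  have hmA : ∀ i : Fin n, Measurable fun v : Fin n → ℝ => A.indicator (fun _ => (1 : ℝ)) (v i) :=
    fun i => (measurable_const.indicator hA).comp (measurable_pi_apply i)
  have hint : ∀ i, Integrable (fun v => A.indicator (fun _ => (1 : ℝ)) (v i) * M.alloc v i)
      (profileLaw n μ) := fun i => by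
    refine (hM.wellFormed.integrable_alloc hV i).bdd_mul (c := 1) (hmA i).aestronglyMeasurable
      (Filter.Eventually.of_forall fun v => ?_)
    by_cases h : v i ∈ A <;> simp [h]
  have h1 : ∀ i, ∫ t in A, interimAlloc μ M i t ∂μ =
      ∫ v, A.indicator (fun _ => (1 : ℝ)) (v i) * M.alloc v i ∂(profileLaw n μ) := fun i => by
    rw [integral_eq_integral_update (hint i) i, ← integral_indicator hA]
    refine integral_congr_ae (Filter.Eventually.of_forall fun t => ?_)
    by_cases ht : t ∈ A <;> simp [ht, interimAlloc]
  simp only [h1]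
  rw [← integral_finsetSum _ fun i _ => hint i]
  -- On `B` no value lies in `A`, so the counted shares vanish; off `B` they add up to at most the
  -- whole good.
  set B : Set (Fin n → ℝ) := univ.pi fun _ => Aᶜ with hB
  have hBm : MeasurableSet B := MeasurableSet.univ_pi fun _ => hA.compl
  have hBr : (profileLaw n μ).real Bᶜ = 1 - (1 - μ.real A) ^ n := by
    rw [probReal_compl_eq_one_sub hBm, Measure.real, profileLaw, Measure.pi_pi, ENNReal.toReal_prod]
    simp only [Finset.prod_const, Finset.card_univ, Fintype.card_fin]
    rw [← Measure.real, probReal_compl_eq_one_sub hA]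
  rw [← hBr, ← integral_indicator_one hBm.compl]
  refine integral_mono_ae (integrable_finsetSum _ fun i _ => hint i)
    ((integrable_const 1).indicator hBm.compl) ?_
  filter_upwards [ae_profile_of_ae hV] with v hv
  by_cases hvB : v ∈ B
  · have : ∀ i, v i ∉ A := fun i => hvB i (mem_univ i)
    simp [this, hvB]
  · rw [indicator_of_mem (show v ∈ Bᶜ from hvB)]
    refine (Finset.sum_le_sum fun i _ => ?_).trans (hM.xp v hv)
    by_cases h : v i ∈ A <;> simp [h, (hM.wellFormed.alloc_mem v hv i).1]

/-- Jensen for the convex `c`: the cost of the expected payment is at most the expected cost. -/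
theorem WellFormed.integral_pay_le (hc : IsCost c) (hM : WellFormed V μ c M)
    (hV : ∀ᵐ t ∂μ, t ∈ V) (i : Fin n) {t : ℝ} (ht : t ∈ V) :
    0 ≤ interimCost μ c M i t ∧
    ∫ v, M.pay (Function.update v i t) i ∂(profileLaw n μ) ≤ costInv c (interimCost μ c M i t) := by
  have hpos : ∀ᵐ v ∂(profileLaw n μ), 0 ≤ M.pay (Function.update v i t) i := by
    filter_upwards [ae_profile_of_ae hV] with v hv
    exact hM.pay_nonneg _ (update_mem_profiles hv i ht) i
  have hcost := hM.integrable_cost i t ht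
  have hint : Integrable (fun v => M.pay (Function.update v i t) i) (profileLaw n μ) := by
    refine Integrable.mono' ((integrable_const 1).add (hcost.div_const (c 1)))
      ((hM.measurable_pay i).comp (measurable_update_left i t)).aestronglyMeasurable ?_
    filter_upwards [hpos] with v hv
    rw [Real.norm_of_nonneg hv]
    exact hc.le_one_add_div hv
  refine ⟨integral_nonneg_of_ae (hpos.mono fun v hv => hc.nonneg hv),
    hc.le_costInv (integral_nonneg_of_ae hpos) ?_⟩
  exact hc.convex.map_integral_le hc.continuousOn isClosed_Ici hpos hint hcost

/-- By Jensen's inequality, the revenue is at most that of the auction where every bidder pays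
with certainty for the average interim cost. -/
theorem WellFormed.revenue_le (hn : 1 ≤ n) (hc : IsCost c) (hM : WellFormed V μ c M)
    (hV : ∀ᵐ t ∂μ, t ∈ V) {B : ℝ → ℝ} (hB : ∀ t ∈ V, (∑ i, interimCost μ c M i t) / n ≤ B t)
    (hint : Integrable (fun t => costInv c (B t)) μ) :
    revenue μ M ≤ n * ∫ t, costInv c (B t) ∂μ := by
  have hn0 : (0 : ℝ) < n := by positivity
  have hpt : ∀ t ∈ V, ∑ i, ∫ v, M.pay (Function.update v i t) i ∂(profileLaw n μ) ≤
      n * costInv c (B t) := by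
    intro t ht
    have hcost : ∀ i, 0 ≤ interimCost μ c M i t := fun i => (hM.integral_pay_le hc hV i ht).1
    -- A second use of Jensen, across bidders, for the concave `costInv c`.
    have h1 := hc.concaveOn_costInv.le_map_sum (t := Finset.univ) (w := fun _ : Fin n => (1 : ℝ) / n)
      (p := fun i => interimCost μ c M i t) (fun _ _ => by positivity) (by simp [hn0.ne'])
      (fun i _ => hcost i)
    simp only [smul_eq_mul, ← Finset.mul_sum] at h1
    have h2 : costInv c (1 / n * ∑ i, interimCost μ c M i t) ≤ costInv c (B t) := by
      refine hc.costInv_mono (mul_nonneg (by positivity) (Finset.sum_nonneg fun i _ => hcost i)) ?_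
      rw [one_div_mul_eq_div]
      exact hB t ht
    calc ∑ i, ∫ v, M.pay (Function.update v i t) i ∂(profileLaw n μ)
        ≤ ∑ i, costInv c (interimCost μ c M i t) :=
          Finset.sum_le_sum fun i _ => (hM.integral_pay_le hc hV i ht).2
      _ = n * (1 / n * ∑ i, costInv c (interimCost μ c M i t)) := by field_simp
      _ ≤ n * costInv c (B t) := mul_le_mul_of_nonneg_left (h1.trans h2) hn0.le
  have hB0 : ∀ t ∈ V, 0 ≤ costInv c (B t) := fun t ht => hc.costInv_nonneg
    ((div_nonneg (Finset.sum_nonneg fun i _ => (hM.integral_pay_le hc hV i ht).1) hn0.le).trans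
      (hB t ht))
  by_cases hsum : Integrable (fun v => ∑ i, M.pay v i) (profileLaw n μ)
  · have hi : ∀ i, Integrable (fun v => M.pay v i) (profileLaw n μ) := fun i => by
      refine Integrable.mono' hsum (hM.measurable_pay i).aestronglyMeasurable ?_
      filter_upwards [ae_profile_of_ae hV] with v hv
      rw [Real.norm_of_nonneg (hM.pay_nonneg v hv i)]
      exact Finset.single_le_sum (f := fun i => M.pay v i) (fun i _ => hM.pay_nonneg v hv i)
        (Finset.mem_univ i)
    have hsec : ∀ i, Integrable
        (fun t => ∫ v, M.pay (Function.update v i t) i ∂(profileLaw n μ)) μ := fun i =>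
      (integrable_update_pair (hi i) i).integral_prod_left
    unfold revenue
    rw [integral_finsetSum _ fun i _ => hi i,
      Finset.sum_congr rfl fun i _ => integral_eq_integral_update (hi i) i,
      ← integral_finsetSum _ fun i _ => hsec i, ← integral_const_mul]
    exact integral_mono_ae (integrable_finsetSum _ fun i _ => hsec i) (hint.const_mul _)
      (hV.mono fun t ht => hpt t ht)
  -- The integral of a non-integrable function is `0` by convention, and the bound is nonnegative.
  · unfold revenue
    rw [integral_undef hsum]
    exact mul_nonneg hn0.le (integral_nonneg_of_ae (hV.mono fun t ht => hB0 t ht))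

end Admissible

/-! ### Auctions with deterministic payments -/

/-- An interim rule `X` that satisfies Border's inequalities and is incentive compatible with
perceived payments `C` is implemented by an auction where the payments of a bidder depend on the
own value only. -/
theorem BorderRule.exists_mechanism {n : ℕ} (hn : 1 ≤ n) {V : Set ℝ} {μ : Measure ℝ}
    [IsProbabilityMeasure μ] (hV : ∀ᵐ t ∂μ, t ∈ V) {c : ℝ → ℝ} (hc : IsCost c) {X C : ℝ → ℝ}
    (hX : BorderRule n μ X) (hCm : Measurable C) (hC0 : ∀ t ∈ V, 0 ≤ C t)
    (hIC : ∀ v ∈ V, ∀ w ∈ V, v * X w - C w ≤ v * X v - C v) (hIR : ∀ v ∈ V, 0 ≤ v * X v - C v)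
    (hint : Integrable (fun t => costInv c (C t)) μ) :
    ∃ M : Mechanism n, IsAdmissible V μ c M ∧ (∀ i t, interimAlloc μ M i t = X t) ∧
      (∀ v, (∀ j, v j ∈ V) → ∀ i, M.pay v i = costInv c (C (v i))) ∧
      revenue μ M = n * ∫ t, costInv c (C t) ∂μ := by
  obtain ⟨x, hxm, hx0, hx1, hxX⟩ := hX.exists_alloc hn
  -- The maximum and the globally defined inverse only secure measurability off `V`; on `V` the
  -- payment is `costInv c (C (v i))`.
  set M : Mechanism n := ⟨x, fun v i => hc.orderIso.symm (max (C (v i)) 0)⟩ with hM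
  have hpay : ∀ t ∈ V, hc.orderIso.symm (max (C t) 0) = costInv c (C t) := fun t ht => by
    rw [hc.orderIso_symm_apply (le_max_right _ _), max_eq_left (hC0 t ht)]
  have hconst : ∀ i, ∀ t ∈ V, (fun v => c (M.pay (Function.update v i t) i)) = fun _ => C t := by
    intro i t ht
    funext v
    simp only [hM, Function.update_self]
    rw [hpay t ht, hc.apply_costInv (hC0 t ht)]
  have hcost : ∀ i, ∀ t ∈ V, interimCost μ c M i t = C t := fun i t ht => by
    unfold interimCost
    rw [hconst i t ht]
    simp
  have hpayV : ∀ v, (∀ j, v j ∈ V) → ∀ i, M.pay v i = costInv c (C (v i)) := fun v hv i =>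
    hpay (v i) (hv i)
  refine ⟨M, ⟨⟨hxm, fun i => ?_, fun v _ i => ⟨hx0 v i, ?_⟩, fun v hv i => ?_, fun i t ht => ?_⟩,
    fun i v hv w hw => ?_, fun i v hv => ?_, fun v _ => hx1 v⟩, hxX, hpayV, ?_⟩
  · exact hc.continuous_orderIso_symm.measurable.comp
      ((hCm.comp (measurable_pi_apply i)).max measurable_const)
  · exact (Finset.single_le_sum (f := fun i => x v i) (fun i _ => hx0 v i)
      (Finset.mem_univ i)).trans (hx1 v)
  · rw [hpayV v hv i]
    exact hc.costInv_nonneg (hC0 _ (hv i))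
  · rw [hconst i t ht]
    exact integrable_const _
  · rw [hcost i v hv, hcost i w hw]
    rw [show interimAlloc μ M i w = X w from hxX i w, show interimAlloc μ M i v = X v from hxX i v]
    exact hIC v hv w hw
  · rw [hcost i v hv, show interimAlloc μ M i v = X v from hxX i v]
    exact hIR v hv
  · have h1 : ∀ i : Fin n, Integrable (fun v : Fin n → ℝ => costInv c (C (v i))) (profileLaw n μ) :=
      fun i => (measurePreserving_eval_profile i).integrable_comp_of_integrable hint
    have h2 : ∀ i : Fin n, ∫ v, costInv c (C (v i)) ∂(profileLaw n μ) = ∫ t, costInv c (C t) ∂μ :=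
      fun i => by
        have hmp := measurePreserving_eval_profile (μ := μ) i
        conv_rhs => rw [← hmp.map_eq]
        refine (integral_map (φ := fun v : Fin n → ℝ => v i) (f := fun t => costInv c (C t))
          hmp.measurable.aemeasurable ?_).symm
        rw [hmp.map_eq]
        exact hint.aestronglyMeasurable
    unfold revenue
    rw [integral_congr_ae (g := fun v => ∑ i, costInv c (C (v i)))
      ((ae_profile_of_ae hV).mono fun v hv => Finset.sum_congr rfl fun i _ => hpayV v hv i),
      integral_finsetSum _ fun i _ => h1 i]
    simp [h2]

/-! ### Discrete values -/

section Telescope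

theorem sum_Icc_sub_pred (g : ℕ → ℝ) {k m : ℕ} (hk : 1 ≤ k) (hkm : k ≤ m + 1) :
    ∑ q ∈ Finset.Icc k m, (g q - g (q - 1)) = g m - g (k - 1) := by
  obtain ⟨k, rfl⟩ : ∃ j, k = j + 1 := ⟨k - 1, by omega⟩
  simp only [Nat.add_sub_cancel]
  have hkm' : k ≤ m := by omega
  clear hkm
  induction m, hkm' using Nat.le_induction with
  | base => simp
  | succ m hm ih => rw [Finset.sum_Icc_succ_top (by omega), ih]; simp

theorem sum_Icc_one_sub_pred (f : ℕ → ℝ) {q : ℕ} (hq : 1 ≤ q) :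
    ∑ k ∈ Finset.Icc 1 q, f k - ∑ k ∈ Finset.Icc 1 (q - 1), f k = f q := by
  obtain ⟨q, rfl⟩ : ∃ j, q = j + 1 := ⟨q - 1, by omega⟩
  rw [Finset.sum_Icc_succ_top (by omega)]
  simp

/-- Both sides are the probability that a given bidder has value `q` and wins. Algebraically, `n *
(n-1).choose k = (k+1) * n.choose (k+1)` turns the sum into the binomial expansion of `massCdf f q ^
n` without its zeroth term. -/
theorem mul_topAlloc {n : ℕ} (hn : 1 ≤ n) (f : ℕ → ℝ) {q : ℕ} (hq : 1 ≤ q) :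
    f q * topAlloc n f q = (massCdf f q ^ n - massCdf f (q - 1) ^ n) / n := by
  obtain ⟨n, rfl⟩ : ∃ j, n = j + 1 := ⟨n - 1, by omega⟩
  have hF : massCdf f q = f q + massCdf f (q - 1) := by
    linarith [show massCdf f q - massCdf f (q - 1) = f q from sum_Icc_one_sub_pred f hq]
  rw [hF, add_pow, Finset.sum_range_succ']
  simp only [Nat.choose_zero_right, pow_zero, one_mul, Nat.sub_zero, Nat.cast_one, mul_one,
    add_sub_cancel_right]
  rw [topAlloc, Finset.mul_sum, Finset.sum_div]
  refine Finset.sum_congr rfl fun k _ => ?_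
  rw [show (∑ τ ∈ Finset.Icc 1 (q - 1), f τ) = massCdf f (q - 1) from rfl, Nat.add_sub_cancel,
    Nat.add_sub_add_right]
  have h : ((n : ℝ) + 1) * (n.choose k : ℝ) = ((n + 1).choose (k + 1) : ℝ) * ((k : ℝ) + 1) := by
    exact_mod_cast Nat.add_one_mul_choose_eq n k
  have hk : (k : ℝ) + 1 ≠ 0 := by positivity
  have hn' : (n : ℝ) + 1 ≠ 0 := by positivity
  push_cast
  field_simp
  linear_combination f q * massCdf f (q - 1) ^ (n - k) * f q ^ k * h

end Telescope

section Discrete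

variable {n m : ℕ} {f : ℕ → ℝ}

theorem sum_Icc_mass (h1 : ∑ t ∈ Finset.Icc 1 m, f t = 1) {k : ℕ} (hk : 1 ≤ k) (hkm : k ≤ m + 1) :
    ∑ q ∈ Finset.Icc k m, f q = 1 - massCdf f (k - 1) := by
  rw [← h1, ← show massCdf f m = ∑ t ∈ Finset.Icc 1 m, f t from rfl,
    ← sum_Icc_sub_pred (massCdf f) hk hkm]
  refine Finset.sum_congr rfl fun q hq => (sum_Icc_one_sub_pred f ?_).symm
  exact hk.trans (Finset.mem_Icc.1 hq).1

/-- By telescoping, the right-hand side of a border constraint is `1 / n` times the probability that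
some value is at least `k`. -/
theorem sum_Icc_mul_topAlloc (hn : 1 ≤ n) (h1 : ∑ t ∈ Finset.Icc 1 m, f t = 1) {k : ℕ}
    (hk : 1 ≤ k) (hkm : k ≤ m + 1) :
    ∑ q ∈ Finset.Icc k m, f q * topAlloc n f q = (1 - massCdf f (k - 1) ^ n) / n := by
  rw [Finset.sum_congr rfl fun q hq => mul_topAlloc hn f (hk.trans (Finset.mem_Icc.1 hq).1),
    ← Finset.sum_div, sum_Icc_sub_pred (fun q => massCdf f q ^ n) hk hkm,
    show massCdf f m = 1 from h1, one_pow]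

/-- Summation by parts for the left-hand side of the border constraints. -/
theorem sum_Icc_mul_sum (h1 : ∑ t ∈ Finset.Icc 1 m, f t = 1) (z : ℕ → ℝ) {k : ℕ} (hk : 1 ≤ k)
    (hkm : k ≤ m) :
    ∑ q ∈ Finset.Icc k m, f q * ∑ τ ∈ Finset.Icc 1 q, z τ =
      ∑ τ ∈ Finset.Icc 1 m, z τ * (1 - massCdf f (max k τ - 1)) := by
  have h2 : ∀ q ∈ Finset.Icc k m, f q * ∑ τ ∈ Finset.Icc 1 q, z τ =
      ∑ τ ∈ Finset.Icc 1 m, if τ ≤ q then z τ * f q else 0 := by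
    intro q hq
    rw [← Finset.sum_filter, Finset.mul_sum]
    refine Finset.sum_congr ?_ fun τ _ => mul_comm _ _
    ext τ
    simp only [Finset.mem_Icc, Finset.mem_filter] at hq ⊢
    omega
  rw [Finset.sum_congr rfl h2, Finset.sum_comm]
  refine Finset.sum_congr rfl fun τ hτ => ?_
  rw [Finset.mem_Icc] at hτ
  rw [← sum_Icc_mass h1 (k := max k τ) (by omega) (by omega), Finset.mul_sum, ← Finset.sum_filter]
  refine Finset.sum_congr ?_ fun _ _ => rfl
  ext q
  simp only [Finset.mem_Icc, Finset.mem_filter]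
  omega

/-! ### Integration against the discrete law -/

theorem integrable_massLaw (g : ℝ → ℝ) : Integrable g (massLaw m f) := by
  unfold massLaw
  refine integrable_finsetSum_measure.2 fun t _ => ?_
  exact (integrable_dirac (by simp)).smul_measure ENNReal.ofReal_ne_top

theorem integral_massLaw (hf : ∀ t ∈ Finset.Icc 1 m, 0 < f t) (g : ℝ → ℝ) :
    ∫ t, g t ∂massLaw m f = ∑ t ∈ Finset.Icc 1 m, f t * g t := by
  unfold massLaw
  rw [integral_finsetSum_measure fun t _ =>
    (integrable_dirac (by simp)).smul_measure ENNReal.ofReal_ne_top]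
  refine Finset.sum_congr rfl fun t ht => ?_
  rw [integral_smul_measure, integral_dirac, ENNReal.toReal_ofReal (hf t ht).le, smul_eq_mul]

theorem isProbabilityMeasure_massLaw (hf : ∀ t ∈ Finset.Icc 1 m, 0 < f t)
    (h1 : ∑ t ∈ Finset.Icc 1 m, f t = 1) : IsProbabilityMeasure (massLaw m f) := by
  constructor
  simp only [massLaw, Measure.coe_finsetSum, Finset.sum_apply, Measure.smul_apply,
    measure_univ, smul_eq_mul, mul_one]
  rw [← ENNReal.ofReal_sum_of_nonneg fun t ht => (hf t ht).le, h1, ENNReal.ofReal_one]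

theorem ae_massLaw {P : ℝ → Prop}
    (h : ∀ t ∈ Finset.Icc 1 m, P t) : ∀ᵐ t ∂massLaw m f, P t := by
  rw [ae_iff]
  simp only [massLaw, Measure.coe_finsetSum, Finset.sum_apply, Measure.smul_apply, smul_eq_mul]
  refine Finset.sum_eq_zero fun t ht => ?_
  simp [h t ht]

theorem ae_mem_discValues :
    ∀ᵐ t ∂massLaw m f, t ∈ discValues m :=
  ae_massLaw fun t ht => ⟨t, Finset.mem_Icc.1 ht, rfl⟩

theorem setIntegral_massLaw (hf : ∀ t ∈ Finset.Icc 1 m, 0 < f t) (g : ℝ → ℝ) {S : Set ℝ}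
    (hS : MeasurableSet S) {k : ℕ} (hSk : ∀ q ∈ Finset.Icc 1 m, (q : ℝ) ∈ S ↔ k ≤ q) (hk : 1 ≤ k) :
    ∫ t in S, g t ∂massLaw m f = ∑ q ∈ Finset.Icc k m, f q * g q := by
  classical
  rw [← integral_indicator hS, integral_massLaw hf]
  have h2 : Finset.Icc k m = (Finset.Icc 1 m).filter fun q : ℕ => (q : ℝ) ∈ S := by
    ext q
    rw [Finset.mem_filter]
    constructor
    · intro h
      have h' : q ∈ Finset.Icc 1 m := by
        rw [Finset.mem_Icc] at h ⊢
        omega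
      exact ⟨h', (hSk q h').2 (Finset.mem_Icc.1 h).1⟩
    · rintro ⟨h, hS⟩
      exact Finset.mem_Icc.2 ⟨(hSk q h).1 hS, (Finset.mem_Icc.1 h).2⟩
  rw [h2, Finset.sum_filter]
  refine Finset.sum_congr rfl fun q _ => ?_
  by_cases h : (q : ℝ) ∈ S <;> simp [h]

theorem measureReal_massLaw (hf : ∀ t ∈ Finset.Icc 1 m, 0 < f t)
    (h1 : ∑ t ∈ Finset.Icc 1 m, f t = 1) {S : Set ℝ}
    (hS : MeasurableSet S) {k : ℕ} (hSk : ∀ q ∈ Finset.Icc 1 m, (q : ℝ) ∈ S ↔ k ≤ q) (hk : 1 ≤ k)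
    (hkm : k ≤ m + 1) : (massLaw m f).real S = 1 - massCdf f (k - 1) := by
  have : IsProbabilityMeasure (massLaw m f) := isProbabilityMeasure_massLaw hf h1
  have h := setIntegral_massLaw hf (fun _ => 1) hS hSk hk
  rw [← sum_Icc_mass h1 hk hkm]
  simpa using h

/-- The interim allocation rule with increments `z`, as a function on `ℝ`. -/
def stepAlloc (m : ℕ) (z : ℕ → ℝ) (t : ℝ) : ℝ :=
  ∑ τ ∈ Finset.Icc 1 m, if (τ : ℝ) ≤ t then z τ else 0

theorem stepAlloc_natCast (z : ℕ → ℝ) {t : ℕ} (ht : t ≤ m) :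
    stepAlloc m z t = ∑ τ ∈ Finset.Icc 1 t, z τ := by
  rw [stepAlloc, ← Finset.sum_filter]
  refine Finset.sum_congr ?_ fun _ _ => rfl
  ext τ
  simp only [Finset.mem_filter, Finset.mem_Icc, Nat.cast_le]
  omega

theorem stepAlloc_mono {z : ℕ → ℝ} (hz : ∀ τ ∈ Finset.Icc 1 m, 0 ≤ z τ) :
    Monotone (stepAlloc m z) := by
  intro s t hst
  refine Finset.sum_le_sum fun τ hτ => ?_
  split_ifs with h h' h'
  · exact le_rfl
  · exact absurd (h.trans hst) h'
  · exact hz τ hτ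
  · exact le_rfl

theorem stepAlloc_nonneg {z : ℕ → ℝ} (hz : ∀ τ ∈ Finset.Icc 1 m, 0 ≤ z τ) (t : ℝ) :
    0 ≤ stepAlloc m z t := by
  refine Finset.sum_nonneg fun τ hτ => ?_
  split_ifs
  exacts [hz τ hτ, le_rfl]

theorem stepAlloc_le {z : ℕ → ℝ} (hz : ∀ τ ∈ Finset.Icc 1 m, 0 ≤ z τ) (t : ℝ) :
    stepAlloc m z t ≤ ∑ τ ∈ Finset.Icc 1 m, z τ := by
  refine Finset.sum_le_sum fun τ hτ => ?_
  split_ifs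
  exacts [le_rfl, hz τ hτ]

theorem one_le_of_sum_Icc_eq_one (h1 : ∑ t ∈ Finset.Icc 1 m, f t = 1) : 1 ≤ m := by
  by_contra h
  have : m = 0 := by omega
  subst this
  simp at h1

/-- The constraint at the top value `m` bounds `f m` times the total by `(1 - massCdf f (m - 1) ^ n)
/ n`, which by Bernoulli's inequality is at most `1 - massCdf f (m - 1) = f m`. -/
theorem DiscFeasible.sum_le_one (hn : 1 ≤ n) (hf : ∀ t ∈ Finset.Icc 1 m, 0 < f t)
    (h1 : ∑ t ∈ Finset.Icc 1 m, f t = 1) {z : ℕ → ℝ} (hz : DiscFeasible n m f z) :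
    ∑ τ ∈ Finset.Icc 1 m, z τ ≤ 1 := by
  have hm : 1 ≤ m := one_le_of_sum_Icc_eq_one h1
  have hmem : m ∈ Finset.Icc 1 m := Finset.mem_Icc.2 ⟨hm, le_rfl⟩
  have h := hz.border m hmem
  rw [← sum_Icc_mul_sum h1 z hm le_rfl, sum_Icc_mul_topAlloc hn h1 hm (by omega)] at h
  have h2 := sum_Icc_mass h1 hm (by omega)
  simp only [Finset.Icc_self, Finset.sum_singleton] at h h2
  have hF : 0 ≤ massCdf f (m - 1) := Finset.sum_nonneg fun k hk =>
    (hf k (Finset.Icc_subset_Icc_right (by omega) hk)).le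
  have h3 := pow_tangent_le hF zero_le_one n
  simp only [one_pow, mul_one] at h3
  have hn0 : (0 : ℝ) < n := by positivity
  have hfm := hf m hmem
  rw [le_div_iff₀ hn0] at h
  have h4 : f m * (∑ τ ∈ Finset.Icc 1 m, z τ) * n ≤ f m * 1 * n := by
    rw [h2] at h ⊢
    linarith
  exact le_of_mul_le_mul_left (le_of_mul_le_mul_right h4 hn0) hfm

theorem DiscFeasible.borderRule (hn : 1 ≤ n) (hf : ∀ t ∈ Finset.Icc 1 m, 0 < f t)
    (h1 : ∑ t ∈ Finset.Icc 1 m, f t = 1) {z : ℕ → ℝ} (hz : DiscFeasible n m f z) :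
    BorderRule n (massLaw m f) (stepAlloc m z) := by
  have hn0 : (0 : ℝ) < n := by positivity
  have key : ∀ (S : Set ℝ) (k : ℕ), MeasurableSet S →
      (∀ q ∈ Finset.Icc 1 m, (q : ℝ) ∈ S ↔ k ≤ q) → 1 ≤ k → k ≤ m + 1 →
      n * ∫ s in S, stepAlloc m z s ∂massLaw m f ≤ 1 - (1 - (massLaw m f).real S) ^ n := by
    intro S k hS hSk hk hkm
    rw [setIntegral_massLaw hf _ hS hSk hk, measureReal_massLaw hf h1 hS hSk hk hkm, sub_sub_cancel,
      Finset.sum_congr rfl fun q hq => by rw [stepAlloc_natCast z (Finset.mem_Icc.1 hq).2],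
      ← le_div_iff₀' hn0, ← sum_Icc_mul_topAlloc hn h1 hk hkm]
    rcases Nat.lt_or_ge m k with h | h
    · simp [Finset.Icc_eq_empty_of_lt h]
    · rw [sum_Icc_mul_sum h1 z hk h]
      exact hz.border k (Finset.mem_Icc.2 ⟨hk, h⟩)
  have hae : ∀ P : ℝ → Prop, (∀ t ∈ Finset.Icc 1 m, ¬ P t) → massLaw m f {t | P t} = 0 :=
    fun P hP => by simpa [ae_iff] using ae_massLaw (P := fun t => ¬ P t) hP
  refine ⟨⟨0, m, ?_, ?_⟩, stepAlloc_mono hz.nonneg, fun t => ⟨stepAlloc_nonneg hz.nonneg t,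
    (stepAlloc_le hz.nonneg t).trans (hz.sum_le_one hn hf h1)⟩, fun t => ?_, fun t => ?_⟩
  · exact hae (fun t => t < 0) fun t _ => by simp
  · exact hae (fun t => (m : ℝ) < t) fun t ht => by
      simpa using (Finset.mem_Icc.1 ht).2
  -- Clamping to `[1, m + 1]` keeps the trace on `{1, …, m}`; the value `m + 1` stands for an empty
  -- trace.
  · refine key _ (max 1 (min (m + 1) ⌈t⌉₊)) measurableSet_Ici (fun q hq => ?_) (by omega) (by omega)
    rw [Finset.mem_Icc] at hq
    rw [mem_Ici, ← Nat.ceil_le]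
    omega
  · refine key _ (max 1 (min (m + 1) (⌊t⌋₊ + 1))) measurableSet_Ioi (fun q hq => ?_) (by omega)
      (by omega)
    rw [Finset.mem_Icc] at hq
    rw [mem_Ioi, ← Nat.floor_lt' (by omega)]
    omega

/-- The perceived payments of the auction with increments `z`. -/
def stepCost (m : ℕ) (z : ℕ → ℝ) : ℝ → ℝ := stepAlloc m fun τ => τ * z τ

theorem discObjective_eq (hf : ∀ t ∈ Finset.Icc 1 m, 0 < f t) (c : ℝ → ℝ) (z : ℕ → ℝ) :
    ∫ t, costInv c (stepCost m z t) ∂massLaw m f = discObjective m c f z := by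
  rw [integral_massLaw hf]
  refine Finset.sum_congr rfl fun t ht => ?_
  rw [stepCost, stepAlloc_natCast _ (Finset.mem_Icc.1 ht).2]

/-- The utility of value `v` from report `w` is a sum over the increments up to `w`, each with the
sign of `v - τ`. A truthful report collects exactly those with `τ ≤ v`, which gives incentive
compatibility and individual rationality at once. -/
theorem mul_stepAlloc_sub_stepCost (z : ℕ → ℝ) (v w : ℝ) :
    v * stepAlloc m z w - stepCost m z w =
      ∑ τ ∈ Finset.Icc 1 m, if (τ : ℝ) ≤ w then (v - τ) * z τ else 0 := by
  rw [stepCost, stepAlloc, stepAlloc, Finset.mul_sum, ← Finset.sum_sub_distrib]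
  refine Finset.sum_congr rfl fun τ _ => ?_
  split_ifs <;> ring

theorem DiscFeasible.exists_mechanism (hn : 1 ≤ n) {c : ℝ → ℝ} (hc : IsCost c)
    (hf : ∀ t ∈ Finset.Icc 1 m, 0 < f t) (h1 : ∑ t ∈ Finset.Icc 1 m, f t = 1) {z : ℕ → ℝ}
    (hz : DiscFeasible n m f z) :
    ∃ M : Mechanism n, IsAdmissible (discValues m) (massLaw m f) c M ∧
      (∀ i, ∀ t ∈ Finset.Icc 1 m,
        interimAlloc (massLaw m f) M i t = ∑ τ ∈ Finset.Icc 1 t, z τ) ∧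
      (∀ v : Fin n → ℕ, (∀ j, v j ∈ Finset.Icc 1 m) →
        ∀ i, M.pay (fun j => (v j : ℝ)) i =
          costInv c (∑ τ ∈ Finset.Icc 1 (v i), (τ : ℝ) * z τ)) ∧
      revenue (massLaw m f) M = n * discObjective m c f z := by
  have := isProbabilityMeasure_massLaw hf h1
  have hz' : ∀ τ ∈ Finset.Icc 1 m, 0 ≤ (τ : ℝ) * z τ := fun τ hτ =>
    mul_nonneg (Nat.cast_nonneg τ) (hz.nonneg τ hτ)
  obtain ⟨M, hM, hMX, hMp, hMr⟩ := (hz.borderRule hn hf h1).exists_mechanism hn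
    (ae_mem_discValues) hc (C := stepCost m z) (stepAlloc_mono hz').measurable
    (fun t _ => stepAlloc_nonneg hz' t)
    (fun v _ w _ => by
      rw [mul_stepAlloc_sub_stepCost, mul_stepAlloc_sub_stepCost]
      refine Finset.sum_le_sum fun τ hτ => ?_
      have := hz.nonneg τ hτ
      split_ifs with h h' h'
      · exact le_rfl
      · exact mul_nonpos_of_nonpos_of_nonneg (by linarith) this
      · exact mul_nonneg (by linarith) this
      · exact le_rfl)
    (fun v _ => by
      rw [mul_stepAlloc_sub_stepCost]
      refine Finset.sum_nonneg fun τ hτ => ?_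
      split_ifs with h
      · exact mul_nonneg (by linarith) (hz.nonneg τ hτ)
      · exact le_rfl)
    (integrable_massLaw _)
  refine ⟨M, hM, fun i t ht => ?_, fun v hv i => ?_, ?_⟩
  · rw [hMX, stepAlloc_natCast z (Finset.mem_Icc.1 ht).2]
  · rw [hMp _ (fun j => ⟨v j, Finset.mem_Icc.1 (hv j), rfl⟩), stepCost,
      stepAlloc_natCast _ (Finset.mem_Icc.1 (hv i)).2]
  · rw [hMr, discObjective_eq hf]

/-- Monotone interim rules have nonnegative increments, and Border's necessary condition for upper
sets is the constraint. For the revenue, the incentive constraint of value `t + 1` against report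
`t` bounds the rise of the average cost by `(t + 1) * z (t + 1)`; individual rationality at value
`1` starts the induction. -/
theorem discFeasible_of_isAdmissible (hn : 1 ≤ n) {c : ℝ → ℝ} (hc : IsCost c)
    (hf : ∀ t ∈ Finset.Icc 1 m, 0 < f t) (h1 : ∑ t ∈ Finset.Icc 1 m, f t = 1) {M : Mechanism n}
    (hM : IsAdmissible (discValues m) (massLaw m f) c M) {z : ℕ → ℝ}
    (hMz : ∀ t ∈ Finset.Icc 1 m,
      (∑ i, interimAlloc (massLaw m f) M i t) / n = ∑ τ ∈ Finset.Icc 1 t, z τ) :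
    DiscFeasible n m f z ∧ revenue (massLaw m f) M ≤ n * discObjective m c f z := by
  have := isProbabilityMeasure_massLaw hf h1
  have hV := ae_mem_discValues (m := m) (f := f)
  have hn0 : (0 : ℝ) < n := by positivity
  have hmem : ∀ t ∈ Finset.Icc 1 m, (t : ℝ) ∈ discValues m := fun t ht =>
    ⟨t, Finset.mem_Icc.1 ht, rfl⟩
  have hnonneg : ∀ τ ∈ Finset.Icc 1 m, 0 ≤ z τ := by
    intro τ hτ
    rcases eq_or_lt_of_le (Finset.mem_Icc.1 hτ).1 with h | h
    · subst h
      have h2 := hMz 1 hτ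
      simp only [Finset.Icc_self, Finset.sum_singleton] at h2
      rw [← h2]
      exact div_nonneg (Finset.sum_nonneg fun i _ =>
        (hM.wellFormed.interimAlloc_mem hV i (hmem 1 hτ)).1) hn0.le
    · have hτ' : τ - 1 ∈ Finset.Icc 1 m := by
        rw [Finset.mem_Icc] at hτ ⊢
        omega
      rw [← sum_Icc_one_sub_pred z (by omega), ← hMz τ hτ, ← hMz _ hτ', sub_nonneg]
      refine div_le_div_of_nonneg_right (Finset.sum_le_sum fun i _ => ?_) hn0.le
      exact hM.bic.interimAlloc_mono i (hmem _ hτ') (hmem _ hτ) (Nat.cast_le.2 (Nat.sub_le τ 1))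
  refine ⟨⟨hnonneg, fun t ht => ?_⟩, ?_⟩
  · have ht' := Finset.mem_Icc.1 ht
    have hS : ∀ q ∈ Finset.Icc 1 m, (q : ℝ) ∈ Ici (t : ℝ) ↔ t ≤ q := fun q _ => by simp
    rw [← sum_Icc_mul_sum h1 z ht'.1 ht'.2, sum_Icc_mul_topAlloc hn h1 ht'.1 (by omega),
      le_div_iff₀' hn0]
    have h2 := hM.sum_setIntegral_le hV (measurableSet_Ici (a := (t : ℝ)))
    rw [measureReal_massLaw hf h1 measurableSet_Ici hS ht'.1 (by omega), sub_sub_cancel] at h2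
    refine le_trans (le_of_eq ?_) h2
    simp only [setIntegral_massLaw hf _ measurableSet_Ici hS ht'.1]
    rw [Finset.sum_comm, Finset.mul_sum]
    refine Finset.sum_congr rfl fun q hq => ?_
    rw [← Finset.mul_sum, ← hMz q (Finset.Icc_subset_Icc_left ht'.1 hq)]
    field_simp
  · rw [← discObjective_eq hf]
    refine hM.wellFormed.revenue_le hn hc hV ?_ (integrable_massLaw _)
    rintro _ ⟨t, ht, rfl⟩
    dsimp only
    rw [stepCost, stepAlloc_natCast _ ht.2]
    obtain ⟨ht1, htm⟩ := ht
    induction t, ht1 using Nat.le_induction with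
    | base =>
      have hmem1 := Finset.mem_Icc.2 ⟨le_refl 1, htm⟩
      have h2 := hMz 1 hmem1
      simp only [Finset.Icc_self, Finset.sum_singleton] at h2 ⊢
      rw [← h2, Nat.cast_one, one_mul]
      refine div_le_div_of_nonneg_right (Finset.sum_le_sum fun i _ => ?_) hn0.le
      have := hM.iir i _ (hmem 1 hmem1)
      simp only [Nat.cast_one] at this
      linarith
    | succ t ht1 ih =>
      have ht' := Finset.mem_Icc.2 ⟨ht1, (Nat.le_succ t).trans htm⟩
      have ht'' := Finset.mem_Icc.2 ⟨ht1.trans (Nat.le_succ t), htm⟩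
      have h2 := sum_Icc_one_sub_pred z (Finset.mem_Icc.1 ht'').1
      rw [Nat.succ_sub_one, ← hMz _ ht', ← hMz _ ht''] at h2
      rw [Finset.sum_Icc_succ_top (by omega), ← h2]
      refine le_trans ?_ (add_le_add_left (ih (Finset.mem_Icc.1 ht').2) _)
      rw [← sub_div, mul_div_assoc', ← add_div]
      refine div_le_div_of_nonneg_right ?_ hn0.le
      rw [← Finset.sum_sub_distrib, Finset.mul_sum, ← Finset.sum_add_distrib]
      refine Finset.sum_le_sum fun i _ => ?_
      have := hM.bic i _ (hmem _ ht'') _ (hmem _ ht')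
      linarith

/-- Feasible increments lie in `[0, 1]`. Coordinates outside `{1, …, m}` are irrelevant and are
pinned to `0` to obtain compactness. -/
theorem exists_discSolution (hn : 1 ≤ n) {c : ℝ → ℝ} (hc : IsCost c)
    (hf : ∀ t ∈ Finset.Icc 1 m, 0 < f t) (h1 : ∑ t ∈ Finset.Icc 1 m, f t = 1) :
    ∃ z, DiscSolution n m c f z := by
  set K : Set (ℕ → ℝ) := univ.pi fun τ => if τ ∈ Finset.Icc 1 m then Icc (0 : ℝ) 1 else {0}
    with hK
  have hKc : IsCompact K := isCompact_univ_pi fun τ => by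
    split_ifs
    exacts [isCompact_Icc, isCompact_singleton]
  have hfeas : IsClosed {z | DiscFeasible n m f z} := by
    have : {z | DiscFeasible n m f z} =
        (⋂ τ ∈ Finset.Icc 1 m, {z | 0 ≤ z τ}) ∩ ⋂ t ∈ Finset.Icc 1 m,
          {z | ∑ τ ∈ Finset.Icc 1 m, z τ * (1 - massCdf f (max t τ - 1)) ≤
            ∑ q ∈ Finset.Icc t m, f q * topAlloc n f q} := by
      ext z
      simp only [mem_inter_iff, mem_iInter, mem_ofPred_eq]
      exact ⟨fun h => ⟨h.nonneg, h.border⟩, fun h => ⟨h.1, h.2⟩⟩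
    rw [this]
    refine IsClosed.inter ?_ ?_
    · exact isClosed_biInter fun τ _ => isClosed_le continuous_const (continuous_apply τ)
    · exact isClosed_biInter fun t _ => isClosed_le (continuous_finsetSum _ fun τ _ =>
        (continuous_apply τ).mul continuous_const) continuous_const
  have hzero : (0 : ℕ → ℝ) ∈ K ∩ {z | DiscFeasible n m f z} := by
    refine ⟨fun τ _ => ?_, fun τ _ => le_rfl, fun t ht => ?_⟩
    · dsimp only
      split_ifs <;> simp
    · have ht' := Finset.mem_Icc.1 ht
      rw [sum_Icc_mul_topAlloc hn h1 ht'.1 (by omega)]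
      simp only [Pi.zero_apply, zero_mul, Finset.sum_const_zero]
      refine div_nonneg (sub_nonneg.2 (pow_le_one₀ (Finset.sum_nonneg fun k hk => ?_) ?_))
        (Nat.cast_nonneg n)
      · exact (hf k (Finset.Icc_subset_Icc_right (by omega) hk)).le
      · rw [← h1]
        exact Finset.sum_le_sum_of_subset_of_nonneg (Finset.Icc_subset_Icc_right (by omega))
          fun k hk _ => (hf k hk).le
  obtain ⟨z, ⟨-, hz⟩, hmax⟩ := (hKc.inter_right hfeas).exists_isMaxOn ⟨0, hzero⟩
    (f := fun z => ∑ t ∈ Finset.Icc 1 m, f t * hc.orderIso.symm (∑ τ ∈ Finset.Icc 1 t, (τ : ℝ) * z τ))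
    (continuous_finsetSum _ fun t _ => continuous_const.mul (hc.continuous_orderIso_symm.comp
      (continuous_finsetSum _ fun τ _ => continuous_const.mul (continuous_apply τ)))).continuousOn
  have hobj : ∀ z, DiscFeasible n m f z → discObjective m c f z =
      ∑ t ∈ Finset.Icc 1 m, f t * hc.orderIso.symm (∑ τ ∈ Finset.Icc 1 t, (τ : ℝ) * z τ) := by
    intro z hz
    refine Finset.sum_congr rfl fun t ht => ?_
    rw [hc.orderIso_symm_apply]
    exact Finset.sum_nonneg fun τ hτ => mul_nonneg (Nat.cast_nonneg τ)
      (hz.nonneg τ (Finset.Icc_subset_Icc_right (Finset.mem_Icc.1 ht).2 hτ))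
  refine ⟨z, hz, fun w hw => ?_⟩
  set w' : ℕ → ℝ := fun τ => if τ ∈ Finset.Icc 1 m then w τ else 0 with hw'
  have hww : ∀ τ ∈ Finset.Icc 1 m, w' τ = w τ := fun τ hτ => if_pos hτ
  have hfw : DiscFeasible n m f w' := by
    refine ⟨fun τ hτ => (hww τ hτ).symm ▸ hw.nonneg τ hτ, fun t ht => ?_⟩
    rw [Finset.sum_congr rfl fun τ hτ => by rw [hww τ hτ]]
    exact hw.border t ht
  have hKw : w' ∈ K := by
    intro τ _
    by_cases h : τ ∈ Finset.Icc 1 m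
    · simp only [if_pos h, hww τ h]
      exact ⟨hw.nonneg τ h,
        (Finset.single_le_sum (fun τ hτ => hw.nonneg τ hτ) h).trans (hw.sum_le_one hn hf h1)⟩
    · simp only [hw', if_neg h, mem_singleton_iff]
  have h2 := hmax ⟨hKw, hfw⟩
  simp only [mem_ofPred_eq] at h2
  rw [← hobj w' hfw, ← hobj z hz] at h2
  refine le_trans (le_of_eq ?_) h2
  refine Finset.sum_congr rfl fun t ht => ?_
  congr 2
  exact Finset.sum_congr rfl fun τ hτ => by
    rw [hww τ (Finset.Icc_subset_Icc_right (Finset.mem_Icc.1 ht).2 hτ)]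

theorem discrete_program (hn : 1 ≤ n) {c : ℝ → ℝ} (hc : IsCost c)
    (hf : ∀ t ∈ Finset.Icc 1 m, 0 < f t) (h1 : ∑ t ∈ Finset.Icc 1 m, f t = 1) :
    (∃ opt : ℝ,
      IsGreatest {r | ∃ z, DiscFeasible n m f z ∧ r = discObjective m c f z} opt ∧
      IsGreatest {r | ∃ M : Mechanism n, IsAdmissible (discValues m) (massLaw m f) c M ∧
        r = revenue (massLaw m f) M} (n * opt)) ∧
    ∀ z, DiscSolution n m c f z ↔
      ∃ M : Mechanism n, IsOptimalAuction (discValues m) (massLaw m f) c M ∧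
        ∀ i, ∀ t ∈ Finset.Icc 1 m,
          interimAlloc (massLaw m f) M i t = ∑ τ ∈ Finset.Icc 1 t, z τ := by
  have hn0 : (0 : ℝ) < n := by positivity
  obtain ⟨z₀, hz₀, hmax⟩ := exists_discSolution hn hc hf h1
  have hbound : ∀ M : Mechanism n, IsAdmissible (discValues m) (massLaw m f) c M →
      revenue (massLaw m f) M ≤ n * discObjective m c f z₀ := by
    intro M hM
    -- Setting `A 0 = 0` makes the increments of the average interim rule sum back to it.
    set A : ℕ → ℝ := fun t => if t = 0 then 0 else (∑ i, interimAlloc (massLaw m f) M i t) / n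
      with hA
    have h := discFeasible_of_isAdmissible hn hc hf h1 hM (z := fun τ => A τ - A (τ - 1))
      fun t ht => by
        rw [sum_Icc_sub_pred A le_rfl (by omega)]
        have : t ≠ 0 := by
          rw [Finset.mem_Icc] at ht
          omega
        simp [hA, this]
    exact h.2.trans (mul_le_mul_of_nonneg_left (hmax _ h.1) hn0.le)
  obtain ⟨M₀, hM₀, -, -, hrev₀⟩ := hz₀.exists_mechanism hn hc hf h1
  refine ⟨⟨discObjective m c f z₀, ⟨⟨z₀, hz₀, rfl⟩, ?_⟩, ⟨M₀, hM₀, hrev₀.symm⟩, ?_⟩, fun z => ?_⟩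
  · rintro _ ⟨z, hz, rfl⟩
    exact hmax z hz
  · rintro _ ⟨M, hM, rfl⟩
    exact hbound M hM
  · constructor
    · rintro ⟨hz, hzmax⟩
      obtain ⟨M, hM, hMX, -, hrev⟩ := hz.exists_mechanism hn hc hf h1
      refine ⟨M, ⟨hM, fun M' hM' => (hbound M' hM').trans ?_⟩, hMX⟩
      rw [hrev]
      exact mul_le_mul_of_nonneg_left (hzmax _ hz₀) hn0.le
    · rintro ⟨M, ⟨hM, hopt⟩, hMX⟩
      obtain ⟨hz, hrev⟩ := discFeasible_of_isAdmissible hn hc hf h1 hM (z := z) fun t ht => by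
        simp only [hMX _ t ht]
        simp [hn0.ne']
      refine ⟨hz, fun z' hz' => ?_⟩
      obtain ⟨M', hM', -, -, hrev'⟩ := hz'.exists_mechanism hn hc hf h1
      have := (hopt M' hM').trans hrev
      rw [hrev'] at this
      exact le_of_mul_le_mul_left this hn0

end Discrete

/-! ### Continuous values -/

/-- Densities on `[0, 1]` that are continuous and positive in the interior. -/
structure IsDensity (f : ℝ → ℝ) : Prop where
  cont : ContinuousOn f (Icc 0 1)
  pos : ∀ t ∈ Ioo (0 : ℝ) 1, 0 < f t
  integral_eq_one : ∫ t in (0 : ℝ)..1, f t = 1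

section Density

variable {f : ℝ → ℝ}

namespace IsDensity

theorem nonneg (hf : IsDensity f) {t : ℝ} (ht : t ∈ Icc (0 : ℝ) 1) : 0 ≤ f t := by
  have h := hf.cont
  rw [← closure_Ioo (zero_ne_one' ℝ)] at ht h
  exact le_on_closure (fun s hs => (hf.pos s hs).le) continuousOn_const h ht

theorem intervalIntegrable (hf : IsDensity f) {a b : ℝ} (ha : a ∈ Icc (0 : ℝ) 1)
    (hb : b ∈ Icc (0 : ℝ) 1) : IntervalIntegrable f volume a b :=
  (hf.cont.mono (uIcc_subset_Icc ha hb)).intervalIntegrable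

theorem integral_tail (hf : IsDensity f) {t : ℝ} (ht : t ∈ Icc (0 : ℝ) 1) :
    ∫ s in t..1, f s = 1 - densityCdf f t := by
  have h0 : (0 : ℝ) ∈ Icc (0 : ℝ) 1 := ⟨le_rfl, zero_le_one⟩
  have h1 : (1 : ℝ) ∈ Icc (0 : ℝ) 1 := ⟨zero_le_one, le_rfl⟩
  rw [eq_sub_iff_add_eq', densityCdf, intervalIntegral.integral_add_adjacent_intervals
    (hf.intervalIntegrable h0 ht) (hf.intervalIntegrable ht h1), hf.integral_eq_one]

theorem cdf_nonneg (hf : IsDensity f) {t : ℝ} (ht : t ∈ Icc (0 : ℝ) 1) : 0 ≤ densityCdf f t :=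
  intervalIntegral.integral_nonneg ht.1 fun _ hs => hf.nonneg ⟨hs.1, hs.2.trans ht.2⟩

theorem cdf_le_one (hf : IsDensity f) {t : ℝ} (ht : t ∈ Icc (0 : ℝ) 1) : densityCdf f t ≤ 1 := by
  rw [← sub_nonneg, ← hf.integral_tail ht]
  exact intervalIntegral.integral_nonneg ht.2 fun _ hs => hf.nonneg ⟨ht.1.trans hs.1, hs.2⟩

/-- Strictness permits division by `1 - densityCdf f t` when feasible rules are bounded by `1`. -/
theorem cdf_lt_one (hf : IsDensity f) {t : ℝ} (ht : t ∈ Ico (0 : ℝ) 1) : densityCdf f t < 1 := by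
  rw [← sub_pos, ← hf.integral_tail ⟨ht.1, ht.2.le⟩]
  exact intervalIntegral.intervalIntegral_pos_of_pos_on
    (hf.intervalIntegrable ⟨ht.1, ht.2.le⟩ ⟨zero_le_one, le_rfl⟩)
    (fun s hs => hf.pos s ⟨ht.1.trans_lt hs.1, hs.2⟩) ht.2

theorem aemeasurable (hf : IsDensity f) : AEMeasurable f (volume.restrict (Icc 0 1)) :=
  hf.cont.aemeasurable measurableSet_Icc

theorem integral_densityLaw (hf : IsDensity f) (g : ℝ → ℝ) :
    ∫ t, g t ∂densityLaw f = ∫ t in (0 : ℝ)..1, f t * g t := by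
  rw [densityLaw, integral_withDensity_eq_integral_toReal_smul₀ hf.aemeasurable.ennreal_ofReal
    (Filter.Eventually.of_forall fun _ => ENNReal.ofReal_lt_top),
    intervalIntegral.integral_of_le zero_le_one, ← integral_Icc_eq_integral_Ioc]
  refine setIntegral_congr_fun measurableSet_Icc fun t ht => ?_
  simp only [smul_eq_mul]
  rw [ENNReal.toReal_ofReal (hf.nonneg ht)]

theorem isProbabilityMeasure (hf : IsDensity f) : IsProbabilityMeasure (densityLaw f) := by
  constructor
  rw [densityLaw, withDensity_apply _ MeasurableSet.univ, Measure.restrict_univ,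
    ← ofReal_integral_eq_lintegral_ofReal (hf.cont.integrableOn_Icc)
      ((ae_restrict_mem measurableSet_Icc).mono fun t ht => hf.nonneg ht),
    integral_Icc_eq_integral_Ioc, ← intervalIntegral.integral_of_le zero_le_one,
    hf.integral_eq_one, ENNReal.ofReal_one]

end IsDensity

theorem ae_mem_densityLaw : ∀ᵐ t ∂densityLaw f, t ∈ Icc (0 : ℝ) 1 :=
  (withDensity_absolutelyContinuous _ _).ae_le (ae_restrict_mem measurableSet_Icc)

namespace IsDensity

theorem setIntegral_Ioi (hf : IsDensity f) (g : ℝ → ℝ) {t : ℝ} (ht : t ∈ Icc (0 : ℝ) 1) :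
    ∫ s in Ioi t, g s ∂densityLaw f = ∫ s in t..1, f s * g s := by
  rw [← integral_indicator measurableSet_Ioi, hf.integral_densityLaw,
    intervalIntegral.integral_of_le zero_le_one, intervalIntegral.integral_of_le ht.2]
  have h : ∀ s, f s * (Ioi t).indicator g s = (Ioi t).indicator (fun s => f s * g s) s := fun s => by
    by_cases hs : s ∈ Ioi t <;> simp [hs]
  simp only [h]
  rw [setIntegral_indicator measurableSet_Ioi, Ioc_inter_Ioi, sup_eq_right.2 ht.1]

theorem setIntegral_Ici (hf : IsDensity f) (g : ℝ → ℝ) {t : ℝ} (ht : t ∈ Icc (0 : ℝ) 1) :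
    ∫ s in Ici t, g s ∂densityLaw f = ∫ s in t..1, f s * g s := by
  rw [← hf.setIntegral_Ioi g ht]
  refine setIntegral_congr_set ?_
  exact (withDensity_absolutelyContinuous _ _).ae_le
    (ae_restrict_of_ae (Ioi_ae_eq_Ici (μ := volume) (a := t)).symm)

theorem measureReal_Ioi (hf : IsDensity f) {t : ℝ} (ht : t ∈ Icc (0 : ℝ) 1) :
    (densityLaw f).real (Ioi t) = 1 - densityCdf f t := by
  have := hf.setIntegral_Ioi (fun _ => 1) ht
  simpa [hf.integral_tail ht] using this

theorem measureReal_Ici (hf : IsDensity f) {t : ℝ} (ht : t ∈ Icc (0 : ℝ) 1) :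
    (densityLaw f).real (Ici t) = 1 - densityCdf f t := by
  have := hf.setIntegral_Ici (fun _ => 1) ht
  simpa [hf.integral_tail ht] using this

end IsDensity

/-- Interim allocation rules for the values in `[0, 1]` that satisfy Border's inequalities. -/
structure ContRule (n : ℕ) (f X : ℝ → ℝ) : Prop where
  mono : Monotone X
  mem : ∀ t, X t ∈ Icc (0 : ℝ) 1
  border : ∀ t ∈ Icc (0 : ℝ) 1, n * ∫ s in t..1, f s * X s ≤ 1 - densityCdf f t ^ n

/-- The perceived payment for the interim rule `X` when value `0` has utility `0`. -/
def ruleCost (X : ℝ → ℝ) (t : ℝ) : ℝ :=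
  t * X t - ∫ s in (0 : ℝ)..t, X s

/-- The revenue per bidder from the interim rule `X`. -/
def ruleRevenue (c f X : ℝ → ℝ) : ℝ :=
  ∫ t in (0 : ℝ)..1, f t * costInv c (ruleCost X t)

/-! ### Envelope payments of a monotone rule -/

section RuleCost

variable {X : ℝ → ℝ}

theorem mul_le_integral_of_monotone (hX : Monotone X) {a b : ℝ} (hab : a ≤ b) :
    (b - a) * X a ≤ ∫ s in a..b, X s := by
  have h := intervalIntegral.integral_mono_on hab (intervalIntegrable_const (c := X a))
    (hX.intervalIntegrable (μ := volume)) fun s hs => hX hs.1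
  simpa using h

theorem integral_le_mul_of_monotone (hX : Monotone X) {a b : ℝ} (hab : a ≤ b) :
    ∫ s in a..b, X s ≤ (b - a) * X b := by
  have h := intervalIntegral.integral_mono_on hab (hX.intervalIntegrable (μ := volume))
    (intervalIntegrable_const (c := X b)) fun s hs => hX hs.2
  simpa using h

theorem integral_sub_integral_of_monotone (hX : Monotone X) (a b : ℝ) :
    (∫ s in (0 : ℝ)..b, X s) - ∫ s in (0 : ℝ)..a, X s = ∫ s in a..b, X s :=
  intervalIntegral.integral_interval_sub_left hX.intervalIntegrable hX.intervalIntegrable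

theorem ruleCost_nonneg (hX : Monotone X) {t : ℝ} (ht : 0 ≤ t) : 0 ≤ ruleCost X t := by
  have := integral_le_mul_of_monotone hX ht
  rw [ruleCost]
  linarith

theorem ruleCost_le_one (hX : Monotone X) (hmem : ∀ t, X t ∈ Icc (0 : ℝ) 1) {t : ℝ}
    (ht : t ∈ Icc (0 : ℝ) 1) : ruleCost X t ≤ 1 := by
  have h1 := mul_le_integral_of_monotone hX ht.1
  have h2 : t * X t ≤ 1 := mul_le_one₀ ht.2 (hmem t).1 (hmem t).2
  have h3 := mul_nonneg ht.1 (hmem 0).1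
  rw [ruleCost]
  linarith

theorem measurable_ruleCost (hX : Monotone X) : Measurable (ruleCost X) :=
  (measurable_id.mul hX.measurable).sub
    (intervalIntegral.continuous_primitive (fun _ _ => hX.intervalIntegrable) 0).measurable

/-- The loss from reporting `w` at value `v` is the integral of `X` from `w` to `v` minus `(v - w) *
X w`, which is nonnegative for monotone `X`. -/
theorem ruleCost_incentive (hX : Monotone X) (v w : ℝ) :
    v * X w - ruleCost X w ≤ v * X v - ruleCost X v := by
  have h := integral_sub_integral_of_monotone hX w v
  rw [ruleCost, ruleCost]
  rcases le_total w v with hvw | hvw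
  · have := mul_le_integral_of_monotone hX hvw
    linarith
  · have := integral_le_mul_of_monotone hX hvw
    rw [intervalIntegral.integral_symm v w] at h
    linarith

theorem ruleCost_congr {Y : ℝ → ℝ} {t : ℝ} (ht : t ∈ Icc (0 : ℝ) 1)
    (h : ∀ s ∈ Icc (0 : ℝ) 1, X s = Y s) : ruleCost X t = ruleCost Y t := by
  rw [ruleCost, ruleCost, h t ht, intervalIntegral.integral_congr fun s hs => ?_]
  rw [uIcc_of_le ht.1] at hs
  exact h s ⟨hs.1, hs.2.trans ht.2⟩

theorem integrable_costInv_ruleCost {c : ℝ → ℝ} (hc : IsCost c) (hX : Monotone X)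
    (hmem : ∀ t, X t ∈ Icc (0 : ℝ) 1) (hf : IsDensity f) :
    Integrable (fun t => costInv c (ruleCost X t)) (densityLaw f) := by
  have := hf.isProbabilityMeasure
  have h1 : Integrable (fun t => hc.orderIso.symm (ruleCost X t)) (densityLaw f) := by
    refine Integrable.of_bound (hc.continuous_orderIso_symm.measurable.comp
      (measurable_ruleCost hX)).aestronglyMeasurable (costInv c 1) ?_
    filter_upwards [ae_mem_densityLaw] with t ht
    have h0 := ruleCost_nonneg hX ht.1
    rw [hc.orderIso_symm_apply h0, Real.norm_of_nonneg (hc.costInv_nonneg h0)]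
    exact hc.costInv_mono h0 (ruleCost_le_one hX hmem ht)
  refine h1.congr ?_
  filter_upwards [ae_mem_densityLaw] with t ht
  exact hc.orderIso_symm_apply (ruleCost_nonneg hX ht.1)

end RuleCost

variable {n : ℕ}

/-- Thresholds below `0` reduce to the threshold `0`; those above `1` cut out null sets. -/
theorem ContRule.borderRule (hf : IsDensity f) {X : ℝ → ℝ} (hX : ContRule n f X) :
    BorderRule n (densityLaw f) X := by
  have := hf.isProbabilityMeasure
  have hnull : ∀ S : Set ℝ, Disjoint S (Icc 0 1) → densityLaw f S = 0 := fun S hS =>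
    measure_eq_zero_iff_ae_notMem.2 (ae_mem_densityLaw.mono fun t ht h => disjoint_left.1 hS h ht)
  have hbig : ∀ S : Set ℝ, Disjoint S (Icc 0 1) →
      n * ∫ s in S, X s ∂densityLaw f ≤ 1 - (1 - (densityLaw f).real S) ^ n := fun S hS => by
    rw [Measure.restrict_eq_zero.2 (hnull S hS), Measure.real, hnull S hS]
    simp
  have h0 : (0 : ℝ) ∈ Icc (0 : ℝ) 1 := ⟨le_rfl, zero_le_one⟩
  have hsmall : ∀ S : Set ℝ, Icc 0 1 ⊆ S →
      n * ∫ s in S, X s ∂densityLaw f ≤ 1 - (1 - (densityLaw f).real S) ^ n := fun S hS => by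
    have hae : S =ᵐ[densityLaw f] Ici 0 := by
      filter_upwards [ae_mem_densityLaw] with t ht
      exact propext ⟨fun _ => ht.1, fun _ => hS ht⟩
    rw [setIntegral_congr_set hae, measureReal_congr hae, hf.setIntegral_Ici X h0,
      hf.measureReal_Ici h0, sub_sub_cancel]
    exact hX.border 0 h0
  refine ⟨⟨0, 1, hnull _ ?_, hnull _ ?_⟩, hX.mono, hX.mem, fun t => ?_, fun t => ?_⟩
  · exact disjoint_left.2 fun t ht h => absurd h.1 (not_le.2 ht)
  · exact disjoint_left.2 fun t ht h => absurd h.2 (not_le.2 ht)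
  · rcases lt_or_ge t 0 with h | h
    · exact hsmall _ fun s hs => h.le.trans hs.1
    rcases lt_or_ge 1 t with h1 | h1
    · exact hbig _ (disjoint_left.2 fun s hs h => absurd (h1.trans_le hs) (not_lt.2 h.2))
    · rw [hf.setIntegral_Ici X ⟨h, h1⟩, hf.measureReal_Ici ⟨h, h1⟩, sub_sub_cancel]
      exact hX.border t ⟨h, h1⟩
  · rcases lt_or_ge t 0 with h | h
    · exact hsmall _ fun s hs => h.trans_le hs.1
    rcases lt_or_ge 1 t with h1 | h1
    · exact hbig _ (disjoint_left.2 fun s hs h => absurd (h1.trans hs) (not_lt.2 h.2))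
    · rw [hf.setIntegral_Ioi X ⟨h, h1⟩, hf.measureReal_Ioi ⟨h, h1⟩, sub_sub_cancel]
      exact hX.border t ⟨h, h1⟩

theorem ContRule.exists_mechanism (hn : 1 ≤ n) {c : ℝ → ℝ} (hc : IsCost c) (hf : IsDensity f)
    {X : ℝ → ℝ} (hX : ContRule n f X) :
    ∃ M : Mechanism n, IsAdmissible (Icc 0 1) (densityLaw f) c M ∧
      (∀ i t, interimAlloc (densityLaw f) M i t = X t) ∧
      (∀ v, (∀ j, v j ∈ Icc (0 : ℝ) 1) → ∀ i, M.pay v i = costInv c (ruleCost X (v i))) ∧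
      revenue (densityLaw f) M = n * ruleRevenue c f X := by
  have := hf.isProbabilityMeasure
  rw [ruleRevenue, ← hf.integral_densityLaw]
  refine (hX.borderRule hf).exists_mechanism hn ae_mem_densityLaw hc (measurable_ruleCost hX.mono)
    (fun t ht => ruleCost_nonneg hX.mono ht.1) (fun v _ w _ => ruleCost_incentive hX.mono v w)
    (fun v hv => ?_) (integrable_costInv_ruleCost hc hX.mono hX.mem hf)
  rw [ruleCost, sub_sub_cancel]
  exact intervalIntegral.integral_nonneg hv.1 fun s _ => (hX.mem s).1

/-- The utility of a value is at least the integral of the interim allocation rule. -/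
theorem integral_le_sub_of_incentive {X u : ℝ → ℝ} (hX : Monotone X) {t : ℝ} (ht : 0 ≤ t)
    (hu : ∀ w v, 0 ≤ w → w ≤ v → v ≤ t → (v - w) * X w ≤ u v - u w) :
    ∫ s in (0 : ℝ)..t, X s ≤ u t - u 0 := by
  -- On a partition into `N` equal steps, the incentive constraints bound the left Riemann sum of
  -- `X` by the increase of `u`. The right sum, which dominates the integral, exceeds the left one
  -- by a telescoping error.
  have hstep : ∀ N : ℕ, 0 < N → ∀ k ≤ N, ∫ s in (0 : ℝ)..(k * (t / N)), X s ≤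
      u (k * (t / N)) - u 0 + t / N * (X (k * (t / N)) - X 0) := by
    intro N hN k
    have hN' : (0 : ℝ) < N := Nat.cast_pos.2 hN
    have hd : 0 ≤ t / N := div_nonneg ht hN'.le
    induction k with
    | zero => intro _; simp
    | succ k ih =>
      intro hk
      have hle : (k : ℝ) * (t / N) ≤ ((k + 1 : ℕ) : ℝ) * (t / N) := by
        push_cast
        nlinarith
      have h1 := ih (by omega)
      have h2 := integral_le_mul_of_monotone hX hle
      have h3 := hu _ _ (mul_nonneg (Nat.cast_nonneg k) hd) hle (by
        calc ((k + 1 : ℕ) : ℝ) * (t / N) ≤ N * (t / N) :=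
              mul_le_mul_of_nonneg_right (Nat.cast_le.2 hk) hd
          _ = t := by field_simp)
      rw [← integral_sub_integral_of_monotone hX] at h2
      have h4 : ((k + 1 : ℕ) : ℝ) * (t / N) - k * (t / N) = t / N := by push_cast; ring
      rw [h4] at h2 h3
      linarith
  by_contra! hcon
  set δ := (∫ s in (0 : ℝ)..t, X s) - (u t - u 0) with hδ
  have hδ0 : 0 < δ := sub_pos.2 hcon
  -- For this `N` the error `t / N * (X t - X 0)` is smaller than the supposed gap `δ`.
  obtain ⟨N, hN⟩ := exists_nat_gt (t * (X t - X 0) / δ)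
  have hX0 : 0 ≤ t * (X t - X 0) := mul_nonneg ht (sub_nonneg.2 (hX ht))
  have hN0 : (0 : ℝ) < N := (div_nonneg hX0 hδ0.le).trans_lt hN
  have h := hstep N (Nat.cast_pos.1 hN0) N le_rfl
  rw [mul_div_cancel₀ t hN0.ne'] at h
  rw [div_lt_iff₀ hδ0] at hN
  have h2 : δ * N ≤ t / N * (X t - X 0) * N :=
    mul_le_mul_of_nonneg_right (by linarith) hN0.le
  have h3 : t / N * (X t - X 0) * N = t * (X t - X 0) := by field_simp
  linarith

/-- Averaging over bidders keeps monotonicity, Border's inequality and the incentive constraints.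
The average utility is nonnegative at `0`, so it dominates the integral of `X`, and the average cost
is at most `ruleCost X`. -/
theorem IsAdmissible.exists_contRule (hn : 1 ≤ n) {c : ℝ → ℝ} (hc : IsCost c) (hf : IsDensity f)
    {M : Mechanism n} (hM : IsAdmissible (Icc 0 1) (densityLaw f) c M) :
    ∃ X, ContRule n f X ∧
      (∀ t ∈ Icc (0 : ℝ) 1, X t = (∑ i, interimAlloc (densityLaw f) M i t) / n) ∧
      revenue (densityLaw f) M ≤ n * ruleRevenue c f X := by
  have := hf.isProbabilityMeasure
  have hn0 : (0 : ℝ) < n := by positivity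
  have hV := ae_mem_densityLaw (f := f)
  -- The projection extends the average rule by constants, so that it is monotone on all of `ℝ`.
  set X : ℝ → ℝ := fun t =>
    (∑ i, interimAlloc (densityLaw f) M i (projIcc 0 1 zero_le_one t)) / n with hXdef
  have hX : ∀ t ∈ Icc (0 : ℝ) 1, X t = (∑ i, interimAlloc (densityLaw f) M i t) / n :=
    fun t ht => by simp only [hXdef, projIcc_of_mem zero_le_one ht]
  have hmono : Monotone X := fun s t hst => by
    refine div_le_div_of_nonneg_right (Finset.sum_le_sum fun i _ => ?_) hn0.le
    exact hM.bic.interimAlloc_mono i (projIcc 0 1 zero_le_one s).2 (projIcc 0 1 zero_le_one t).2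
      (monotone_projIcc zero_le_one hst)
  have hmem : ∀ t, X t ∈ Icc (0 : ℝ) 1 := fun t => by
    have h := fun i => hM.wellFormed.interimAlloc_mem hV i (projIcc 0 1 zero_le_one t).2
    refine ⟨div_nonneg (Finset.sum_nonneg fun i _ => (h i).1) hn0.le, (div_le_one hn0).2 ?_⟩
    calc _ ≤ ∑ _i : Fin n, (1 : ℝ) := Finset.sum_le_sum fun i _ => (h i).2
      _ = n := by simp
  refine ⟨X, ⟨hmono, hmem, fun t ht => ?_⟩, hX, ?_⟩
  · have h := hM.sum_setIntegral_le hV (measurableSet_Ioi (a := t))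
    rw [hf.measureReal_Ioi ht, sub_sub_cancel] at h
    refine le_trans (le_of_eq ?_) h
    rw [← hf.setIntegral_Ioi X ht, ← integral_finsetSum _ fun i _ =>
      (hM.wellFormed.integrable_interimAlloc hV i).integrableOn, ← integral_const_mul]
    refine integral_congr_ae (ae_restrict_of_ae ?_)
    filter_upwards [hV] with s hs
    rw [hX s hs]
    field_simp
  · rw [ruleRevenue, ← hf.integral_densityLaw]
    refine hM.wellFormed.revenue_le hn hc hV (fun t ht => ?_)
      (integrable_costInv_ruleCost hc hmono hmem hf)
    set u : ℝ → ℝ := fun t => t * X t - (∑ i, interimCost (densityLaw f) c M i t) / n with hu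
    have h := integral_le_sub_of_incentive (u := u) hmono ht.1 fun w v hw hwv hv => by
      have hv' : v ∈ Icc (0 : ℝ) 1 := ⟨hw.trans hwv, hv.trans ht.2⟩
      have hw' : w ∈ Icc (0 : ℝ) 1 := ⟨hw, hwv.trans hv'.2⟩
      have h1 := Finset.sum_le_sum fun i (_ : i ∈ Finset.univ) => hM.bic i v hv' w hw'
      simp only [Finset.sum_sub_distrib, ← Finset.mul_sum] at h1
      have h2 := div_le_div_of_nonneg_right h1 hn0.le
      simp only [sub_div, mul_div_assoc, ← hX v hv', ← hX w hw'] at h2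
      simp only [hu]
      linarith
    have h0 : 0 ≤ u 0 := by
      have h1 : ∀ i, interimCost (densityLaw f) c M i 0 ≤ 0 := fun i => by
        have := hM.iir i 0 ⟨le_rfl, zero_le_one⟩
        linarith
      have h2 : (∑ i, interimCost (densityLaw f) c M i 0) / n ≤ 0 :=
        div_nonpos_of_nonpos_of_nonneg (Finset.sum_nonpos fun i _ => h1 i) hn0.le
      simp only [hu]
      linarith
    rw [ruleCost]
    simp only [hu] at h h0
    linarith

end Density

/-! ### Interim rules with a density -/

section Primitive

/-- Exchange of the order of integration over a triangle. -/
theorem integral_mul_primitive {g z : ℝ → ℝ} {a b : ℝ} (ha : 0 ≤ a) (hab : a ≤ b)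
    (hg : IntervalIntegrable g volume a b) (hz : IntervalIntegrable z volume 0 b) :
    ∫ s in a..b, g s * ∫ τ in (0 : ℝ)..s, z τ =
      ∫ τ in (0 : ℝ)..b, z τ * ∫ s in (max a τ)..b, g s := by
  have hb := ha.trans hab
  rw [intervalIntegrable_iff_integrableOn_Ioc_of_le hab] at hg
  rw [intervalIntegrable_iff_integrableOn_Ioc_of_le hb] at hz
  set ρ := volume.restrict (Ioc 0 b) with hρ
  set G : ℝ → ℝ := (Ioi a).indicator g with hG
  have hIoc : Ioc 0 b ∩ Ioi a = Ioc a b := by rw [Ioc_inter_Ioi, sup_eq_right.2 ha]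
  have hGint : Integrable G ρ := by
    rw [hG, integrable_indicator_iff measurableSet_Ioi, IntegrableOn, hρ,
      Measure.restrict_restrict measurableSet_Ioi, inter_comm, hIoc]
    exact hg
  set T : Set (ℝ × ℝ) := {p | p.2 ≤ p.1} with hT
  have hTm : MeasurableSet T := measurableSet_le measurable_snd measurable_fst
  have hint : Integrable (T.indicator fun p : ℝ × ℝ => G p.1 * z p.2) (ρ.prod ρ) :=
    (hGint.mul_prod hz).indicator hTm
  have hswap := integral_integral_swap (f := fun s τ => T.indicator (fun p : ℝ × ℝ => G p.1 * z p.2)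
    (s, τ)) hint
  have hl : ∀ s ∈ Ioc 0 b, ∫ τ, T.indicator (fun p : ℝ × ℝ => G p.1 * z p.2) (s, τ) ∂ρ =
      (Ioi a).indicator (fun s => g s * ∫ τ in (0 : ℝ)..s, z τ) s := by
    intro s hs
    have h1 : ∀ τ, T.indicator (fun p : ℝ × ℝ => G p.1 * z p.2) (s, τ) =
        G s * (Iic s).indicator z τ := fun τ => by
      by_cases h : τ ≤ s <;> simp [hT, h]
    simp only [h1]
    rw [integral_const_mul, hρ, setIntegral_indicator measurableSet_Iic, Ioc_inter_Iic,
      inf_eq_right.2 hs.2, ← intervalIntegral.integral_of_le hs.1.le]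
    by_cases h : s ∈ Ioi a <;> simp [hG, h]
  have hr : ∀ τ ∈ Ioc 0 b, ∫ s, T.indicator (fun p : ℝ × ℝ => G p.1 * z p.2) (s, τ) ∂ρ =
      z τ * ∫ s in (max a τ)..b, g s := by
    intro τ hτ
    have h1 : ∀ s, T.indicator (fun p : ℝ × ℝ => G p.1 * z p.2) (s, τ) =
        z τ * (Ici τ).indicator G s := fun s => by
      by_cases h : τ ≤ s <;> simp [hT, h, mul_comm]
    simp only [h1]
    rw [integral_const_mul, hρ, setIntegral_indicator measurableSet_Ici,
      setIntegral_congr_set ((ae_eq_refl (Ioc 0 b)).inter Ioi_ae_eq_Ici.symm),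
      hG, setIntegral_indicator measurableSet_Ioi, Ioc_inter_Ioi, Ioc_inter_Ioi,
      sup_eq_right.2 hτ.1.le, intervalIntegral.integral_of_le (max_le hab hτ.2), sup_comm]
  rw [setIntegral_congr_fun measurableSet_Ioc hl, setIntegral_congr_fun measurableSet_Ioc hr,
    setIntegral_indicator measurableSet_Ioi, hIoc] at hswap
  rw [intervalIntegral.integral_of_le hab, intervalIntegral.integral_of_le hb]
  exact hswap

variable {n : ℕ} {f z : ℝ → ℝ}

/-- The interim allocation rule with derivative `z` on `[0, 1]`. -/
def primitiveRule (z : ℝ → ℝ) (t : ℝ) : ℝ :=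
  ∫ τ in (0 : ℝ)..(projIcc (0 : ℝ) 1 zero_le_one t), z τ

theorem primitiveRule_eq (z : ℝ → ℝ) {t : ℝ} (ht : t ∈ Icc (0 : ℝ) 1) :
    primitiveRule z t = ∫ τ in (0 : ℝ)..t, z τ := by
  rw [primitiveRule, projIcc_of_mem zero_le_one ht]

theorem intervalIntegrable_sub_interval (hz : IntervalIntegrable z volume 0 1) {a b : ℝ}
    (ha : a ∈ Icc (0 : ℝ) 1) (hb : b ∈ Icc (0 : ℝ) 1) : IntervalIntegrable z volume a b := by
  rw [← uIcc_of_le (zero_le_one' ℝ)] at ha hb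
  exact hz.mono_set (uIcc_subset_uIcc ha hb)

theorem primitiveRule_mono (hz : IntervalIntegrable z volume 0 1)
    (h0 : ∀ τ ∈ Icc (0 : ℝ) 1, 0 ≤ z τ) : Monotone (primitiveRule z) := by
  intro s t hst
  have hs := (projIcc (0 : ℝ) 1 zero_le_one s).2
  have ht := (projIcc (0 : ℝ) 1 zero_le_one t).2
  have h1 : (0 : ℝ) ∈ Icc (0 : ℝ) 1 := ⟨le_rfl, zero_le_one⟩
  have hle : (projIcc (0 : ℝ) 1 zero_le_one s : ℝ) ≤ projIcc (0 : ℝ) 1 zero_le_one t :=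
    monotone_projIcc zero_le_one hst
  rw [primitiveRule, primitiveRule, ← sub_nonneg, intervalIntegral.integral_interval_sub_left
    (intervalIntegrable_sub_interval hz h1 ht) (intervalIntegrable_sub_interval hz h1 hs)]
  exact intervalIntegral.integral_nonneg hle fun τ hτ => h0 τ ⟨hs.1.trans hτ.1, hτ.2.trans ht.2⟩

/-- Integration by parts for a merely integrable `z`: Fubini over the triangle turns the integral of
the primitive into that of `(t - τ) * z τ`. -/
theorem ruleCost_primitiveRule (hz : IntervalIntegrable z volume 0 1) {t : ℝ}
    (ht : t ∈ Icc (0 : ℝ) 1) : ruleCost (primitiveRule z) t = ∫ τ in (0 : ℝ)..t, τ * z τ := by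
  have hzt : IntervalIntegrable z volume 0 t :=
    intervalIntegrable_sub_interval hz ⟨le_rfl, zero_le_one⟩ ht
  have h1 : ∫ s in (0 : ℝ)..t, primitiveRule z s = ∫ τ in (0 : ℝ)..t, z τ * (t - τ) := by
    have h := integral_mul_primitive le_rfl ht.1 (intervalIntegrable_const (c := (1 : ℝ))) hzt
    simp only [one_mul, intervalIntegral.integral_const, smul_eq_mul, mul_one] at h
    have h2 : ∫ s in (0 : ℝ)..t, primitiveRule z s = ∫ s in (0 : ℝ)..t, ∫ τ in (0 : ℝ)..s, z τ :=
      intervalIntegral.integral_congr fun s hs => by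
        rw [uIcc_of_le ht.1] at hs
        exact primitiveRule_eq z ⟨hs.1, hs.2.trans ht.2⟩
    rw [h2, h]
    refine intervalIntegral.integral_congr fun τ hτ => ?_
    rw [uIcc_of_le ht.1] at hτ
    simp only [max_eq_right hτ.1]
  rw [ruleCost, h1, primitiveRule_eq z ht, ← intervalIntegral.integral_const_mul,
    ← intervalIntegral.integral_sub (hzt.const_mul t)
      (hzt.mul_continuousOn (by fun_prop))]
  refine intervalIntegral.integral_congr fun τ _ => ?_
  ring

theorem ruleRevenue_primitiveRule (c : ℝ → ℝ) (hz : IntervalIntegrable z volume 0 1) :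
    ruleRevenue c f (primitiveRule z) = contObjective c f z := by
  refine intervalIntegral.integral_congr fun t ht => ?_
  rw [uIcc_of_le zero_le_one] at ht
  simp only [ruleCost_primitiveRule hz ht]

theorem integral_mul_primitiveRule (hf : IsDensity f) (hz : IntervalIntegrable z volume 0 1)
    {t : ℝ} (ht : t ∈ Icc (0 : ℝ) 1) :
    ∫ s in t..1, f s * primitiveRule z s =
      ∫ τ in (0 : ℝ)..1, z τ * (1 - densityCdf f (max t τ)) := by
  have h := integral_mul_primitive ht.1 ht.2 (hf.intervalIntegrable ht ⟨zero_le_one, le_rfl⟩) hz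
  rw [intervalIntegral.integral_congr (g := fun s => f s * ∫ τ in (0 : ℝ)..s, z τ) fun s hs => ?_, h]
  · refine intervalIntegral.integral_congr fun τ hτ => ?_
    rw [uIcc_of_le zero_le_one] at hτ
    rw [hf.integral_tail ⟨hτ.1.trans (le_max_right _ _), max_le ht.2 hτ.2⟩]
  · rw [uIcc_of_le ht.2] at hs
    rw [primitiveRule_eq z ⟨ht.1.trans hs.1, hs.2⟩]

/-- The bound by `1` is implied by the constraints. For `t < 1`, monotonicity and the constraint
bound `(1 - F t)` times the rule by `(1 - F t ^ n) / n`, hence by `1 - F t`. At `t = 1` continuity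
of the primitive takes over. -/
theorem ContFeasible.contRule (hn : 1 ≤ n) (hf : IsDensity f) (hz : ContFeasible n f z) :
    ContRule n f (primitiveRule z) := by
  have hn0 : (0 : ℝ) < n := by positivity
  have hmono := primitiveRule_mono hz.integrable hz.nonneg
  have hborder : ∀ t ∈ Icc (0 : ℝ) 1,
      n * ∫ s in t..1, f s * primitiveRule z s ≤ 1 - densityCdf f t ^ n := fun t ht => by
    rw [integral_mul_primitiveRule hf hz.integrable ht, ← le_div_iff₀' hn0]
    exact hz.border t ht
  have h0 : (0 : ℝ) ∈ Icc (0 : ℝ) 1 := ⟨le_rfl, zero_le_one⟩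
  have h1 : (1 : ℝ) ∈ Icc (0 : ℝ) 1 := ⟨zero_le_one, le_rfl⟩
  have hlt : ∀ t ∈ Ico (0 : ℝ) 1, primitiveRule z t ≤ 1 := by
    intro t ht
    have ht' : t ∈ Icc (0 : ℝ) 1 := ⟨ht.1, ht.2.le⟩
    have hfi := hf.intervalIntegrable ht' h1
    have h2 : (1 - densityCdf f t) * primitiveRule z t ≤ ∫ s in t..1, f s * primitiveRule z s := by
      rw [← hf.integral_tail ht', ← intervalIntegral.integral_mul_const]
      refine intervalIntegral.integral_mono_on ht.2.le (hfi.mul_const _) ?_ fun s hs => ?_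
      · exact (hmono.intervalIntegrable (μ := volume)).continuousOn_mul
          (hf.cont.mono (uIcc_subset_Icc ht' h1))
      · exact mul_le_mul_of_nonneg_left (hmono hs.1) (hf.nonneg ⟨ht.1.trans hs.1, hs.2⟩)
    have h3 := pow_tangent_le (hf.cdf_nonneg ht') zero_le_one n
    have h4 := hborder t ht'
    have h5 := sub_pos.2 (hf.cdf_lt_one ht)
    simp only [one_pow, mul_one] at h3
    have h6 : n * ((1 - densityCdf f t) * primitiveRule z t) ≤ n * ((1 - densityCdf f t) * 1) := by
      have := mul_le_mul_of_nonneg_left h2 hn0.le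
      linarith
    exact le_of_mul_le_mul_left (le_of_mul_le_mul_left h6 hn0) h5
  have hone : primitiveRule z 1 ≤ 1 := by
    rw [primitiveRule_eq z h1]
    have hcont : ContinuousOn (fun t => ∫ τ in (0 : ℝ)..t, z τ) (Icc 0 1) := by
      have := intervalIntegral.continuousOn_primitive_interval' (b₁ := 0) (b₂ := 1) hz.integrable
        left_mem_uIcc
      rwa [uIcc_of_le (zero_le_one' ℝ)] at this
    rw [← closure_Ico (zero_ne_one' ℝ)] at hcont h1
    refine le_on_closure (fun t ht => ?_) hcont continuousOn_const h1
    rw [← primitiveRule_eq z ⟨ht.1, ht.2.le⟩]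
    exact hlt t ht
  refine ⟨hmono, fun t => ⟨?_, ?_⟩, hborder⟩
  · exact intervalIntegral.integral_nonneg (projIcc (0 : ℝ) 1 zero_le_one t).2.1
      fun τ hτ => hz.nonneg τ ⟨hτ.1, hτ.2.trans (projIcc (0 : ℝ) 1 zero_le_one t).2.2⟩
  · rcases lt_or_ge t 1 with h | h
    · exact (hmono (le_max_right 0 t)).trans (hlt _ ⟨le_max_left _ _, max_lt zero_lt_one h⟩)
    · have : primitiveRule z t = primitiveRule z 1 := by
        rw [primitiveRule, primitiveRule, projIcc_of_right_le _ h, projIcc_right]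
      rwa [this]

/-- As `f` is nonnegative, a rule that is pointwise smaller inherits Border's inequalities; this is
how smoothed rules become feasible. -/
theorem contFeasible_of_primitiveRule (hn : 1 ≤ n) (hf : IsDensity f)
    (hz : IntervalIntegrable z volume 0 1) (h0 : ∀ τ ∈ Icc (0 : ℝ) 1, 0 ≤ z τ) {X : ℝ → ℝ}
    (hX : ContRule n f X) (hle : ∀ t ∈ Icc (0 : ℝ) 1, ∫ τ in (0 : ℝ)..t, z τ ≤ X t) :
    ContFeasible n f z := by
  have hn0 : (0 : ℝ) < n := by positivity
  refine ⟨hz, h0, fun t ht => ?_⟩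
  rw [← integral_mul_primitiveRule hf hz ht, le_div_iff₀' hn0]
  refine le_trans (mul_le_mul_of_nonneg_left ?_ hn0.le) (hX.border t ht)
  have hfc : ContinuousOn f (uIcc t 1) :=
    hf.cont.mono (uIcc_subset_Icc ht ⟨zero_le_one, le_rfl⟩)
  refine intervalIntegral.integral_mono_on ht.2
    ((primitiveRule_mono hz h0).intervalIntegrable.continuousOn_mul hfc)
    (hX.mono.intervalIntegrable.continuousOn_mul hfc) fun s hs => ?_
  have hs' : s ∈ Icc (0 : ℝ) 1 := ⟨ht.1.trans hs.1, hs.2⟩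
  refine mul_le_mul_of_nonneg_left ?_ (hf.nonneg hs')
  rw [primitiveRule_eq z hs']
  exact hle s hs'

theorem ContFeasible.exists_mechanism (hn : 1 ≤ n) {c : ℝ → ℝ} (hc : IsCost c) (hf : IsDensity f)
    (hz : ContFeasible n f z) :
    ∃ M : Mechanism n, IsAdmissible (Icc 0 1) (densityLaw f) c M ∧
      (∀ i, ∀ t ∈ Icc (0 : ℝ) 1,
        interimAlloc (densityLaw f) M i t = ∫ τ in (0 : ℝ)..t, z τ) ∧
      (∀ v, (∀ j, v j ∈ Icc (0 : ℝ) 1) →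
        ∀ i, M.pay v i = costInv c (∫ τ in (0 : ℝ)..(v i), τ * z τ)) ∧
      revenue (densityLaw f) M = n * contObjective c f z := by
  obtain ⟨M, hM, hMX, hMp, hMr⟩ := (hz.contRule hn hf).exists_mechanism hn hc hf
  refine ⟨M, hM, fun i t ht => ?_, fun v hv i => ?_, ?_⟩
  · rw [hMX, primitiveRule_eq z ht]
  · rw [hMp v hv, ruleCost_primitiveRule hz.integrable (hv i)]
  · rw [hMr, ruleRevenue_primitiveRule c hz.integrable]

theorem contFeasible_of_isAdmissible (hn : 1 ≤ n) {c : ℝ → ℝ} (hc : IsCost c) (hf : IsDensity f)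
    {M : Mechanism n} (hM : IsAdmissible (Icc 0 1) (densityLaw f) c M)
    (hz : IntervalIntegrable z volume 0 1) (h0 : ∀ τ ∈ Icc (0 : ℝ) 1, 0 ≤ z τ)
    (hMz : ∀ t ∈ Icc (0 : ℝ) 1,
      (∑ i, interimAlloc (densityLaw f) M i t) / n = ∫ τ in (0 : ℝ)..t, z τ) :
    ContFeasible n f z ∧ revenue (densityLaw f) M ≤ n * contObjective c f z := by
  obtain ⟨X, hX, hXM, hrev⟩ := hM.exists_contRule hn hc hf
  have hXz : ∀ t ∈ Icc (0 : ℝ) 1, X t = primitiveRule z t := fun t ht => by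
    rw [hXM t ht, hMz t ht, primitiveRule_eq z ht]
  refine ⟨contFeasible_of_primitiveRule hn hf hz h0 hX fun t ht => ?_, hrev.trans_eq ?_⟩
  · rw [hXz t ht, primitiveRule_eq z ht]
  · rw [← ruleRevenue_primitiveRule c hz, ruleRevenue, ruleRevenue]
    congr 1
    refine intervalIntegral.integral_congr fun t ht => ?_
    rw [uIcc_of_le zero_le_one] at ht
    simp only [ruleCost_congr ht hXz]

end Primitive

/-! ### Existence of optimal interim rules -/

section Limits

open Filter Topology

variable {n : ℕ} {f c : ℝ → ℝ}

theorem ruleRevenue_eq (hf : IsDensity f) (c X : ℝ → ℝ) :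
    ruleRevenue c f X = ∫ t, costInv c (ruleCost X t) ∂densityLaw f :=
  (hf.integral_densityLaw _).symm

theorem ruleRevenue_le (hc : IsCost c) (hf : IsDensity f) {X : ℝ → ℝ} (hX : Monotone X)
    (hmem : ∀ t, X t ∈ Icc (0 : ℝ) 1) : ruleRevenue c f X ≤ costInv c 1 := by
  have := hf.isProbabilityMeasure
  rw [ruleRevenue_eq hf]
  calc _ ≤ ∫ _t, costInv c 1 ∂densityLaw f := by
        refine integral_mono_ae (integrable_costInv_ruleCost hc hX hmem hf) (integrable_const _) ?_
        filter_upwards [ae_mem_densityLaw] with t ht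
        exact hc.costInv_mono (ruleCost_nonneg hX ht.1) (ruleCost_le_one hX hmem ht)
    _ = _ := by simp

theorem ae_densityLaw_of_ae {P : ℝ → Prop} (h : ∀ᵐ t ∂volume.restrict (Icc (0 : ℝ) 1), P t) :
    ∀ᵐ t ∂densityLaw f, P t :=
  (withDensity_absolutelyContinuous _ _).ae_le h

/-- Dominated convergence twice: for the integral inside the cost, where the rules are at most `1`,
and for the revenue, where the integrands are at most `costInv c 1`. -/
theorem tendsto_ruleRevenue (hc : IsCost c) (hf : IsDensity f) {Y : ℕ → ℝ → ℝ} {X : ℝ → ℝ}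
    (hY : ∀ k, Monotone (Y k)) (hYmem : ∀ k t, Y k t ∈ Icc (0 : ℝ) 1) (hX : Monotone X)
    (hlim : ∀ᵐ t ∂volume.restrict (Icc (0 : ℝ) 1), Tendsto (fun k => Y k t) atTop (𝓝 (X t))) :
    Tendsto (fun k => ruleRevenue c f (Y k)) atTop (𝓝 (ruleRevenue c f X)) := by
  have := hf.isProbabilityMeasure
  simp only [ruleRevenue_eq hf]
  refine tendsto_integral_of_dominated_convergence (fun _ => costInv c 1)
    (fun k => (integrable_costInv_ruleCost hc (hY k) (hYmem k) hf).aestronglyMeasurable)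
    (integrable_const _) (fun k => ?_) ?_
  · filter_upwards [ae_mem_densityLaw] with t ht
    have h0 := ruleCost_nonneg (hY k) ht.1
    rw [Real.norm_of_nonneg (hc.costInv_nonneg h0)]
    exact hc.costInv_mono h0 (ruleCost_le_one (hY k) (hYmem k) ht)
  · filter_upwards [ae_mem_densityLaw, ae_densityLaw_of_ae hlim] with t ht htlim
    have hint : Tendsto (fun k => ∫ s in (0 : ℝ)..t, Y k s) atTop (𝓝 (∫ s in (0 : ℝ)..t, X s)) := by
      simp only [intervalIntegral.integral_of_le ht.1]
      refine tendsto_integral_of_dominated_convergence (fun _ => (1 : ℝ))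
        (fun k => (hY k).measurable.aestronglyMeasurable) (integrable_const _)
        (fun k => Eventually.of_forall fun s => ?_) ?_
      · rw [Real.norm_of_nonneg (hYmem k s).1]
        exact (hYmem k s).2
      · exact ae_restrict_of_ae_restrict_of_subset
          (Ioc_subset_Icc_self.trans (Icc_subset_Icc_right ht.2)) hlim
    have hcost : Tendsto (fun k => ruleCost (Y k) t) atTop (𝓝 (ruleCost X t)) :=
      (htlim.const_mul t).sub hint
    have h := (hc.continuous_orderIso_symm.tendsto _).comp hcost
    rw [hc.orderIso_symm_apply (ruleCost_nonneg hX ht.1)] at h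
    refine h.congr fun k => ?_
    exact hc.orderIso_symm_apply (ruleCost_nonneg (hY k) ht.1)

theorem ContRule.of_tendsto (hf : IsDensity f) {Y : ℕ → ℝ → ℝ} {X : ℝ → ℝ}
    (hY : ∀ k, ContRule n f (Y k)) (hX : Monotone X) (hmem : ∀ t, X t ∈ Icc (0 : ℝ) 1)
    (hlim : ∀ᵐ t ∂volume.restrict (Icc (0 : ℝ) 1), Tendsto (fun k => Y k t) atTop (𝓝 (X t))) :
    ContRule n f X := by
  have := hf.isProbabilityMeasure
  refine ⟨hX, hmem, fun t ht => ?_⟩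
  have h : Tendsto (fun k => ∫ s in t..1, f s * Y k s) atTop (𝓝 (∫ s in t..1, f s * X s)) := by
    simp only [← hf.setIntegral_Ioi _ ht]
    refine tendsto_integral_of_dominated_convergence (fun _ => (1 : ℝ))
      (fun k => (hY k).mono.measurable.aestronglyMeasurable) (integrable_const _)
      (fun k => Eventually.of_forall fun s => ?_) (ae_restrict_of_ae (ae_densityLaw_of_ae hlim))
    rw [Real.norm_of_nonneg ((hY k).mem s).1]
    exact ((hY k).mem s).2
  exact le_of_tendsto' (h.const_mul _) fun k => (hY k).border t ht

theorem ContRule.zero (hf : IsDensity f) : ContRule n f fun _ => 0 := by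
  refine ⟨monotone_const, fun _ => ⟨le_rfl, zero_le_one⟩, fun t ht => ?_⟩
  simpa using pow_le_one₀ (hf.cdf_nonneg ht) (hf.cdf_le_one ht)

/-! ### Convexity of the set of rules and concavity of the revenue -/

section Convex

variable {X Y : ℝ → ℝ} {a b : ℝ}

theorem ContRule.combo (hf : IsDensity f) (hX : ContRule n f X) (hY : ContRule n f Y) (ha : 0 ≤ a)
    (hb : 0 ≤ b) (hab : a + b = 1) : ContRule n f fun t => a * X t + b * Y t := by
  refine ⟨fun s t hst => add_le_add (mul_le_mul_of_nonneg_left (hX.mono hst) ha)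
    (mul_le_mul_of_nonneg_left (hY.mono hst) hb), fun t => ?_, fun t ht => ?_⟩
  · exact convex_Icc (0 : ℝ) 1 (hX.mem t) (hY.mem t) ha hb hab
  · have := hf.isProbabilityMeasure
    rw [← hf.setIntegral_Ioi _ ht, integral_add
      (((hX.borderRule hf).integrable.const_mul a).integrableOn)
      (((hY.borderRule hf).integrable.const_mul b).integrableOn), integral_const_mul,
      integral_const_mul, hf.setIntegral_Ioi X ht, hf.setIntegral_Ioi Y ht]
    have h1 := mul_le_mul_of_nonneg_left (hX.border t ht) ha
    have h2 := mul_le_mul_of_nonneg_left (hY.border t ht) hb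
    calc _ = a * (n * ∫ s in t..1, f s * X s) + b * (n * ∫ s in t..1, f s * Y s) := by ring
      _ ≤ a * (1 - densityCdf f t ^ n) + b * (1 - densityCdf f t ^ n) := add_le_add h1 h2
      _ = _ := by rw [← add_mul, hab, one_mul]

theorem ruleCost_combo (hX : Monotone X) (hY : Monotone Y) (a b t : ℝ) :
    ruleCost (fun t => a * X t + b * Y t) t = a * ruleCost X t + b * ruleCost Y t := by
  rw [ruleCost, ruleCost, ruleCost, intervalIntegral.integral_add
    (hX.intervalIntegrable.const_mul a) (hY.intervalIntegrable.const_mul b),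
    intervalIntegral.integral_const_mul, intervalIntegral.integral_const_mul]
  ring

/-- The cost is linear in the rule and `costInv c` is concave. -/
theorem ruleRevenue_combo_ge (hc : IsCost c) (hf : IsDensity f) (hX : ContRule n f X)
    (hY : ContRule n f Y) (ha : 0 ≤ a) (hb : 0 ≤ b) (hab : a + b = 1) :
    a * ruleRevenue c f X + b * ruleRevenue c f Y ≤
      ruleRevenue c f fun t => a * X t + b * Y t := by
  have hXY := hX.combo hf hY ha hb hab
  have h1 := integrable_costInv_ruleCost hc hX.mono hX.mem hf
  have h2 := integrable_costInv_ruleCost hc hY.mono hY.mem hf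
  rw [ruleRevenue_eq hf, ruleRevenue_eq hf, ruleRevenue_eq hf, ← integral_const_mul,
    ← integral_const_mul, ← integral_add (h1.const_mul a) (h2.const_mul b)]
  refine integral_mono_ae ((h1.const_mul a).add (h2.const_mul b))
    (integrable_costInv_ruleCost hc hXY.mono hXY.mem hf) ?_
  filter_upwards [ae_mem_densityLaw] with t ht
  rw [ruleCost_combo hX.mono hY.mono]
  exact hc.concaveOn_costInv.2 (ruleCost_nonneg hX.mono ht.1) (ruleCost_nonneg hY.mono ht.1)
    ha hb hab

end Convex

/-- Some interim rule maximizes the revenue: maximizing sequences have convex combinations that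
converge almost everywhere. -/
theorem exists_optimal_rule (n : ℕ) (hc : IsCost c) (hf : IsDensity f) :
    ∃ X, ContRule n f X ∧ ∀ Y, ContRule n f Y → ruleRevenue c f Y ≤ ruleRevenue c f X := by
  set R : Set ℝ := {r | ∃ Y, ContRule n f Y ∧ ruleRevenue c f Y = r} with hR
  have hbdd : BddAbove R := ⟨costInv c 1, by
    rintro _ ⟨Y, hY, rfl⟩
    exact ruleRevenue_le hc hf hY.mono hY.mem⟩
  have hne : R.Nonempty := ⟨_, _, ContRule.zero hf, rfl⟩
  -- Classes of rules within `1 / (k + 1)` of the supremum; concavity of the revenue makes these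
  -- sets convex.
  set D : ℕ → Set (Lp ℝ 2 (volume.restrict (Icc (0 : ℝ) 1))) := fun k =>
    {u | ∃ Y, ContRule n f Y ∧ sSup R - 1 / ((k : ℝ) + 1) ≤ ruleRevenue c f Y ∧
      u =ᵐ[volume.restrict (Icc (0 : ℝ) 1)] Y} with hD
  have hanti : Antitone D := by
    rintro i j hij u ⟨Y, hY, hrev, hu⟩
    have := Nat.one_div_le_one_div (α := ℝ) hij
    exact ⟨Y, hY, by linarith, hu⟩
  have hconv : ∀ k, Convex ℝ (D k) := by
    rintro k u ⟨Y, hY, hYrev, hu⟩ w ⟨Z, hZ, hZrev, hw⟩ a b ha hb hab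
    refine ⟨fun t => a * Y t + b * Z t, hY.combo hf hZ ha hb hab, ?_, ?_⟩
    · refine le_trans ?_ (ruleRevenue_combo_ge hc hf hY hZ ha hb hab)
      calc sSup R - 1 / ((k : ℝ) + 1) = a * (sSup R - 1 / ((k : ℝ) + 1)) +
            b * (sSup R - 1 / ((k : ℝ) + 1)) := by rw [← add_mul, hab, one_mul]
        _ ≤ _ := add_le_add (mul_le_mul_of_nonneg_left hYrev ha)
            (mul_le_mul_of_nonneg_left hZrev hb)
    · filter_upwards [Lp.coeFn_add (a • u) (b • w), Lp.coeFn_smul a u, Lp.coeFn_smul b w, hu, hw]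
        with t h1 h2 h3 h4 h5
      rw [h1, Pi.add_apply, h2, h3, Pi.smul_apply, Pi.smul_apply, h4, h5, smul_eq_mul, smul_eq_mul]
  have hDne : ∀ k, (D k).Nonempty := fun k => by
    obtain ⟨_, ⟨Y, hY, rfl⟩, hlt⟩ := exists_lt_of_lt_csSup hne
      (sub_lt_self (sSup R) (by positivity : (0 : ℝ) < 1 / ((k : ℝ) + 1)))
    have hL := memLp_of_bound_one (ρ := volume.restrict (Icc (0 : ℝ) 1)) hY.mono.measurable hY.mem
    exact ⟨hL.toLp Y, Y, hY, hlt.le, hL.coeFn_toLp⟩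
  obtain ⟨u, x, hu, hux⟩ := exists_tendsto_of_antitone_convex D hanti hconv hDne
    (R := measureUnivNNReal (volume.restrict (Icc (0 : ℝ) 1)) ^ (2 : ENNReal).toReal⁻¹ * 1) (by
      rintro u ⟨Y, hY, -, hu⟩
      refine Lp.norm_le_of_ae_bound zero_le_one ?_
      filter_upwards [hu] with t ht
      rw [ht, Real.norm_of_nonneg (hY.mem t).1]
      exact (hY.mem t).2)
  obtain ⟨ns, hns, hae⟩ := (tendstoInMeasure_of_tendsto_Lp hux).exists_seq_tendsto_ae
  choose Y hY hrev huY using hu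
  have hbddA : ∀ t, IsBoundedUnder (· ≤ ·) atTop fun k => Y (ns k) t := fun t =>
    isBoundedUnder_of ⟨1, fun k => ((hY _).mem t).2⟩
  have hbddB : ∀ t, IsBoundedUnder (· ≥ ·) atTop fun k => Y (ns k) t := fun t =>
    isBoundedUnder_of ⟨0, fun k => ((hY _).mem t).1⟩
  -- The L² limit is only a class. The pointwise limsup is monotone at every point and agrees with
  -- it almost everywhere on `[0, 1]`.
  set X : ℝ → ℝ := fun t => limsup (fun k => Y (ns k) t) atTop with hX
  have hmono : Monotone X := fun s t hst =>
    limsup_le_limsup (Eventually.of_forall fun k => (hY _).mono hst)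
      (hbddB s).isCoboundedUnder_le (hbddA t)
  have hmem : ∀ t, X t ∈ Icc (0 : ℝ) 1 := fun t => by
    refine ⟨le_limsup_of_frequently_le (Frequently.of_forall fun k => ((hY _).mem t).1) (hbddA t),
      limsup_le_of_le (hbddB t).isCoboundedUnder_le (Eventually.of_forall fun k => ((hY _).mem t).2)⟩
  have hlim : ∀ᵐ t ∂volume.restrict (Icc (0 : ℝ) 1),
      Tendsto (fun k => Y (ns k) t) atTop (𝓝 (X t)) := by
    filter_upwards [hae, ae_all_iff.2 huY] with t h1 h2
    simp only [h2] at h1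
    rwa [show X t = x t from h1.limsup_eq]
  refine ⟨X, ContRule.of_tendsto hf (fun k => hY (ns k)) hmono hmem hlim, fun Z hZ => ?_⟩
  refine (le_csSup hbdd ⟨Z, hZ, rfl⟩).trans ?_
  have h1 := tendsto_ruleRevenue hc hf (fun k => (hY (ns k)).mono) (fun k => (hY (ns k)).mem)
    hmono hlim
  have h2 : Tendsto (fun k : ℕ => sSup R - 1 / ((ns k : ℝ) + 1)) atTop (𝓝 (sSup R - 0)) :=
    tendsto_const_nhds.sub ((tendsto_one_div_add_atTop_nhds_zero_nat (𝕜 := ℝ)).comp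
      hns.tendsto_atTop)
  rw [sub_zero] at h2
  exact le_of_tendsto_of_tendsto' h2 h1 fun k => hrev (ns k)

end Limits

/-! ### Approximation by interim rules with a density -/

section Smoothing

open Filter Topology

variable {n : ℕ} {f c : ℝ → ℝ}

/-- The rule `X`, set to zero at negative values. -/
def truncRule (X : ℝ → ℝ) : ℝ → ℝ := (Ici 0).indicator X

/-- The derivative of the moving average of `truncRule X` over a window of length `ε` to the
left. -/
def windowSlope (X : ℝ → ℝ) (ε t : ℝ) : ℝ :=
  (truncRule X t - truncRule X (t - ε)) / ε

variable {X : ℝ → ℝ}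

theorem truncRule_mem (hX : ∀ t, X t ∈ Icc (0 : ℝ) 1) (t : ℝ) : truncRule X t ∈ Icc (0 : ℝ) 1 := by
  by_cases ht : t ∈ Ici (0 : ℝ)
  · simpa [truncRule, ht] using hX t
  · simp [truncRule, ht]

theorem truncRule_mono (hX : Monotone X) (hmem : ∀ t, X t ∈ Icc (0 : ℝ) 1) :
    Monotone (truncRule X) := by
  intro s t hst
  by_cases hs : s ∈ Ici (0 : ℝ)
  · have ht : t ∈ Ici (0 : ℝ) := le_trans hs hst
    simpa [truncRule, hs, ht] using hX hst
  · rw [truncRule, indicator_of_notMem hs]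
    exact (truncRule_mem hmem t).1

theorem truncRule_eq {t : ℝ} (ht : 0 ≤ t) : truncRule X t = X t :=
  indicator_of_mem (mem_Ici.2 ht) X

variable {ε : ℝ}

theorem intervalIntegrable_shift (hX : Monotone X) (ε a b : ℝ) :
    IntervalIntegrable (fun t => X (t - ε)) volume a b :=
  Monotone.intervalIntegrable fun _ _ h => hX (sub_le_sub_right h ε)

theorem intervalIntegrable_windowSlope (hX : Monotone X) (hmem : ∀ t, X t ∈ Icc (0 : ℝ) 1)
    (ε a b : ℝ) : IntervalIntegrable (windowSlope X ε) volume a b :=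
  ((truncRule_mono hX hmem).intervalIntegrable.sub
    (intervalIntegrable_shift (truncRule_mono hX hmem) ε a b)).div_const ε

theorem windowSlope_nonneg (hX : Monotone X) (hmem : ∀ t, X t ∈ Icc (0 : ℝ) 1) (hε : 0 < ε)
    (t : ℝ) : 0 ≤ windowSlope X ε t :=
  div_nonneg (sub_nonneg.2 (truncRule_mono hX hmem (by linarith))) hε.le

/-- After a shift by `ε` the two integrals cancel except over the window. Truncation removes the
part left of `0`, so the average is a primitive starting at `0`. -/
theorem integral_windowSlope (hX : Monotone X) (hmem : ∀ t, X t ∈ Icc (0 : ℝ) 1) (hε : 0 < ε)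
    (t : ℝ) : ∫ s in (0 : ℝ)..t, windowSlope X ε s =
      (∫ s in (t - ε)..t, truncRule X s) / ε := by
  have hT := truncRule_mono hX hmem
  have hneg : ∫ s in (0 - ε)..0, truncRule X s = 0 := by
    rw [intervalIntegral.integral_of_le (by linarith), integral_Ioc_eq_integral_Ioo]
    refine setIntegral_eq_zero_of_forall_eq_zero fun s hs => ?_
    exact indicator_of_notMem (fun h => absurd hs.2 (not_lt.2 h)) X
  have h1 : ∫ s in (0 : ℝ)..t, windowSlope X ε s =
      ((∫ s in (0 : ℝ)..t, truncRule X s) - ∫ s in (0 : ℝ)..t, truncRule X (s - ε)) / ε := by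
    rw [← intervalIntegral.integral_sub hT.intervalIntegrable (intervalIntegrable_shift hT ε _ _),
      ← intervalIntegral.integral_div]
    rfl
  have h2 := intervalIntegral.integral_add_adjacent_intervals (μ := volume) (f := truncRule X)
    (a := 0 - ε) (b := 0) (c := t) hT.intervalIntegrable hT.intervalIntegrable
  have h3 := intervalIntegral.integral_add_adjacent_intervals (μ := volume) (f := truncRule X)
    (a := 0 - ε) (b := t - ε) (c := t) hT.intervalIntegrable hT.intervalIntegrable
  rw [h1, intervalIntegral.integral_comp_sub_right]
  congr 1
  linarith

theorem integral_windowSlope_le (hX : Monotone X) (hmem : ∀ t, X t ∈ Icc (0 : ℝ) 1) (hε : 0 < ε)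
    (t : ℝ) : ∫ s in (0 : ℝ)..t, windowSlope X ε s ≤ truncRule X t := by
  rw [integral_windowSlope hX hmem hε, div_le_iff₀' hε]
  have := integral_le_mul_of_monotone (truncRule_mono hX hmem) (by linarith : t - ε ≤ t)
  rwa [sub_sub_cancel] at this

theorem le_integral_windowSlope (hX : Monotone X) (hmem : ∀ t, X t ∈ Icc (0 : ℝ) 1) (hε : 0 < ε)
    (t : ℝ) : truncRule X (t - ε) ≤ ∫ s in (0 : ℝ)..t, windowSlope X ε s := by
  rw [integral_windowSlope hX hmem hε, le_div_iff₀' hε]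
  have := mul_le_integral_of_monotone (truncRule_mono hX hmem) (by linarith : t - ε ≤ t)
  rwa [sub_sub_cancel] at this

/-- Every interim rule is approximated by feasible solutions of the program. -/
theorem ContRule.exists_contFeasible_tendsto (hn : 1 ≤ n) (hc : IsCost c) (hf : IsDensity f)
    (hX : ContRule n f X) :
    ∃ z : ℕ → ℝ → ℝ, (∀ k, ContFeasible n f (z k)) ∧
      Tendsto (fun k => contObjective c f (z k)) atTop (𝓝 (ruleRevenue c f X)) := by
  set e : ℕ → ℝ := fun k => 1 / ((k : ℝ) + 1) with he
  have he0 : ∀ k, 0 < e k := fun k => by positivity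
  have hint : ∀ k, IntervalIntegrable (windowSlope X (e k)) volume 0 1 := fun k =>
    intervalIntegrable_windowSlope hX.mono hX.mem _ _ _
  have hfeas : ∀ k, ContFeasible n f (windowSlope X (e k)) := fun k =>
    contFeasible_of_primitiveRule hn hf (hint k)
      (fun τ _ => windowSlope_nonneg hX.mono hX.mem (he0 k) τ) hX fun t ht =>
      (integral_windowSlope_le hX.mono hX.mem (he0 k) t).trans_eq (truncRule_eq ht.1)
  refine ⟨fun k => windowSlope X (e k), hfeas, ?_⟩
  have hrule := fun k => (hfeas k).contRule hn hf
  simp only [← ruleRevenue_primitiveRule c (hint _)]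
  refine tendsto_ruleRevenue hc hf (fun k => (hrule k).mono) (fun k => (hrule k).mem) hX.mono ?_
  have hT := truncRule_mono hX.mono hX.mem
  -- A monotone function has countably many discontinuities. At every other point the average is
  -- squeezed between `truncRule X (t - e k)` and `truncRule X t`.
  have hcont : ∀ᵐ t, ContinuousAt (truncRule X) t :=
    measure_eq_zero_iff_ae_notMem.1 (hT.countable_not_continuousAt.measure_zero volume) |>.mono
      fun t ht => not_not.1 ht
  filter_upwards [ae_restrict_of_ae hcont, ae_restrict_mem measurableSet_Icc] with t hct ht
  have hshift : Tendsto (fun k => truncRule X (t - e k)) atTop (𝓝 (truncRule X t)) := by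
    refine hct.tendsto.comp ?_
    have : Tendsto (fun k => t - e k) atTop (𝓝 (t - 0)) :=
      tendsto_const_nhds.sub tendsto_one_div_add_atTop_nhds_zero_nat
    rwa [sub_zero] at this
  rw [← truncRule_eq (X := X) ht.1]
  refine tendsto_of_tendsto_of_tendsto_of_le_of_le hshift tendsto_const_nhds (fun k => ?_)
    fun k => ?_
  · dsimp only
    rw [primitiveRule_eq _ ht]
    exact le_integral_windowSlope hX.mono hX.mem (he0 k) t
  · dsimp only
    rw [primitiveRule_eq _ ht]
    exact integral_windowSlope_le hX.mono hX.mem (he0 k) t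

theorem continuous_program (hn : 1 ≤ n) (hc : IsCost c) (hf : IsDensity f) :
    (∃ opt : ℝ,
      IsLUB {r | ∃ z, ContFeasible n f z ∧ r = contObjective c f z} opt ∧
      IsGreatest {r | ∃ M : Mechanism n, IsAdmissible (Icc 0 1) (densityLaw f) c M ∧
        r = revenue (densityLaw f) M} (n * opt)) ∧
    ∀ z, ContSolution n c f z ↔
      IntervalIntegrable z volume 0 1 ∧ (∀ τ ∈ Icc (0 : ℝ) 1, 0 ≤ z τ) ∧
        ∃ M : Mechanism n, IsOptimalAuction (Icc 0 1) (densityLaw f) c M ∧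
          ∀ i, ∀ t ∈ Icc (0 : ℝ) 1,
            interimAlloc (densityLaw f) M i t = ∫ τ in (0 : ℝ)..t, z τ := by
  have hn0 : (0 : ℝ) < n := by positivity
  obtain ⟨X, hX, hmax⟩ := exists_optimal_rule n hc hf
  obtain ⟨w, hw, hwlim⟩ := hX.exists_contFeasible_tendsto hn hc hf
  have hbound : ∀ M : Mechanism n, IsAdmissible (Icc 0 1) (densityLaw f) c M →
      revenue (densityLaw f) M ≤ n * ruleRevenue c f X := fun M hM => by
    obtain ⟨Y, hY, -, hrev⟩ := hM.exists_contRule hn hc hf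
    exact hrev.trans (mul_le_mul_of_nonneg_left (hmax Y hY) hn0.le)
  refine ⟨⟨ruleRevenue c f X, ⟨?_, fun b hb => ?_⟩, ?_, ?_⟩, fun z => ⟨?_, ?_⟩⟩
  · rintro _ ⟨z, hz, rfl⟩
    rw [← ruleRevenue_primitiveRule c hz.integrable]
    exact hmax _ (hz.contRule hn hf)
  -- The smoothed rules show that no smaller upper bound exists, even if `X` itself has no density.
  · exact le_of_tendsto' hwlim fun k => hb ⟨w k, hw k, rfl⟩
  · obtain ⟨M, hM, -, -, hrev⟩ := hX.exists_mechanism hn hc hf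
    exact ⟨M, hM, hrev.symm⟩
  · rintro _ ⟨M, hM, rfl⟩
    exact hbound M hM
  · rintro ⟨hz, hzmax⟩
    obtain ⟨M, hM, hMX, -, hrev⟩ := hz.exists_mechanism hn hc hf
    refine ⟨hz.integrable, hz.nonneg, M, ⟨hM, fun M' hM' => (hbound M' hM').trans ?_⟩, hMX⟩
    rw [hrev]
    -- A solution dominates every `w k`, hence the limit of their objectives, which is the optimal
    -- revenue per bidder.
    exact mul_le_mul_of_nonneg_left (le_of_tendsto' hwlim fun k => hzmax _ (hw k)) hn0.le
  · rintro ⟨hzi, hz0, M, ⟨hM, hopt⟩, hMX⟩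
    obtain ⟨hz, hrev⟩ := contFeasible_of_isAdmissible hn hc hf hM hzi hz0 fun t ht => by
      simp only [hMX _ t ht]
      simp [hn0.ne']
    refine ⟨hz, fun z' hz' => ?_⟩
    obtain ⟨M', hM', -, -, hrev'⟩ := hz'.exists_mechanism hn hc hf
    have := (hopt M' hM').trans hrev
    rw [hrev'] at this
    exact le_of_mul_le_mul_left this hn0

end Smoothing

end ConvexAuction

end

theorem mainTheorem10 (n : ℕ) (hn : 1 ≤ n) (c : ℝ → ℝ)
    (hc_convex : ConvexOn ℝ (Ici 0) c) (hc_mono : StrictMonoOn c (Ici 0)) (hc_zero : c 0 = 0) :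
    -- Values with a continuous density on `[0, 1]`
    (∀ f : ℝ → ℝ, ContinuousOn f (Icc 0 1) → (∀ t ∈ Ioo (0 : ℝ) 1, 0 < f t) →
      ∫ t in (0 : ℝ)..1, f t = 1 →
      -- an optimal auction exists, with revenue `n` times the supremum of the program
      (∃ opt : ℝ,
        IsLUB {r | ∃ z, ContFeasible n f z ∧ r = contObjective c f z} opt ∧
        IsGreatest {r | ∃ M : Mechanism n, IsAdmissible (Icc 0 1) (densityLaw f) c M ∧
          r = revenue (densityLaw f) M} (n * opt)) ∧
      -- every feasible `z` is the derivative of the interim allocation rule of an auction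
      (∀ z, ContFeasible n f z →
        ∃ M : Mechanism n, IsAdmissible (Icc 0 1) (densityLaw f) c M ∧
          (∀ i, ∀ t ∈ Icc (0 : ℝ) 1,
            interimAlloc (densityLaw f) M i t = ∫ τ in (0 : ℝ)..t, z τ) ∧
          (∀ v, (∀ j, v j ∈ Icc (0 : ℝ) 1) →
            ∀ i, M.pay v i = costInv c (∫ τ in (0 : ℝ)..(v i), τ * z τ)) ∧
          revenue (densityLaw f) M = n * contObjective c f z) ∧
      -- conversely, the derivative of the (average) interim allocation rule is feasible
      (∀ (M : Mechanism n) (z : ℝ → ℝ), IsAdmissible (Icc 0 1) (densityLaw f) c M →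
        IntervalIntegrable z volume 0 1 → (∀ τ ∈ Icc (0 : ℝ) 1, 0 ≤ z τ) →
        (∀ t ∈ Icc (0 : ℝ) 1,
          (∑ i, interimAlloc (densityLaw f) M i t) / n = ∫ τ in (0 : ℝ)..t, z τ) →
        ContFeasible n f z ∧ revenue (densityLaw f) M ≤ n * contObjective c f z) ∧
      -- the solutions of the program are exactly the derivatives for optimal auctions
      (∀ z, ContSolution n c f z ↔
        IntervalIntegrable z volume 0 1 ∧ (∀ τ ∈ Icc (0 : ℝ) 1, 0 ≤ z τ) ∧
          ∃ M : Mechanism n, IsOptimalAuction (Icc 0 1) (densityLaw f) c M ∧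
            ∀ i, ∀ t ∈ Icc (0 : ℝ) 1,
              interimAlloc (densityLaw f) M i t = ∫ τ in (0 : ℝ)..t, z τ)) ∧
    -- Values in `{1, …, m}` with probability mass function `f`
    (∀ (m : ℕ) (f : ℕ → ℝ), (∀ t ∈ Finset.Icc 1 m, 0 < f t) →
      ∑ t ∈ Finset.Icc 1 m, f t = 1 →
      (∃ opt : ℝ,
        IsGreatest {r | ∃ z, DiscFeasible n m f z ∧ r = discObjective m c f z} opt ∧
        IsGreatest {r | ∃ M : Mechanism n, IsAdmissible (discValues m) (massLaw m f) c M ∧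
          r = revenue (massLaw m f) M} (n * opt)) ∧
      (∀ z, DiscFeasible n m f z →
        ∃ M : Mechanism n, IsAdmissible (discValues m) (massLaw m f) c M ∧
          (∀ i, ∀ t ∈ Finset.Icc 1 m,
            interimAlloc (massLaw m f) M i t = ∑ τ ∈ Finset.Icc 1 t, z τ) ∧
          (∀ v : Fin n → ℕ, (∀ j, v j ∈ Finset.Icc 1 m) →
            ∀ i, M.pay (fun j => (v j : ℝ)) i =
              costInv c (∑ τ ∈ Finset.Icc 1 (v i), (τ : ℝ) * z τ)) ∧
          revenue (massLaw m f) M = n * discObjective m c f z) ∧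
      (∀ (M : Mechanism n) (z : ℕ → ℝ), IsAdmissible (discValues m) (massLaw m f) c M →
        (∀ t ∈ Finset.Icc 1 m,
          (∑ i, interimAlloc (massLaw m f) M i t) / n = ∑ τ ∈ Finset.Icc 1 t, z τ) →
        DiscFeasible n m f z ∧ revenue (massLaw m f) M ≤ n * discObjective m c f z) ∧
      (∀ z, DiscSolution n m c f z ↔
        ∃ M : Mechanism n, IsOptimalAuction (discValues m) (massLaw m f) c M ∧
          ∀ i, ∀ t ∈ Finset.Icc 1 m,
            interimAlloc (massLaw m f) M i t = ∑ τ ∈ Finset.Icc 1 t, z τ)) := by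
  have hc : IsCost c := ⟨hc_convex, hc_mono, hc_zero⟩
  refine ⟨fun f hfc hfp hfi => ?_, fun m f hf h1 => ?_⟩
  · have hf : IsDensity f := ⟨hfc, hfp, hfi⟩
    obtain ⟨hopt, hsol⟩ := continuous_program hn hc hf
    exact ⟨hopt, fun z hz => hz.exists_mechanism hn hc hf,
      fun M z hM hz h0 hMz => contFeasible_of_isAdmissible hn hc hf hM hz h0 hMz, hsol⟩
  · obtain ⟨hopt, hsol⟩ := discrete_program hn hc hf h1
    exact ⟨hopt, fun z hz => hz.exists_mechanism hn hc hf h1,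
      fun M z hM hMz => discFeasible_of_isAdmissible hn hc hf h1 hM hMz, hsol⟩
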